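/- Let $M$ be the closed unit disc in $\mathbb R^2$ and $SM=M\times\mathbb S^1$. Fan-beam coordinates $(\beta,\alpha)\in(\mathbb R/2\pi\mathbb Z)^2$ on $\partial SM$ stand for the base point $e^{i\beta}$ and the direction $e^{i\theta}$, $\theta=\beta+\pi+\alpha$; $\partial_+SM=\{-\pi/2\le\alpha\le\pi/2\}$ carries the measure $d\beta\,d\alpha$. All functions are complex valued. Set $$I F(\beta,\alpha)=\int_0^{2\cos\alpha}F(e^{i\beta}+te^{i\theta},\theta)\,dt,\qquad (\beta,\alpha)\in\partial_+SM,$$ $I_0f=I[f]$ for functions $f$ on $M$, and $I_\perp h=I[X_\perp h]$ with $X_\perp=\sin\theta\,\partial_x-\cos\theta\,\partial_y$. For $w$ on $\partial_+SM$ let $w_\psi$ be the function on $SM$ that is constant along the lines $t\mapsto(\mathrm x+te^{i\theta},\theta)$ and equals $w$ on $\partial_+SM$, let $u_0(\mathrm x)=\frac1{2\pi}\int_0^{2\pi}u(\mathrm x,\theta)\,d\theta$, and set $$I_0^\sharp w=2\pi\,(w_\psi)_0,\qquad I_\perp^\sharp w=-2\pi\,(X_\perp w_\psi)_0,$$ the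 latter in the sense of distributions on the interior of $M$. Let $\mathcal S(\beta,\alpha)=(\beta+\pi+2\alpha,\pi-\alpha)$; for $u$ on $\partial_+SM$ let $A_\pm u=u$ on $\partial_+SM$ and $A_\pm u=\pm u\circ\mathcal S$ on the rest of $\partial SM$; let $A_\pm^*u=(u\pm u\circ\mathcal S)|_{\partial_+SM}$ for $u$ on $\partial SM$. Let $H$ be the fibrewise Hilbert transform on $L^2(\partial SM)$, which multiplies the harmonic $e^{ik\theta}$ by $-i\,\mathrm{sgn}(k)$ (with $\mathrm{sgn}(0)=0$), and let $H_+$, $H_-$ be $H$ restricted to even, respectively odd, $k$ (and zero on the other harmonics). Put $$P_\pm^*=-A_+^*H_\pm A_-,\qquad C_+=\tfrac12A_-^*H_+A_-,\qquad P_-^\dagger=\tfrac14P_-^*,\qquad P_+^\dagger=\tfrac14P_+^*(\mathrm{Id}-12\,C_+^2).$$ Let $\dot H^1(M)$ be the space of $h\in H^1(M)$ whose boundary trace satisfies $\int_0^{2\pi}h(e^{i\beta})\,d\beta=0$; $h$ need not vanish on $\partial M$. **Proposition.** For every $f\in L^2(M)$, $I_0f$ is in $L^2(\partial_+SM)$,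 $(P_-^\dagger I_0f)_\psi$ is in $L^2(SM)$, and $$f=-\frac1{2\pi}\,I_\perp^\sharp P_-^\dagger I_0f .$$ For every $h\in\dot H^1(M)$, $I_\perp h$ is in $L^2(\partial_+SM)$, $(P_+^\dagger I_\perp h)_\psi$ is in $L^2(SM)$, and $$h=\frac1{2\pi}\,I_0^\sharp P_+^\dagger I_\perp h .$$ The first identity holds as distributions on the interior of $M$, the second almost everywhere in $M$. -/

import Mathlib

open MeasureTheory Real
open scoped Distributions LineDeriv ENNReal ContDiff

noncomputable section

namespace FanBeam

instance instFactTwoPiPos : Fact (0 < 2 * π) := ⟨Real.two_pi_pos⟩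

/-- The circle `ℝ / 2πℤ` of angles; its `volume` is arc length, of total mass `2π`. -/
abbrev Ang : Type := AddCircle (2 * π)

/-- The class of `π` in `ℝ / 2πℤ`. -/
def piAng : Ang := ((π : ℝ) : Ang)

/-- The unit vector `e^{iθ}`; the plane is identified with `ℂ` through `z = x + iy`. -/
def dir (θ : Ang) : ℂ := (AddCircle.toCircle θ : ℂ)

/-- `cos` on `ℝ / 2πℤ`. -/
def cosA (θ : Ang) : ℝ := (dir θ).re

/-- `sin` on `ℝ / 2πℤ`. -/
def sinA (θ : Ang) : ℝ := (dir θ).im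

/-- The closed unit disc `M`. -/
def disc : Set ℂ := Metric.closedBall 0 1

/-- Lebesgue measure on `M`. -/
def discMeasure : Measure ℂ := volume.restrict disc

/-- The interior of `M`. -/
def openDisc : TopologicalSpace.Opens ℂ := ⟨Metric.ball 0 1, Metric.isOpen_ball⟩

/-- Fan-beam coordinates `(β, α)` on `∂SM`: base point `e^{iβ}`, direction `e^{i(β+π+α)}`. -/
abbrev BdrySM : Type := Ang × Ang

/-- The influx boundary `∂₊SM`, that is `-π/2 ≤ α ≤ π/2` modulo `2π`. -/
def influx : Set BdrySM := {b | 0 ≤ cosA b.2}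

/-- The measure `dβ dα` on `∂₊SM`. -/
def influxMeasure : Measure BdrySM := volume.restrict influx

/-! ### The ray transform -/

/-- The (unattenuated) ray transform of a function on `SM`: the integral over the chord that starts
at `e^{iβ}` in direction `θ = β + π + α`, whose length is `2 cos α`. It is meant on `∂₊SM`. -/
def rayTransform (F : ℂ → Ang → ℂ) (b : BdrySM) : ℂ :=
  ∫ t in (0 : ℝ)..(2 * cosA b.2),
    F (dir b.1 + (t : ℂ) * dir (b.1 + piAng + b.2)) (b.1 + piAng + b.2)

/-- `I₀ f`: the ray transform of a function of position. -/
def I0 (f : ℂ → ℂ) : BdrySM → ℂ := rayTransform fun x _ => f x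

/-- `X_⊥ h = sin θ ∂ₓh - cos θ ∂_yh`, as a function on `SM`, in terms of `∂ₓh` and `∂_yh`. -/
def Xperp (hx hy : ℂ → ℂ) (x : ℂ) (θ : Ang) : ℂ := (sinA θ : ℂ) * hx x - (cosA θ : ℂ) * hy x

/-- `I_⊥ h = I (X_⊥ h)`, in terms of the weak derivatives `hx = ∂ₓh` and `hy = ∂_yh`. -/
def Iperp (hx hy : ℂ → ℂ) : BdrySM → ℂ := rayTransform (Xperp hx hy)

/-! ### The Sobolev space -/

/-- The distribution `φ ↦ ∫ φ g` on the open unit disc, for `g` locally integrable there. -/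
def toDistr (g : ℂ → ℂ) : 𝓓'(openDisc, ℂ) :=
  TestFunction.integralAgainstBilinCLM (ContinuousLinearMap.lsmul ℝ ℝ) volume g

/-- `h ∈ H¹(M)`, with weak partial derivatives `hx` and `hy`. -/
structure IsH1 (h hx hy : ℂ → ℂ) : Prop where
  memLp : MemLp h 2 discMeasure
  memLp_x : MemLp hx 2 discMeasure
  memLp_y : MemLp hy 2 discMeasure
  deriv_x : ∂_{(1 : ℂ)} (toDistr h) = toDistr hx
  deriv_y : ∂_{Complex.I} (toDistr h) = toDistr hy

/-- `g ∈ L²(∂M)` is the boundary trace of `h ∈ H¹(M)`: Green's formula holds against every function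
that is smooth up to the boundary (the outer normal at `e^{iβ}` is `(cos β, sin β)`). This
determines `g` up to a null set. -/
structure IsTrace (h hx hy : ℂ → ℂ) (g : Ang → ℂ) : Prop where
  memLp : MemLp g 2 (volume : Measure Ang)
  green_x : ∀ φ : ℂ → ℂ, ContDiff ℝ ∞ φ →
    ∫ x, (hx x * φ x + h x * fderiv ℝ φ x 1) ∂discMeasure
      = ∫ β : Ang, g β * φ (dir β) * (cosA β : ℂ)
  green_y : ∀ φ : ℂ → ℂ, ContDiff ℝ ∞ φ →
    ∫ x, (hy x * φ x + h x * fderiv ℝ φ x Complex.I) ∂discMeasure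
      = ∫ β : Ang, g β * φ (dir β) * (sinA β : ℂ)

/-- `h ∈ Ḣ¹(M)`, with weak partial derivatives `hx` and `hy`: `h ∈ H¹(M)` and the boundary trace
of `h` has integral zero. -/
structure IsHDot1 (h hx hy : ℂ → ℂ) : Prop extends IsH1 h hx hy where
  trace_mean : ∃ g : Ang → ℂ, IsTrace h hx hy g ∧ ∫ β : Ang, g β = 0

/-! ### Boundary operators

Operators act on functions on `∂SM`; elements of `L²(∂₊SM)` are functions of which only the values
on `∂₊SM` matter, and everything is insensitive to null sets. -/

/-- The scattering relation `S(β, α) = (β + π + 2α, π - α)`. -/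
def scat (b : BdrySM) : BdrySM := (b.1 + piAng + (b.2 + b.2), piAng - b.2)

open Classical in
/-- `A₊` (for `s = 1`) and `A₋` (for `s = -1`): extension from `∂₊SM` to `∂SM` that is even,
respectively odd, under the scattering relation. -/
def extA (s : ℂ) (u : BdrySM → ℂ) (b : BdrySM) : ℂ :=
  if b ∈ influx then u b else s * u (scat b)

/-- The adjoints `A₊*` (for `s = 1`) and `A₋*` (for `s = -1`). -/
def extAStar (s : ℂ) (u : BdrySM → ℂ) (b : BdrySM) : ℂ := u b + s * u (scat b)

/-- The Fourier mode `e^{i(pβ + kα)}` on `∂SM`. -/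
def mode (n : ℤ × ℤ) : C(BdrySM, ℂ) :=
  ⟨fun b => fourier n.1 b.1 * fourier n.2 b.2, by fun_prop⟩

/-- The Fourier coefficient of `e^{i(pβ + kα)}`, so that `u = ∑ modeCoeff u n • mode n`. -/
def modeCoeff (u : BdrySM → ℂ) (n : ℤ × ℤ) : ℂ :=
  (1 / (4 * π ^ 2) : ℂ) * ∫ b, mode (-n) b * u b

/-- The operator on `L²(∂SM)` that multiplies the `k`-th harmonic along the fibres by `m k`, for a
bounded `m`, through the Fourier series of `u ∈ L²(∂SM)`. On the fibre over `e^{iβ}` one has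
`θ = β + π + α`, so `e^{ikθ}` and `e^{ikα}` differ by a factor that is constant on the fibre. -/
def fiberMultiplier (m : ℤ → ℂ) (u : BdrySM → ℂ) : BdrySM → ℂ :=
  ((∑' n : ℤ × ℤ, (m n.2 * modeCoeff u n) •
    ContinuousMap.toLp 2 (volume : Measure BdrySM) ℂ (mode n) :
      Lp ℂ 2 (volume : Measure BdrySM)) : BdrySM → ℂ)

/-- The symbol `-i sgn k` of the fibrewise Hilbert transform `H`. -/
def hilbertSymbol (k : ℤ) : ℂ := -Complex.I * (Int.sign k : ℂ)

/-- `H₊`: the fibrewise Hilbert transform restricted to even harmonics. -/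
def Hplus : (BdrySM → ℂ) → BdrySM → ℂ :=
  fiberMultiplier fun k => if Even k then hilbertSymbol k else 0

/-- `H₋`: the fibrewise Hilbert transform restricted to odd harmonics. -/
def Hminus : (BdrySM → ℂ) → BdrySM → ℂ :=
  fiberMultiplier fun k => if Even k then 0 else hilbertSymbol k

/-- `P₊* = -A₊* H₊ A₋`. -/
def PplusStar (u : BdrySM → ℂ) : BdrySM → ℂ := -extAStar 1 (Hplus (extA (-1) u))

/-- `P₋* = -A₊* H₋ A₋`. -/
def PminusStar (u : BdrySM → ℂ) : BdrySM → ℂ := -extAStar 1 (Hminus (extA (-1) u))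

/-- `C₊ = ½ A₋* H₊ A₋`. -/
def Cplus (u : BdrySM → ℂ) : BdrySM → ℂ := (1 / 2 : ℂ) • extAStar (-1) (Hplus (extA (-1) u))

/-- `P₋† = ¼ P₋*`. -/
def PminusDagger (u : BdrySM → ℂ) : BdrySM → ℂ := (1 / 4 : ℂ) • PminusStar u

/-- `P₊† = ¼ P₊* (Id - 12 C₊²)`. -/
def PplusDagger (u : BdrySM → ℂ) : BdrySM → ℂ :=
  (1 / 4 : ℂ) • PplusStar (u - (12 : ℂ) • Cplus (Cplus u))

/-! ### Backprojection -/

/-- The time `x·v + √(1 - |x|² + (x·v)²)`, `v = e^{iθ}`, for which a particle at `x ∈ M` with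
direction `v` has been travelling since it entered `M`. -/
def backTime (x : ℂ) (θ : Ang) : ℝ :=
  (x * (starRingEnd ℂ) (dir θ)).re
    + √(1 - ‖x‖ ^ 2 + ((x * (starRingEnd ℂ) (dir θ)).re) ^ 2)

/-- The angle `β` of the point of `∂M` at which the line through `(x, θ)` enters `M`. -/
def entryAngle (x : ℂ) (θ : Ang) : Ang :=
  ((Complex.arg (x - (backTime x θ : ℂ) * dir θ) : ℝ) : Ang)

/-- `w_ψ`: the function on `SM` that is constant along the geodesic flow (`X w_ψ = 0`) and equals
`w` on `∂₊SM`. -/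
def psiExt (w : BdrySM → ℂ) (x : ℂ) (θ : Ang) : ℂ :=
  w (entryAngle x θ, θ - entryAngle x θ - piAng)

/-- The fibrewise average `u₀(x) = (1/2π) ∫ u(x, θ) dθ`. -/
def fiberAvg (u : ℂ → Ang → ℂ) (x : ℂ) : ℂ := (1 / (2 * π) : ℂ) * ∫ θ : Ang, u x θ

/-- `I₀^♯ w = 2π (w_ψ)₀`. -/
def I0Sharp (w : BdrySM → ℂ) (x : ℂ) : ℂ := (2 * π : ℂ) * fiberAvg (psiExt w) x

/-- The distribution `(X_⊥ u)₀ = ∂ₓ (sin θ u)₀ - ∂_y (cos θ u)₀` on the open unit disc. -/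
def avgXperp (u : ℂ → Ang → ℂ) : 𝓓'(openDisc, ℂ) :=
  ∂_{(1 : ℂ)} (toDistr (fiberAvg fun x θ => (sinA θ : ℂ) * u x θ))
    - ∂_{Complex.I} (toDistr (fiberAvg fun x θ => (cosA θ : ℂ) * u x θ))

/-- `I_⊥^♯ w = -2π (X_⊥ w_ψ)₀`, a distribution on the open unit disc. -/
def IperpSharp (w : BdrySM → ℂ) : 𝓓'(openDisc, ℂ) := (-(2 * π)) • avgXperp (psiExt w)

end FanBeam

end

open MeasureTheory Real
open scoped Distributions LineDeriv ENNReal ContDiff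

noncomputable section

namespace FanBeam

/-! ### The unit vectors -/

/-! Both identities are tested against the ridge functions U_n(Im(x e^{-iφ})), with U_n the
Chebyshev polynomial of the second kind. These generate all polynomials in x and its conjugate, so
an integrable function on the disc orthogonal to all of them vanishes
(`ae_eq_zero_of_integral_ridge`). Neither f nor h is ever expanded in a series.

In the coordinates θ = β + π + α and γ = π/2 - α, the signed distance of a ray from the origin is s
= sin α = cos γ. The scattering relation fixes θ and sends γ to -γ, and a fibrewise multiplier m
acts on e^{ipθ} e^{iqγ} as m(p - q). Hence the boundary operators are diagonal between e^{ipθ}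
sin(qγ) (`sinE`) and e^{ipθ} cos(qγ) (`cosE`). The ray transform of a ridge function is a finite sum
of the modes e^{ipθ} sin((n+1)γ), p = n - 2j with 0 ≤ j ≤ n (`I0_ridge`). Summing the backprojected
harmonics e^{ipθ} U_n(s) over these p gives the ridge function back, by the reproducing property of
the Dirichlet sum (`integral_dsum_mul`). Santaló's formula dx dθ = cos α dβ dα dt supplies the L²
bounds and the duality between I and the extension along rays.

For f: P₋† turns the sine into -1/2 times the cosine, that is, into e^{ipθ} T_{n+1}(s). The function
s decreases at unit rate along X_⊥, so integration by parts against a test function produces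
T_{n+1}' = (n+1) U_n. By transposition, the pairing with a test function φ is an integral of f
against a density, and the ridge functions identify this density as -2πφ (`integral_testDensity`).

For h: backprojection brings in the factor cos α = sin γ, and 2 sin γ sin((n+1)γ) = cos(nγ) -
cos((n+2)γ). The transpose of P₊† multiplies by -1/2 while turning cosine into sine, except on the
edge modes |p| = q > 0, where the term -12 C₊² changes the multiplier from -1/4 to -1. Green's
formula then yields interior terms, which combine through U_{n+1}' - U_{n-1}' = 2(n+1) U_n, and
boundary terms. The edge multiplier -1 is exactly the value that makes the boundary terms cancel
(`bdryMoment_cancel`), so h need not vanish on the boundary. The only exception is n = 0, where the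
boundary term is a multiple of the mean of the trace. -/

lemma dir_add (a b : Ang) : dir (a + b) = dir a * dir b := by
  simp [dir, AddCircle.toCircle_add]

lemma dir_coe (a : ℝ) : dir (a : Ang) = Complex.exp (a * Complex.I) := by
  simp only [dir]
  rw [AddCircle.toCircle_apply_mk, Circle.coe_exp]
  congr 2
  rw [div_self (by positivity), one_mul]

lemma dir_zero : dir 0 = 1 := by simp [dir]

lemma norm_dir (a : Ang) : ‖dir a‖ = 1 := Circle.norm_coe _

lemma dir_ne_zero (a : Ang) : dir a ≠ 0 := by
  intro h; simpa [h] using norm_dir a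

lemma dir_neg (a : Ang) : dir (-a) = (dir a)⁻¹ := by
  apply eq_inv_of_mul_eq_one_left
  rw [← dir_add, neg_add_cancel, dir_zero]

lemma conj_dir (a : Ang) : (starRingEnd ℂ) (dir a) = (dir a)⁻¹ := by
  rw [Complex.inv_def, Complex.normSq_eq_norm_sq, norm_dir]; simp

lemma dir_sub (a b : Ang) : dir (a - b) = dir a * (dir b)⁻¹ := by
  rw [sub_eq_add_neg, dir_add, dir_neg]

lemma dir_pi : dir piAng = -1 := by
  rw [piAng, dir_coe, Complex.exp_pi_mul_I]

lemma dir_injective : Function.Injective dir := fun a b h =>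
  AddCircle.injective_toCircle (by positivity) (Subtype.ext h)

@[fun_prop]
lemma continuous_dir : Continuous dir := by
  unfold dir
  exact continuous_subtype_val.comp AddCircle.continuous_toCircle

@[fun_prop]
lemma continuous_cosA : Continuous cosA := by unfold cosA; fun_prop

@[fun_prop]
lemma continuous_sinA : Continuous sinA := by unfold sinA; fun_prop

@[fun_prop]
lemma measurable_cosA : Measurable cosA := continuous_cosA.measurable

lemma cosA_coe (a : ℝ) : cosA (a : Ang) = Real.cos a := by
  rw [cosA, dir_coe, Complex.exp_ofReal_mul_I_re]

lemma sinA_coe (a : ℝ) : sinA (a : Ang) = Real.sin a := by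
  rw [sinA, dir_coe, Complex.exp_ofReal_mul_I_im]

lemma cosA_sq_add_sinA_sq (a : Ang) : cosA a ^ 2 + sinA a ^ 2 = 1 := by
  have := norm_dir a
  rw [← sq_eq_sq₀ (by positivity) (by positivity), ← Complex.normSq_eq_norm_sq,
    Complex.normSq_apply] at this
  simp only [cosA, sinA]; linarith

lemma dir_eq (a : Ang) : dir a = (cosA a : ℂ) + (sinA a : ℂ) * Complex.I := by
  rw [cosA, sinA, Complex.re_add_im]

lemma dir_inv_eq (a : Ang) : (dir a)⁻¹ = (cosA a : ℂ) - (sinA a : ℂ) * Complex.I := by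
  rw [← conj_dir, dir_eq]; simp [sub_eq_add_neg]

lemma piAng_add_piAng : piAng + piAng = 0 :=
  dir_injective (by rw [dir_add, dir_pi, dir_zero]; norm_num)

lemma cosA_piAng_sub (a : Ang) : cosA (piAng - a) = -cosA a := by
  rw [cosA, dir_sub, dir_pi, dir_inv_eq]; simp

lemma abs_cosA_le (a : Ang) : |cosA a| ≤ 1 := by
  rw [cosA]; exact (Complex.abs_re_le_norm _).trans (norm_dir a).le

lemma abs_sinA_le (a : Ang) : |sinA a| ≤ 1 := by
  rw [sinA]; exact (Complex.abs_im_le_norm _).trans (norm_dir a).le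

/-! ### Chords -/

/-- The direction `θ = β + π + α` of the ray with fan-beam coordinates `(β, α)`. -/
def rayDir (b : BdrySM) : Ang := b.1 + piAng + b.2

/-- The point reached at time `t` on a ray, with its direction. -/
def chord (p : BdrySM × ℝ) : ℂ × Ang := (dir p.1.1 + (p.2 : ℂ) * dir (rayDir p.1), rayDir p.1)

/-- The fan-beam coordinates of the line through a point of `SM`. -/
def entry (p : ℂ × Ang) : BdrySM := (entryAngle p.1 p.2, p.2 - entryAngle p.1 p.2 - piAng)

@[fun_prop]
lemma continuous_rayDir : Continuous rayDir := by unfold rayDir; fun_prop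

@[fun_prop]
lemma continuous_chord : Continuous chord := by unfold chord; fun_prop

@[fun_prop]
lemma measurable_chord : Measurable chord := continuous_chord.measurable

lemma measurable_coe_ang : Measurable (fun a : ℝ => (a : Ang)) := AddCircle.measurable_mk'

@[fun_prop]
lemma measurable_entry : Measurable entry := by
  have h1 : Measurable fun p : ℂ × Ang => backTime p.1 p.2 := by
    unfold backTime
    fun_prop
  have h2 : Measurable fun p : ℂ × Ang => entryAngle p.1 p.2 := by
    unfold entryAngle
    refine measurable_coe_ang.comp (Complex.measurable_arg.comp ?_)
    fun_prop
  unfold entry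
  fun_prop

/-- The signed distance `Im (x e^{-iθ})` from the origin to the line through `x` in direction `θ`. -/
def offset (x : ℂ) (θ : Ang) : ℝ := (x * (dir θ)⁻¹).im

@[fun_prop]
lemma continuous_offset : Continuous fun p : ℂ × Ang => offset p.1 p.2 := by
  have h : ∀ p : ℂ × Ang, offset p.1 p.2 = (p.1 * (starRingEnd ℂ) (dir p.2)).im := fun p => by
    rw [offset, conj_dir]
  simp only [h]
  fun_prop

/-- Rotating the ray direction onto the positive real axis sends e^{iβ} to -e^{-iα}. In this frame
the chord is horizontal at height sin α, with its midpoint on the imaginary axis. -/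
lemma chord_mul_inv (b : BdrySM) (t : ℝ) :
    (chord (b, t)).1 * (dir (rayDir b))⁻¹ = (t - cosA b.2 : ℝ) + (sinA b.2 : ℂ) * Complex.I := by
  have h1 := dir_ne_zero (rayDir b)
  have h2 : dir b.1 * (dir (rayDir b))⁻¹ = -(dir b.2)⁻¹ := by
    rw [rayDir, dir_add, dir_add, dir_pi]
    field_simp [dir_ne_zero b.1, dir_ne_zero b.2]
  simp only [chord]
  rw [add_mul, mul_assoc, mul_inv_cancel₀ h1, h2, dir_inv_eq]
  push_cast; ring

lemma offset_chord (b : BdrySM) (t : ℝ) : offset (chord (b, t)).1 (rayDir b) = sinA b.2 := by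
  rw [offset, chord_mul_inv]; simp

lemma normSq_chord (b : BdrySM) (t : ℝ) :
    ‖(chord (b, t)).1‖ ^ 2 = (t - cosA b.2) ^ 2 + sinA b.2 ^ 2 := by
  have h : ‖(chord (b, t)).1‖ = ‖(chord (b, t)).1 * (dir (rayDir b))⁻¹‖ := by
    rw [norm_mul, norm_inv, norm_dir]; simp
  rw [h, chord_mul_inv, ← Complex.normSq_eq_norm_sq, Complex.normSq_add_mul_I]

/-- The square root in `backTime` becomes √(cos² α), which is cos α exactly because the ray is
incoming. The time t is arbitrary, since points of the whole line have the same entry point. -/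
lemma entry_chord {b : BdrySM} (hb : 0 ≤ cosA b.2) (t : ℝ) : entry (chord (b, t)) = b := by
  have hre : ((chord (b, t)).1 * (starRingEnd ℂ) (dir (rayDir b))).re = t - cosA b.2 := by
    rw [conj_dir, chord_mul_inv]; simp
  have hback : backTime (chord (b, t)).1 (rayDir b) = t := by
    rw [backTime, hre, normSq_chord]
    have : 1 - ((t - cosA b.2) ^ 2 + sinA b.2 ^ 2) + (t - cosA b.2) ^ 2 = cosA b.2 ^ 2 := by
      linarith [cosA_sq_add_sinA_sq b.2]
    rw [this, Real.sqrt_sq hb]; ring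
  have hang : entryAngle (chord (b, t)).1 (rayDir b) = b.1 := by
    apply dir_injective
    rw [entryAngle, hback]
    have : (chord (b, t)).1 - (t : ℂ) * dir (rayDir b) = dir b.1 := by simp [chord]
    rw [this, dir_coe]
    have h := Complex.norm_mul_exp_arg_mul_I (dir b.1)
    rwa [norm_dir, Complex.ofReal_one, one_mul] at h
  have h2 : (chord (b, t)).2 = rayDir b := rfl
  rw [entry, h2, hang]
  refine Prod.ext rfl ?_
  simp only [rayDir]; abel

/-! ### Santaló's formula -/

/-- Fubini over horizontal slices, with the height written as sin a; the weight cos a is the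
Jacobian of this substitution. -/
lemma lintegral_disc_eq (F : ℂ → ℝ≥0∞) (hF : Measurable F) :
    ∫⁻ x, F x ∂discMeasure =
      ∫⁻ a in Set.Ioo (-(π / 2)) (π / 2), ENNReal.ofReal (Real.cos a) *
        ∫⁻ t in Set.Ioc 0 (2 * Real.cos a),
          F (((t - Real.cos a : ℝ) : ℂ) + (Real.sin a : ℂ) * Complex.I) := by
  have hdisc : MeasurableSet disc := Metric.isClosed_closedBall.measurableSet
  have hmk : Measurable fun p : ℝ × ℝ => (p.1 : ℂ) + (p.2 : ℂ) * Complex.I := by fun_prop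
  rw [discMeasure, ← lintegral_indicator hdisc,
    ← (Complex.volume_preserving_equiv_real_prod.symm).lintegral_comp_emb
      Complex.measurableEquivRealProd.symm.measurableEmbedding]
  have hmeas : Measurable fun p : ℝ × ℝ => disc.indicator F ((p.1 : ℂ) + (p.2 : ℂ) * Complex.I) :=
    (hF.indicator hdisc).comp hmk
  have e1 : ∀ p : ℝ × ℝ, Complex.measurableEquivRealProd.symm p
      = (p.1 : ℂ) + (p.2 : ℂ) * Complex.I := fun p => by
    apply Complex.ext <;> simp [Complex.measurableEquivRealProd]
  simp only [e1]
  rw [Measure.volume_eq_prod, lintegral_prod_symm _ hmeas.aemeasurable]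
  set G : ℝ → ℝ≥0∞ := fun s => ∫⁻ r : ℝ, disc.indicator F ((r : ℂ) + (s : ℂ) * Complex.I) with hG
  have hsupp : ∀ s, s ∉ Set.Icc (-1 : ℝ) 1 → G s = 0 := by
    intro s hs
    simp only [hG]
    rw [lintegral_eq_zero_iff (by fun_prop)]
    refine Filter.Eventually.of_forall fun r => Set.indicator_of_notMem (fun hmem => hs ?_) _
    have h1 : ‖(r : ℂ) + s * Complex.I‖ ≤ 1 := by simpa [disc] using hmem
    have h2 := (Complex.abs_im_le_norm ((r : ℂ) + s * Complex.I)).trans h1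
    simp at h2
    exact abs_le.mp h2
  have h1 : ∫⁻ s, G s = ∫⁻ s in Set.Ioo (-1 : ℝ) 1, G s := by
    rw [setLIntegral_congr Ioo_ae_eq_Icc, ← lintegral_indicator measurableSet_Icc]
    congr 1; ext s
    by_cases hs : s ∈ Set.Icc (-1 : ℝ) 1
    · rw [Set.indicator_of_mem hs]
    · rw [Set.indicator_of_notMem hs, hsupp s hs]
  have himg : Real.sin '' Set.Ioo (-(π / 2)) (π / 2) = Set.Ioo (-1) 1 :=
    Real.sinPartialHomeomorph.image_source_eq_target
  change ∫⁻ s, G s = _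
  rw [h1, ← himg, lintegral_image_eq_lintegral_abs_deriv_mul measurableSet_Ioo
    (fun x _ => (Real.hasDerivAt_sin x).hasDerivWithinAt)
    (Real.injOn_sin.mono Set.Ioo_subset_Icc_self)]
  refine setLIntegral_congr_fun measurableSet_Ioo fun a ha => ?_
  have hc : 0 < Real.cos a := Real.cos_pos_of_mem_Ioo ha
  simp only [abs_of_pos hc]
  congr 1
  simp only [hG]
  -- Translating by cos a makes the slice start at time 0.
  rw [← lintegral_sub_right_eq_self _ (Real.cos a), setLIntegral_congr Ioc_ae_eq_Icc,
    ← lintegral_indicator measurableSet_Icc]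
  congr 1; ext t
  have hiff : (((t - Real.cos a : ℝ) : ℂ) + (Real.sin a : ℂ) * Complex.I) ∈ disc ↔
      t ∈ Set.Icc 0 (2 * Real.cos a) := by
    rw [disc, mem_closedBall_zero_iff, ← sq_le_one_iff₀ (norm_nonneg _),
      ← Complex.normSq_eq_norm_sq, Complex.normSq_add_mul_I, Set.mem_Icc]
    have := Real.sin_sq_add_cos_sq a
    constructor
    · intro h
      have : |t - Real.cos a| ≤ |Real.cos a| := sq_le_sq.mp (by linarith)
      rw [abs_of_pos hc, abs_le] at this
      constructor <;> linarith
    · rintro ⟨h1, h2⟩; nlinarith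
  by_cases ht : t ∈ Set.Icc 0 (2 * Real.cos a)
  · rw [Set.indicator_of_mem ht, Set.indicator_of_mem (hiff.mpr ht)]
  · rw [Set.indicator_of_notMem ht, Set.indicator_of_notMem (mt hiff.mp ht)]

lemma measurableSet_influx : MeasurableSet influx :=
  measurableSet_le measurable_const (by fun_prop)

lemma setLIntegral_cosA (G : Ang → ℝ≥0∞) :
    ∫⁻ α in {α | 0 ≤ cosA α}, G α = ∫⁻ a in Set.Ioo (-(π / 2)) (π / 2), G (a : Ang) := by
  have hm : MeasurableSet {α : Ang | 0 ≤ cosA α} := measurableSet_le measurable_const (by fun_prop)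
  rw [← lintegral_indicator hm, ← AddCircle.lintegral_preimage (2 * π) (-π),
    setLIntegral_congr Ioo_ae_eq_Icc, ← lintegral_indicator measurableSet_Ioc,
    ← lintegral_indicator measurableSet_Icc]
  have hpi := Real.pi_pos
  rw [show -π + 2 * π = π by ring]
  have hae : ∀ᵐ a : ℝ, a ≠ -π := by simp [ae_iff]
  refine lintegral_congr_ae ?_
  filter_upwards [hae] with a ha
  by_cases h1 : a ∈ Set.Icc (-(π / 2)) (π / 2)
  · rw [Set.indicator_of_mem h1, Set.indicator_of_mem (by constructor <;> linarith [h1.1, h1.2]),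
      Set.indicator_of_mem]
    change 0 ≤ cosA _
    rw [cosA_coe]; exact Real.cos_nonneg_of_mem_Icc h1
  · rw [Set.indicator_of_notMem h1]
    by_cases h2 : a ∈ Set.Ioc (-π) π
    · rw [Set.indicator_of_mem h2, Set.indicator_of_notMem]
      change ¬ (0 ≤ cosA _)
      rw [cosA_coe, not_le]
      rw [Set.mem_Icc, not_and_or, not_le, not_le] at h1
      rcases h1 with h1 | h1
      · rw [← Real.cos_neg]
        exact Real.cos_neg_of_pi_div_two_lt_of_lt (by linarith) (by linarith [h2.1])
      · exact Real.cos_neg_of_pi_div_two_lt_of_lt h1 (by linarith [h2.2])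
    · rw [Set.indicator_of_notMem h2]

lemma influxMeasure_eq : influxMeasure =
    (volume : Measure Ang).prod (volume.restrict {α : Ang | 0 ≤ cosA α}) := by
  have h : influx = Set.univ ×ˢ {α : Ang | 0 ≤ cosA α} :=
    Set.ext fun b => ⟨fun h => ⟨trivial, h⟩, fun h => h.2⟩
  rw [influxMeasure, Measure.volume_eq_prod, h, ← Measure.prod_restrict, Measure.restrict_univ]

lemma measurable_setLIntegral_Ioc {X : Type*} [MeasurableSpace X] {K : X × ℝ → ℝ≥0∞}
    (hK : Measurable K) {c : X → ℝ} (hc : Measurable c) :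
    Measurable fun x => ∫⁻ t in Set.Ioc 0 (c x), K (x, t) := by
  have hS : MeasurableSet {p : X × ℝ | p.2 ∈ Set.Ioc 0 (c p.1)} :=
    (measurableSet_lt measurable_const measurable_snd).inter
      (measurableSet_le measurable_snd (hc.comp measurable_fst))
  have h : (fun x => ∫⁻ t in Set.Ioc 0 (c x), K (x, t)) =
      fun x => ∫⁻ t, ({p : X × ℝ | p.2 ∈ Set.Ioc 0 (c p.1)}.indicator K) (x, t) := by
    ext x
    rw [← lintegral_indicator measurableSet_Ioc]
    rfl
  rw [h]
  exact (hK.indicator hS).lintegral_prod_right'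

lemma lintegral_disc_rotate (F : ℂ → ℝ≥0∞) (θ : Ang) :
    ∫⁻ x, F (x * dir θ) ∂discMeasure = ∫⁻ x, F x ∂discMeasure := by
  have h := ((rotation (AddCircle.toCircle θ)).measurePreserving).restrict_preimage
    (s := disc) Metric.isClosed_closedBall.measurableSet
  have hpre : (rotation (AddCircle.toCircle θ)) ⁻¹' disc = disc := by
    ext x
    rw [Set.mem_preimage, disc, mem_closedBall_zero_iff, mem_closedBall_zero_iff,
      LinearIsometryEquiv.norm_map]
  rw [hpre] at h
  conv_rhs => rw [discMeasure, ← h.lintegral_comp_emb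
    (rotation (AddCircle.toCircle θ)).toHomeomorph.measurableEmbedding]
  simp only [rotation_apply, dir, mul_comm, discMeasure]

/-- For fixed θ, putting β = θ - π - a turns the chords of direction θ into the horizontal chords
rotated by e^{iθ}, which reduces Santaló's formula to horizontal slicing. -/
lemma chord_sub (θ : Ang) (a t : ℝ) :
    chord ((θ - (piAng + (a : Ang)), (a : Ang)), t) =
      ((((t - Real.cos a : ℝ) : ℂ) + (Real.sin a : ℂ) * Complex.I) * dir θ, θ) := by
  have h2 : rayDir (θ - (piAng + (a : Ang)), (a : Ang)) = θ := by
    simp only [rayDir]; abel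
  have h := chord_mul_inv (θ - (piAng + (a : Ang)), (a : Ang)) t
  rw [h2, ← div_eq_mul_inv, div_eq_iff (dir_ne_zero θ)] at h
  refine Prod.ext ?_ h2
  rw [h, cosA_coe, sinA_coe]

/-- Santaló's formula. -/
lemma lintegral_santalo (F : ℂ × Ang → ℝ≥0∞) (hF : Measurable F) :
    ∫⁻ p, F p ∂(discMeasure.prod volume) =
      ∫⁻ b : BdrySM, ENNReal.ofReal (cosA b.2) *
        ∫⁻ t : ℝ in Set.Ioc 0 (2 * cosA b.2), F (chord (b, t)) ∂volume ∂influxMeasure := by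
  have : SFinite discMeasure := by unfold discMeasure; infer_instance
  have hK : Measurable fun b : BdrySM => ENNReal.ofReal (cosA b.2) *
        ∫⁻ t : ℝ in Set.Ioc 0 (2 * cosA b.2), F (chord (b, t)) :=
    Measurable.mul (by fun_prop)
      (measurable_setLIntegral_Ioc (hF.comp measurable_chord) (by fun_prop))
  rw [lintegral_prod_symm _ hF.aemeasurable, influxMeasure_eq,
    lintegral_prod_symm _ hK.aemeasurable, setLIntegral_cosA]
  have h1 : ∀ θ : Ang, ∫⁻ x, F (x, θ) ∂discMeasure =
      ∫⁻ a in Set.Ioo (-(π / 2)) (π / 2), ENNReal.ofReal (Real.cos a) *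
        ∫⁻ t in Set.Ioc 0 (2 * Real.cos a), F (chord ((θ - (piAng + (a : Ang)), (a : Ang)), t)) := by
    intro θ
    rw [← lintegral_disc_rotate _ θ, lintegral_disc_eq _ (by fun_prop)]
    simp only [chord_sub]
  simp only [h1]
  have hco := measurable_coe_ang
  -- With a outermost, θ and β differ by a translation of the circle, which preserves arc length.
  rw [lintegral_lintegral_swap]
  · refine lintegral_congr fun a => ?_
    simp only [cosA_coe]
    exact lintegral_sub_right_eq_self (fun β : Ang => ENNReal.ofReal (Real.cos a) *
      ∫⁻ t : ℝ in Set.Ioc 0 (2 * Real.cos a), F (chord ((β, (a : Ang)), t))) (piAng + (a : Ang))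
  · refine Measurable.aemeasurable (Measurable.mul (by fun_prop) ?_)
    refine measurable_setLIntegral_Ioc
      (K := fun q : (Ang × ℝ) × ℝ =>
        F (chord ((q.1.1 - (piAng + (q.1.2 : Ang)), (q.1.2 : Ang)), q.2)))
      (hF.comp (measurable_chord.comp ?_)) (by fun_prop)
    fun_prop

/-! ### The phase space measure and the chord measure -/

/-- Lebesgue measure on `SM`. -/
def phaseMeasure : Measure (ℂ × Ang) := discMeasure.prod volume

instance : IsFiniteMeasure discMeasure := by
  unfold discMeasure
  exact isFiniteMeasure_restrict.mpr
    (isCompact_closedBall (0 : ℂ) 1).measure_lt_top.ne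

instance : IsFiniteMeasure phaseMeasure := by unfold phaseMeasure; infer_instance

instance : IsFiniteMeasure influxMeasure := by unfold influxMeasure; infer_instance

/-- The measure `dβ dα dt` on the set of all points of all chords. -/
def chordMeasure : Measure (BdrySM × ℝ) :=
  (influxMeasure.prod volume).restrict {p | p.2 ∈ Set.Ioc 0 (2 * cosA p.1.2)}

lemma measurableSet_chordSet :
    MeasurableSet {p : BdrySM × ℝ | p.2 ∈ Set.Ioc 0 (2 * cosA p.1.2)} :=
  (measurableSet_lt measurable_const measurable_snd).inter
    (measurableSet_le measurable_snd (by fun_prop))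

lemma lintegral_chordMeasure {K : BdrySM × ℝ → ℝ≥0∞} (hK : Measurable K) :
    ∫⁻ q, K q ∂chordMeasure =
      ∫⁻ b : BdrySM, ∫⁻ t : ℝ in Set.Ioc 0 (2 * cosA b.2), K (b, t) ∂volume ∂influxMeasure := by
  rw [chordMeasure, ← lintegral_indicator measurableSet_chordSet,
    lintegral_prod _ (hK.indicator measurableSet_chordSet).aemeasurable]
  refine lintegral_congr fun b => ?_
  rw [← lintegral_indicator measurableSet_Ioc]
  rfl

lemma ae_chordMeasure_pos : ∀ᵐ q ∂chordMeasure, 0 < cosA q.1.2 := by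
  refine (ae_restrict_mem measurableSet_chordSet).mono fun q hq => ?_
  have h := hq.1.trans_le hq.2
  linarith

lemma map_chord : Measure.map chord
    (chordMeasure.withDensity fun q => ENNReal.ofReal (cosA q.1.2)) = phaseMeasure := by
  refine Measure.ext_of_lintegral _ fun F hF => ?_
  rw [lintegral_map hF measurable_chord, lintegral_withDensity_eq_lintegral_mul _ (by fun_prop)
    (by fun_prop), lintegral_chordMeasure (by fun_prop), phaseMeasure,
    lintegral_santalo F hF]
  refine lintegral_congr fun b => ?_
  rw [← lintegral_const_mul _ (by fun_prop)]
  rfl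

/-- The density cos α is positive on every chord of positive length, so it does not enlarge the null
sets. This makes the restriction of an almost everywhere defined function on SM to almost every
chord meaningful. -/
lemma quasiMeasurePreserving_chord :
    Measure.QuasiMeasurePreserving chord chordMeasure phaseMeasure := by
  refine ⟨measurable_chord, ?_⟩
  rw [← map_chord]
  refine Measure.AbsolutelyContinuous.map ?_ measurable_chord
  refine withDensity_absolutelyContinuous' (by fun_prop) ?_
  filter_upwards [ae_chordMeasure_pos] with q hq
  simpa using hq

/-- The density is the chord length 2 cos α times the Santaló weight cos α. Being at most 2, it
makes constant extension along rays bounded on L². -/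
lemma map_entry : Measure.map entry phaseMeasure =
    influxMeasure.withDensity fun b => ENNReal.ofReal (2 * cosA b.2 ^ 2) := by
  refine Measure.ext_of_lintegral _ fun F hF => ?_
  rw [lintegral_map hF measurable_entry, lintegral_withDensity_eq_lintegral_mul _ (by fun_prop) hF,
    phaseMeasure, lintegral_santalo (fun p => F (entry p)) (hF.comp measurable_entry)]
  refine lintegral_congr_ae ?_
  filter_upwards [ae_restrict_mem measurableSet_influx] with b hb
  have hb' : 0 ≤ cosA b.2 := hb
  simp only [entry_chord hb', lintegral_const, Measure.restrict_apply_univ,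
    Real.volume_Ioc, Pi.mul_apply]
  rw [mul_comm (F b), ← mul_assoc, ← ENNReal.ofReal_mul hb']
  ring_nf

lemma quasiMeasurePreserving_entry :
    Measure.QuasiMeasurePreserving entry phaseMeasure influxMeasure := by
  refine ⟨measurable_entry, ?_⟩
  rw [map_entry]
  exact withDensity_absolutelyContinuous _ _

lemma memLp_comp_entry {w : BdrySM → ℂ} (hw : MemLp w 2 influxMeasure) :
    MemLp (fun p => w (entry p)) 2 phaseMeasure := by
  refine MemLp.comp_of_map (f := entry) ?_ measurable_entry.aemeasurable
  refine hw.of_measure_le_smul (c := 2) (by simp) ?_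
  rw [map_entry]
  have h : (2 : ℝ≥0∞) • influxMeasure = influxMeasure.withDensity fun _ => 2 := by
    rw [withDensity_const]
  rw [h]
  refine withDensity_mono (Filter.Eventually.of_forall fun b => ?_)
  change ENNReal.ofReal _ ≤ _
  rw [show (2 : ℝ≥0∞) = ENNReal.ofReal 2 by simp]
  apply ENNReal.ofReal_le_ofReal
  have := cosA_sq_add_sinA_sq b.2
  nlinarith [sq_nonneg (sinA b.2)]

/-- In the frame rotated by e^{-iθ} the point is z and the line enters the disc at -√(1 - (Im z)²) +
i Im z. -/
lemma chord_entry {p : ℂ × Ang} (hp : p.1 ∈ disc) :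
    0 ≤ cosA (entry p).2 ∧ chord (entry p, backTime p.1 p.2) = p := by
  obtain ⟨x, θ⟩ := p
  have hx : ‖x‖ ≤ 1 := by simpa [disc] using hp
  set z := x * (dir θ)⁻¹ with hz
  have hxz : x = z * dir θ := by rw [hz, mul_assoc, inv_mul_cancel₀ (dir_ne_zero θ), mul_one]
  have hnz : ‖z‖ = ‖x‖ := by rw [hz, norm_mul, norm_inv, norm_dir]; simp
  have hsq : ‖x‖ ^ 2 = z.re ^ 2 + z.im ^ 2 := by
    rw [← hnz, ← Complex.normSq_eq_norm_sq, Complex.normSq_apply]; ring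
  set c := √(1 - z.im ^ 2) with hc
  have hc0 : 0 ≤ c := Real.sqrt_nonneg _
  have hc2 : c ^ 2 = 1 - z.im ^ 2 := Real.sq_sqrt (by nlinarith [sq_nonneg z.re, norm_nonneg x])
  have hback : backTime x θ = z.re + c := by
    rw [backTime, conj_dir, ← hz, hsq, hc]; congr 2; ring
  have hdir : dir (entryAngle x θ) = x - (backTime x θ : ℂ) * dir θ := by
    have h1 : x - (backTime x θ : ℂ) * dir θ = (((-c : ℝ) : ℂ) + (z.im : ℂ) * Complex.I) * dir θ := by
      rw [hback]
      nth_rewrite 1 [hxz, ← Complex.re_add_im z]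
      push_cast; ring
    have h2 : ‖x - (backTime x θ : ℂ) * dir θ‖ = 1 := by
      rw [h1, norm_mul, norm_dir, mul_one, ← sq_eq_sq₀ (by positivity) (by positivity),
        ← Complex.normSq_eq_norm_sq, Complex.normSq_add_mul_I]
      linarith
    rw [entryAngle, dir_coe]
    have h := Complex.norm_mul_exp_arg_mul_I (x - (backTime x θ : ℂ) * dir θ)
    rwa [h2, Complex.ofReal_one, one_mul] at h
  have hray : rayDir (entry (x, θ)) = θ := by
    simp only [rayDir, entry]; abel
  have hch : chord (entry (x, θ), backTime x θ) = (x, θ) := by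
    refine Prod.ext ?_ hray
    simp only [chord, hray]
    have : (entry (x, θ)).1 = entryAngle x θ := rfl
    rw [this, hdir]; ring
  refine ⟨?_, hch⟩
  have h := chord_mul_inv (entry (x, θ)) (backTime x θ)
  rw [hch, hray] at h
  have h2 := congrArg Complex.re h
  simp only [← hz] at h2
  simp at h2
  rw [hback] at h2
  linarith

lemma rayDir_entry (p : ℂ × Ang) : rayDir (entry p) = p.2 := by
  simp only [rayDir, entry]; abel

lemma sinA_entry {p : ℂ × Ang} (hp : p.1 ∈ disc) : sinA (entry p).2 = offset p.1 p.2 := by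
  have h := (chord_entry hp).2
  rw [← offset_chord (entry p) (backTime p.1 p.2), h, rayDir_entry]

/-! ### Mapping properties of the ray transform -/

lemma rayTransform_eq {b : BdrySM} (hb : 0 ≤ cosA b.2) (F : ℂ × Ang → ℂ) :
    rayTransform (fun x θ => F (x, θ)) b = ∫ t in Set.Ioc 0 (2 * cosA b.2), F (chord (b, t)) := by
  rw [rayTransform, intervalIntegral.integral_of_le (by linarith)]
  rfl

lemma ae_chord_congr {F G : ℂ × Ang → ℂ} (h : F =ᵐ[phaseMeasure] G) :
    ∀ᵐ b ∂influxMeasure, ∀ᵐ t ∂(volume.restrict (Set.Ioc 0 (2 * cosA b.2))),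
      F (chord (b, t)) = G (chord (b, t)) := by
  have h1 : ∀ᵐ q ∂chordMeasure, F (chord q) = G (chord q) :=
    quasiMeasurePreserving_chord.ae_eq_comp h
  rw [chordMeasure, ae_restrict_iff' measurableSet_chordSet] at h1
  filter_upwards [Measure.ae_ae_of_ae_prod h1] with b hb
  rw [ae_restrict_iff' measurableSet_Ioc]
  exact hb

lemma aestronglyMeasurable_rayTransform {F : ℂ × Ang → ℂ}
    (hF : AEStronglyMeasurable F phaseMeasure) :
    AEStronglyMeasurable (rayTransform fun x θ => F (x, θ)) influxMeasure := by
  have h1 : AEStronglyMeasurable (fun q => F (chord q)) chordMeasure :=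
    hF.comp_quasiMeasurePreserving quasiMeasurePreserving_chord
  rw [chordMeasure, ← aestronglyMeasurable_indicator_iff measurableSet_chordSet] at h1
  refine h1.integral_prod_right'.congr ?_
  filter_upwards [ae_restrict_mem measurableSet_influx] with b hi
  rw [rayTransform_eq hi, ← integral_indicator measurableSet_Ioc]
  rfl

/-- Cauchy–Schwarz on each chord costs its length 2 cos α, which is twice the Santaló weight. -/
lemma lintegral_chord_sq_le {F : ℂ × Ang → ℂ} (hF : AEStronglyMeasurable F phaseMeasure) :
    ∫⁻ b : BdrySM, (∫⁻ t : ℝ in Set.Ioc 0 (2 * cosA b.2), ‖F (chord (b, t))‖ₑ) ^ (2 : ℝ)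
      ∂influxMeasure ≤ 2 * ∫⁻ p, ‖F p‖ₑ ^ (2 : ℝ) ∂phaseMeasure := by
  obtain ⟨G, hG, hFG⟩ := hF
  have hGm : Measurable fun p => ‖G p‖ₑ := hG.measurable.enorm
  have e1 : ∫⁻ p, ‖F p‖ₑ ^ (2 : ℝ) ∂phaseMeasure = ∫⁻ p, ‖G p‖ₑ ^ (2 : ℝ) ∂phaseMeasure :=
    lintegral_congr_ae (hFG.mono fun p hp => by simp only [hp])
  rw [e1, phaseMeasure, lintegral_santalo _ (by fun_prop), ← lintegral_const_mul]
  · refine lintegral_mono_ae ?_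
    filter_upwards [ae_chord_congr hFG, ae_restrict_mem measurableSet_influx] with b hb hi
    have hi' : 0 ≤ cosA b.2 := hi
    have e2 : ∫⁻ t : ℝ in Set.Ioc 0 (2 * cosA b.2), ‖F (chord (b, t))‖ₑ =
        ∫⁻ t : ℝ in Set.Ioc 0 (2 * cosA b.2), ‖G (chord (b, t))‖ₑ :=
      lintegral_congr_ae (hb.mono fun p hp => by simp only [hp])
    rw [e2]
    have hGm' : Measurable fun t : ℝ => ‖G (chord (b, t))‖ₑ :=
      hGm.comp (measurable_chord.comp measurable_prodMk_left)
    have h3 := ENNReal.lintegral_mul_le_Lp_mul_Lq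
      (volume.restrict (Set.Ioc 0 (2 * cosA b.2))) Real.HolderConjugate.two_two
      hGm'.aemeasurable (aemeasurable_const (b := (1 : ℝ≥0∞)))
    simp only [Pi.mul_apply, mul_one, ENNReal.one_rpow, lintegral_one,
      Measure.restrict_apply_univ, Real.volume_Ioc, sub_zero] at h3
    calc _ ≤ _ := ENNReal.rpow_le_rpow h3 (by norm_num : (0 : ℝ) ≤ 2)
      _ = _ := by
        rw [ENNReal.mul_rpow_of_nonneg _ _ (by norm_num), ← ENNReal.rpow_mul, ← ENNReal.rpow_mul]
        norm_num
        ring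
  · exact Measurable.mul (by fun_prop) (measurable_setLIntegral_Ioc
      (K := fun q : BdrySM × ℝ => ‖G (chord q)‖ₑ ^ (2 : ℝ)) (by fun_prop) (by fun_prop))

lemma lintegral_enorm_sq_lt_top {X : Type*} [MeasurableSpace X] {μ : Measure X} {F : X → ℂ}
    (hF : MemLp F 2 μ) : ∫⁻ p, ‖F p‖ₑ ^ (2 : ℝ) ∂μ < ⊤ := by
  have := (eLpNorm_lt_top_iff_lintegral_rpow_enorm_lt_top (by norm_num) (by norm_num)).mp hF.2
  simpa using this

/-- The ray transform maps `L²(SM)` to `L²(∂₊SM)`. -/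
lemma memLp_rayTransform {F : ℂ × Ang → ℂ} (hF : MemLp F 2 phaseMeasure) :
    MemLp (rayTransform fun x θ => F (x, θ)) 2 influxMeasure := by
  refine ⟨aestronglyMeasurable_rayTransform hF.1, ?_⟩
  rw [eLpNorm_lt_top_iff_lintegral_rpow_enorm_lt_top (by norm_num) (by norm_num)]
  have h2 : ∫⁻ p, ‖F p‖ₑ ^ (2 : ℝ) ∂phaseMeasure < ⊤ := lintegral_enorm_sq_lt_top hF
  refine lt_of_le_of_lt ?_ (ENNReal.mul_lt_top (by norm_num : (2 : ℝ≥0∞) < ⊤) h2)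
  refine le_trans (lintegral_mono_ae ?_) (lintegral_chord_sq_le hF.1)
  filter_upwards [ae_restrict_mem measurableSet_influx] with b hi
  rw [rayTransform_eq hi]
  simp only [ENNReal.toReal_ofNat]
  exact ENNReal.rpow_le_rpow (enorm_integral_le_lintegral_enorm _) (by norm_num)

lemma integrable_chord_mul {v : BdrySM → ℂ} {F : ℂ × Ang → ℂ} (hv : MemLp v 2 influxMeasure)
    (hF : MemLp F 2 phaseMeasure) :
    Integrable (fun q : BdrySM × ℝ => v q.1 * F (chord q)) chordMeasure := by
  have hq : Measure.QuasiMeasurePreserving (Prod.fst : BdrySM × ℝ → BdrySM) chordMeasure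
      influxMeasure := by
    refine (Measure.quasiMeasurePreserving_fst (μ := influxMeasure)
      (ν := (volume : Measure ℝ))).mono_left ?_
    exact Measure.absolutelyContinuous_of_le Measure.restrict_le_self
  obtain ⟨v', hv', hvv⟩ := hv.1
  obtain ⟨G, hG, hFG⟩ := id hF.1
  have hae : (fun q : BdrySM × ℝ => v q.1 * F (chord q)) =ᵐ[chordMeasure]
      fun q => v' q.1 * G (chord q) := by
    filter_upwards [hq.ae_eq_comp hvv, quasiMeasurePreserving_chord.ae_eq_comp hFG] with q h1 h2
    simp only [Function.comp] at h1 h2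
    rw [h1, h2]
  refine Integrable.congr ?_ hae.symm
  have hGL : MemLp G 2 phaseMeasure := hF.ae_eq hFG
  have hvL : MemLp v' 2 influxMeasure := hv.ae_eq hvv
  have hv'm : Measurable v' := hv'.measurable
  have hGm : Measurable G := hG.measurable
  refine ⟨Measurable.aestronglyMeasurable (by fun_prop), ?_⟩
  rw [HasFiniteIntegral]
  simp only [enorm_mul]
  rw [lintegral_chordMeasure (by fun_prop)]
  have e1 : ∀ b : BdrySM, ∫⁻ t : ℝ in Set.Ioc 0 (2 * cosA b.2), ‖v' b‖ₑ * ‖G (chord (b, t))‖ₑ =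
      ‖v' b‖ₑ * ∫⁻ t : ℝ in Set.Ioc 0 (2 * cosA b.2), ‖G (chord (b, t))‖ₑ := fun b =>
    lintegral_const_mul _ (by fun_prop)
  simp only [e1]
  have h3 := ENNReal.lintegral_mul_le_Lp_mul_Lq influxMeasure Real.HolderConjugate.two_two
    (f := fun b => ‖v' b‖ₑ)
    (g := fun b : BdrySM => ∫⁻ t : ℝ in Set.Ioc 0 (2 * cosA b.2), ‖G (chord (b, t))‖ₑ)
    hv'm.enorm.aemeasurable
    (measurable_setLIntegral_Ioc (K := fun q : BdrySM × ℝ => ‖G (chord q)‖ₑ) (by fun_prop)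
      (by fun_prop)).aemeasurable
  refine lt_of_le_of_lt h3 (ENNReal.mul_lt_top ?_ ?_)
  · exact ENNReal.rpow_lt_top_of_nonneg (by norm_num) (lintegral_enorm_sq_lt_top hvL).ne
  · refine ENNReal.rpow_lt_top_of_nonneg (by norm_num) (ne_of_lt ?_)
    exact lt_of_le_of_lt (lintegral_chord_sq_le hGL.1)
      (ENNReal.mul_lt_top (by norm_num) (lintegral_enorm_sq_lt_top hGL))

lemma ae_chord_smul (v : BdrySM → ℂ) (F : ℂ × Ang → ℂ) :
    (fun q => (ENNReal.ofReal (cosA q.1.2)).toReal •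
      (v (entry (chord q)) / (cosA (entry (chord q)).2 : ℂ) * F (chord q))) =ᵐ[chordMeasure]
    fun q => v q.1 * F (chord q) := by
  filter_upwards [ae_chordMeasure_pos] with q hq
  have h : entry (chord q) = q.1 := entry_chord hq.le q.2
  rw [h, ENNReal.toReal_ofReal hq.le, Complex.real_smul]
  have : (cosA q.1.2 : ℂ) ≠ 0 := by exact_mod_cast hq.ne'
  field_simp

lemma aestronglyMeasurable_entry_mul {v : BdrySM → ℂ} {F : ℂ × Ang → ℂ}
    (hv : MemLp v 2 influxMeasure) (hF : MemLp F 2 phaseMeasure) :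
    AEStronglyMeasurable (fun p => v (entry p) / (cosA (entry p).2 : ℂ) * F p) phaseMeasure := by
  have h1 : AEStronglyMeasurable (fun p => v (entry p)) phaseMeasure :=
    hv.1.comp_quasiMeasurePreserving quasiMeasurePreserving_entry
  have h2 : Measurable fun p => (cosA (entry p).2 : ℂ)⁻¹ :=
    (Complex.measurable_ofReal.comp
      (measurable_cosA.comp (measurable_snd.comp measurable_entry))).inv
  simp only [div_eq_mul_inv]
  exact (h1.mul h2.aestronglyMeasurable).mul hF.1

/-- The factor 1/cos α is cancelled by the Santaló density, so no decay of v towards glancing rays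
is needed, although v/cos α itself may fail to be square integrable. -/
lemma integrable_entry_mul {v : BdrySM → ℂ} {F : ℂ × Ang → ℂ} (hv : MemLp v 2 influxMeasure)
    (hF : MemLp F 2 phaseMeasure) :
    Integrable (fun p => v (entry p) / (cosA (entry p).2 : ℂ) * F p) phaseMeasure := by
  have hm := aestronglyMeasurable_entry_mul hv hF
  rw [← map_chord] at hm ⊢
  rw [integrable_map_measure hm measurable_chord.aemeasurable,
    integrable_withDensity_iff_integrable_smul' (by fun_prop) (by simp)]
  exact (integrable_chord_mul hv hF).congr (ae_chord_smul v F).symm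

/-- The ray transform is dual to the extension by constants along rays. -/
lemma integral_entry_mul {v : BdrySM → ℂ} {F : ℂ × Ang → ℂ} (hv : MemLp v 2 influxMeasure)
    (hF : MemLp F 2 phaseMeasure) :
    ∫ p, v (entry p) / (cosA (entry p).2 : ℂ) * F p ∂phaseMeasure =
      ∫ b, v b * rayTransform (fun x θ => F (x, θ)) b ∂influxMeasure := by
  have hm := aestronglyMeasurable_entry_mul hv hF
  have hI := integrable_chord_mul hv hF
  conv_lhs => rw [← map_chord]
  rw [← map_chord] at hm
  rw [integral_map measurable_chord.aemeasurable hm,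
    integral_withDensity_eq_integral_toReal_smul (by fun_prop) (by simp),
    integral_congr_ae (ae_chord_smul v F)]
  rw [chordMeasure] at hI ⊢
  rw [← integral_indicator measurableSet_chordSet,
    integral_prod _ ((integrable_indicator_iff measurableSet_chordSet).mpr hI)]
  refine integral_congr_ae ?_
  filter_upwards [ae_restrict_mem measurableSet_influx] with b hi
  rw [rayTransform_eq hi, ← integral_const_mul, ← integral_indicator measurableSet_Ioc]
  rfl

/-! ### The scattering relation -/

lemma scat_scat (b : BdrySM) : scat (scat b) = b := by
  have h := piAng_add_piAng
  refine Prod.ext ?_ ?_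
  · simp only [scat]
    calc _ = b.1 + (piAng + piAng) + (piAng + piAng) := by abel
      _ = b.1 := by rw [h]; simp
  · simp only [scat]; abel

lemma cosA_scat (b : BdrySM) : cosA (scat b).2 = -cosA b.2 := cosA_piAng_sub b.2

/-- A reflection in α combined with a translation in β that depends on α. -/
lemma measurePreserving_scat : MeasurePreserving scat volume volume := by
  have h1 : MeasurePreserving (fun α : Ang => piAng - α) volume volume :=
    Measure.measurePreserving_sub_left volume piAng
  have h2 : MeasurePreserving (fun p : Ang × Ang => (piAng - p.1, p.2 + piAng + (p.1 + p.1)))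
      (volume.prod volume) (volume.prod volume) := by
    refine h1.skew_product (g := fun α β => β + piAng + (α + α)) (by fun_prop) ?_
    refine Filter.Eventually.of_forall fun α => ?_
    simp only [add_assoc]
    exact (measurePreserving_add_right volume (piAng + (α + α))).map_eq
  exact (Measure.measurePreserving_swap.comp (h2.comp Measure.measurePreserving_swap))

/-- The scattering relation as a measurable involution. -/
def scatEquiv : BdrySM ≃ᵐ BdrySM where
  toFun := scat
  invFun := scat
  left_inv := scat_scat
  right_inv := scat_scat
  measurable_toFun := measurePreserving_scat.measurable
  measurable_invFun := measurePreserving_scat.measurable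

lemma integral_comp_scat (f : BdrySM → ℂ) : ∫ b, f (scat b) = ∫ b, f b :=
  measurePreserving_scat.integral_comp scatEquiv.measurableEmbedding f

/-! ### Glancing rays form a null set. -/

lemma cosA_eq_of_sinA_eq_zero {α : Ang} (h : sinA α = 0) : cosA α = 1 ∨ cosA α = -1 := by
  have h1 := cosA_sq_add_sinA_sq α
  rw [h] at h1
  have h2 : (cosA α - 1) * (cosA α + 1) = 0 := by linarith
  rcases mul_eq_zero.mp h2 with h | h
  · left; linarith
  · right; linarith

lemma volume_sinA_eq_zero : (volume : Measure Ang) {α | sinA α = 0} = 0 := by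
  have hsub : {α : Ang | sinA α = 0} ⊆ {0} ∪ {piAng} := by
    intro α hα
    have hα' : sinA α = 0 := hα
    have h2 := cosA_eq_of_sinA_eq_zero hα'
    rcases h2 with h2 | h2
    · left
      refine dir_injective ?_
      rw [dir_eq, h2, hα', dir_zero]; simp
    · right
      refine dir_injective ?_
      rw [dir_eq, h2, hα', dir_pi]; simp
  have hs : ∀ x : Ang, (volume : Measure Ang) {x} = 0 := fun x => by
    rw [← Metric.closedBall_zero, AddCircle.volume_closedBall]
    simp [Real.two_pi_pos.le]
  exact measure_mono_null hsub (measure_union_null (hs _) (hs _))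

lemma ae_sinA_ne_zero : ∀ᵐ θ ∂(volume : Measure Ang), sinA θ ≠ 0 := by
  rw [ae_iff]
  simp only [ne_eq, not_not]
  exact volume_sinA_eq_zero

lemma tendsto_add_right_ae (c : Ang) :
    Filter.Tendsto (fun θ : Ang => θ + c) (ae volume) (ae volume) :=
  (measurePreserving_add_right (volume : Measure Ang) c).quasiMeasurePreserving.tendsto_ae

lemma ae_cosA_ne_zero : ∀ᵐ b : BdrySM, cosA b.2 ≠ 0 := by
  have h : ∀ᵐ α : Ang, cosA α ≠ 0 := by
    filter_upwards [(tendsto_add_right_ae ((π / 2 : ℝ) : Ang)).eventually ae_sinA_ne_zero] with α hα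
    have : sinA (α + ((π / 2 : ℝ) : Ang)) = cosA α := by
      rw [sinA, dir_add, dir_coe]
      push_cast
      rw [Complex.exp_pi_div_two_mul_I]
      simp [cosA]
    rwa [this] at hα
  rw [Measure.volume_eq_prod]
  exact Measure.quasiMeasurePreserving_snd.ae h

lemma ae_cosA_pos : ∀ᵐ b ∂influxMeasure, 0 < cosA b.2 := by
  filter_upwards [ae_restrict_mem measurableSet_influx, ae_restrict_of_ae ae_cosA_ne_zero]
    with b h1 h2
  exact lt_of_le_of_ne h1 h2.symm

/-! ### Extension operators -/

/-- Off the glancing set cos α = 0, the scattering relation exchanges the influx boundary with its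
complement. The case distinction then becomes a sum of two indicator terms, to which changes of
variables apply. -/
lemma extA_ae_eq (s : ℂ) (u : BdrySM → ℂ) :
    extA s u =ᵐ[volume] fun b => influx.indicator u b + s * influx.indicator u (scat b) := by
  filter_upwards [ae_cosA_ne_zero] with b hb
  rw [extA]
  by_cases h : b ∈ influx
  · have h0 : 0 ≤ cosA b.2 := h
    have h' : scat b ∉ influx := by
      change ¬ (0 ≤ cosA (scat b).2)
      rw [cosA_scat, not_le, neg_lt_zero]
      exact lt_of_le_of_ne h0 hb.symm
    simp [h, h']
  · have h0 : ¬ 0 ≤ cosA b.2 := h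
    have h' : scat b ∈ influx := by
      change 0 ≤ cosA (scat b).2
      rw [cosA_scat]; linarith
    simp [h, h']

lemma memLp_extA {s : ℂ} {u : BdrySM → ℂ} (hu : MemLp u 2 influxMeasure) :
    MemLp (extA s u) 2 volume := by
  have h1 : MemLp (influx.indicator u) 2 volume := (memLp_indicator_iff_restrict measurableSet_influx).mpr hu
  have h2 := (h1.comp_measurePreserving measurePreserving_scat).const_mul s
  exact (h1.add h2).ae_eq (extA_ae_eq s u).symm

lemma extA_congr {s : ℂ} {u v : BdrySM → ℂ} (h : u =ᵐ[influxMeasure] v) :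
    extA s u =ᵐ[volume] extA s v := by
  have h1 : influx.indicator u =ᵐ[volume] influx.indicator v := by
    have h0 := (ae_restrict_iff' measurableSet_influx).mp h
    filter_upwards [h0] with b hb
    by_cases hi : b ∈ influx
    · rw [Set.indicator_of_mem hi, Set.indicator_of_mem hi, hb hi]
    · rw [Set.indicator_of_notMem hi, Set.indicator_of_notMem hi]
  have h2 := measurePreserving_scat.quasiMeasurePreserving.ae_eq_comp h1
  filter_upwards [extA_ae_eq s u, extA_ae_eq s v, h1, h2] with b e1 e2 e3 e4
  simp only [Function.comp] at e4
  rw [e1, e2, e3, e4]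

lemma memLp_extAStar {s : ℂ} {u : BdrySM → ℂ} (hu : MemLp u 2 volume) :
    MemLp (extAStar s u) 2 volume :=
  hu.add ((hu.comp_measurePreserving measurePreserving_scat).const_mul s)

lemma memLp_influx {u : BdrySM → ℂ} (hu : MemLp u 2 volume) : MemLp u 2 influxMeasure :=
  hu.restrict _

lemma extAStar_congr {s : ℂ} {u v : BdrySM → ℂ} (h : u =ᵐ[volume] v) :
    extAStar s u =ᵐ[volume] extAStar s v := by
  filter_upwards [h, measurePreserving_scat.quasiMeasurePreserving.ae_eq_comp h] with b e1 e2
  simp only [Function.comp] at e2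
  rw [extAStar, extAStar, e1, e2]

lemma integral_extAStar_mul {s : ℂ} {u v : BdrySM → ℂ} (hu : MemLp u 2 volume)
    (hv : MemLp v 2 influxMeasure) :
    ∫ b, extAStar s u b * v b ∂influxMeasure = ∫ b, u b * extA s v b := by
  have hv' : MemLp (influx.indicator v) 2 volume :=
    (memLp_indicator_iff_restrict measurableSet_influx).mpr hv
  have hus := hu.comp_measurePreserving measurePreserving_scat
  have hvs := hv'.comp_measurePreserving measurePreserving_scat
  have e1 : ∫ b, extAStar s u b * v b ∂influxMeasure =
      ∫ b, (u b * influx.indicator v b + s * (u (scat b) * influx.indicator v b)) := by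
    rw [influxMeasure, ← integral_indicator measurableSet_influx]
    congr 1; ext b
    by_cases h : b ∈ influx
    · simp only [Set.indicator_of_mem h, extAStar]; ring
    · simp [Set.indicator_of_notMem h]
  have e2 : ∫ b, u b * extA s v b =
      ∫ b, (u b * influx.indicator v b + s * (u b * influx.indicator v (scat b))) := by
    refine integral_congr_ae ?_
    filter_upwards [extA_ae_eq s v] with b hb
    rw [hb]; ring
  rw [e1, e2, integral_add, integral_add, integral_const_mul, integral_const_mul]
  · congr 2
    rw [← integral_comp_scat (fun b => u b * influx.indicator v (scat b))]
    simp only [scat_scat]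
  · exact hu.integrable_mul hv'
  · exact (hu.integrable_mul hvs).const_mul s
  · exact hu.integrable_mul hv'
  · exact (hus.integrable_mul hv').const_mul s

/-! ### Fourier multipliers along the fibres -/

lemma mode_apply (n : ℤ × ℤ) (b : BdrySM) : mode n b = fourier n.1 b.1 * fourier n.2 b.2 := rfl

lemma mode_add (m n : ℤ × ℤ) (b : BdrySM) : mode (m + n) b = mode m b * mode n b := by
  simp only [mode_apply, Prod.fst_add, Prod.snd_add, fourier_add]; ring

lemma conj_mode (n : ℤ × ℤ) (b : BdrySM) : (starRingEnd ℂ) (mode n b) = mode (-n) b := by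
  simp only [mode_apply, map_mul, Prod.fst_neg, Prod.snd_neg, fourier_neg]

lemma integral_fourier (n : ℤ) : ∫ θ : Ang, fourier n θ = if n = 0 then (2 * π : ℂ) else 0 := by
  split_ifs with h
  · subst h
    simp [Measure.real, Real.pi_pos.le]
  · exact integral_eq_zero_of_add_right_eq_neg (fourier_add_half_inv_index h Real.two_pi_pos)

lemma integral_mode (n : ℤ × ℤ) : ∫ b, mode n b = if n = 0 then (4 * π ^ 2 : ℂ) else 0 := by
  simp only [mode_apply]
  rw [Measure.volume_eq_prod, integral_prod_mul (fun x : Ang => fourier n.1 x)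
    (fun x : Ang => fourier n.2 x), integral_fourier, integral_fourier]
  by_cases h1 : n.1 = 0 <;> by_cases h2 : n.2 = 0 <;> simp [h1, h2, Prod.ext_iff]
  ring

lemma memLp_mode (n : ℤ × ℤ) : MemLp (mode n) 2 (volume : Measure BdrySM) :=
  (mode n).continuous.memLp_of_hasCompactSupport (HasCompactSupport.of_compactSpace _)

/-- The class of the Fourier mode in `L²(∂SM)`. -/
def modeLp (n : ℤ × ℤ) : Lp ℂ 2 (volume : Measure BdrySM) :=
  ContinuousMap.toLp 2 (volume : Measure BdrySM) ℂ (mode n)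

lemma coeFn_modeLp (n : ℤ × ℤ) : modeLp n =ᵐ[volume] mode n := ContinuousMap.coeFn_toLp _ _

lemma inner_modeLp (n : ℤ × ℤ) {u : BdrySM → ℂ} {U : Lp ℂ 2 (volume : Measure BdrySM)}
    (hU : U =ᵐ[volume] u) :
    inner ℂ (modeLp n) U = (4 * π ^ 2 : ℂ) * modeCoeff u n := by
  have hpi : (π : ℂ) ≠ 0 := by exact_mod_cast Real.pi_ne_zero
  have h4 : (4 * π ^ 2 : ℂ) ≠ 0 := mul_ne_zero (by norm_num) (pow_ne_zero 2 hpi)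
  rw [L2.inner_def, modeCoeff, ← mul_assoc, mul_one_div_cancel h4, one_mul]
  refine integral_congr_ae ?_
  filter_upwards [coeFn_modeLp n, hU] with b h1 h2
  rw [h1, h2, RCLike.inner_apply', conj_mode]

lemma modeCoeff_mode (m n : ℤ × ℤ) : modeCoeff (mode m) n = if n = m then 1 else 0 := by
  have hpi : (π : ℂ) ≠ 0 := by exact_mod_cast Real.pi_ne_zero
  simp only [modeCoeff, ← mode_add, integral_mode, neg_add_eq_zero]
  split_ifs
  · field_simp
  · simp

lemma orthonormal_modeLp : Orthonormal ℂ fun n => ((1 / (2 * π) : ℝ) : ℂ) • modeLp n := by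
  have hpi : (π : ℂ) ≠ 0 := by exact_mod_cast Real.pi_ne_zero
  rw [orthonormal_iff_ite]
  intro m n
  rw [inner_smul_left, inner_smul_right, inner_modeLp m (coeFn_modeLp n), modeCoeff_mode]
  split_ifs with h
  · rw [Complex.conj_ofReal]; push_cast; field_simp; norm_num
  · simp

/-- The terms of the Fourier series of `u`, with multiplier `m`. -/
def multTerm (m : ℤ → ℂ) (u : BdrySM → ℂ) (n : ℤ × ℤ) : Lp ℂ 2 (volume : Measure BdrySM) :=
  (m n.2 * modeCoeff u n) • modeLp n

lemma fiberMultiplier_eq (m : ℤ → ℂ) (u : BdrySM → ℂ) :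
    fiberMultiplier m u = ((∑' n, multTerm m u n : Lp ℂ 2 (volume : Measure BdrySM)) :
      BdrySM → ℂ) := rfl

lemma memLp_fiberMultiplier (m : ℤ → ℂ) (u : BdrySM → ℂ) :
    MemLp (fiberMultiplier m u) 2 volume := Lp.memLp _

lemma fiberMultiplier_congr {m : ℤ → ℂ} {u v : BdrySM → ℂ} (h : u =ᵐ[volume] v) :
    fiberMultiplier m u = fiberMultiplier m v := by
  have : ∀ n, modeCoeff u n = modeCoeff v n := fun n => by
    rw [modeCoeff, modeCoeff]
    congr 1
    exact integral_congr_ae (h.mono fun b hb => by simp only [hb])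
  simp only [fiberMultiplier, this]

/-- Bessel's inequality and boundedness of the symbol. Without summability the `tsum` defining the
multiplier would take its default value 0. -/
lemma summable_multTerm {m : ℤ → ℂ} (hm : ∀ k, ‖m k‖ ≤ 1) {u : BdrySM → ℂ}
    (hu : MemLp u 2 volume) : Summable (multTerm m u) := by
  have hpi : (π : ℂ) ≠ 0 := by exact_mod_cast Real.pi_ne_zero
  have hB := orthonormal_modeLp.inner_products_summable (hu.toLp u)
  have hs := (orthonormal_modeLp.orthogonalFamily).summable_iff_norm_sq_summable
    (fun n => m n.2 * inner ℂ (((1 / (2 * π) : ℝ) : ℂ) • modeLp n) (hu.toLp u))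
  have h1 : Summable fun n : ℤ × ℤ =>
      ‖m n.2 * inner ℂ (((1 / (2 * π) : ℝ) : ℂ) • modeLp n) (hu.toLp u)‖ ^ 2 := by
    refine hB.of_nonneg_of_le (fun n => by positivity) fun n => ?_
    rw [norm_mul]
    refine pow_le_pow_left₀ (by positivity) ?_ 2
    exact mul_le_of_le_one_left (norm_nonneg _) (hm _)
  refine (hs.mpr h1).congr fun n => ?_
  rw [LinearIsometry.toSpanSingleton_apply, inner_smul_left, inner_modeLp n hu.coeFn_toLp,
    smul_smul, multTerm, Complex.conj_ofReal]
  congr 1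
  push_cast; field_simp; ring

lemma modeCoeff_add {u v : BdrySM → ℂ} (hu : MemLp u 2 volume) (hv : MemLp v 2 volume)
    (n : ℤ × ℤ) : modeCoeff (u + v) n = modeCoeff u n + modeCoeff v n := by
  rw [modeCoeff, modeCoeff, modeCoeff, ← mul_add, ← integral_add]
  · simp only [Pi.add_apply, mul_add]
  · exact (memLp_mode _).integrable_mul hu
  · exact (memLp_mode _).integrable_mul hv

lemma modeCoeff_smul (c : ℂ) (u : BdrySM → ℂ) (n : ℤ × ℤ) :
    modeCoeff (c • u) n = c * modeCoeff u n := by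
  rw [modeCoeff, modeCoeff, mul_left_comm c, ← integral_const_mul c]
  congr 1
  refine integral_congr_ae (Filter.Eventually.of_forall fun b => ?_)
  simp only [Pi.smul_apply, smul_eq_mul]; ring

lemma fiberMultiplier_add {m : ℤ → ℂ} (hm : ∀ k, ‖m k‖ ≤ 1) {u v : BdrySM → ℂ}
    (hu : MemLp u 2 volume) (hv : MemLp v 2 volume) :
    fiberMultiplier m (u + v) =ᵐ[volume] fiberMultiplier m u + fiberMultiplier m v := by
  have h : multTerm m (u + v) = fun n => multTerm m u n + multTerm m v n := by
    ext1 n; rw [multTerm, modeCoeff_add hu hv, mul_add, add_smul]; rfl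
  rw [fiberMultiplier_eq, h, (summable_multTerm hm hu).tsum_add (summable_multTerm hm hv)]
  exact Lp.coeFn_add _ _

lemma fiberMultiplier_smul {m : ℤ → ℂ} (c : ℂ) (u : BdrySM → ℂ) :
    fiberMultiplier m (c • u) =ᵐ[volume] c • fiberMultiplier m u := by
  have h : multTerm m (c • u) = fun n => c • multTerm m u n := by
    ext1 n; rw [multTerm, modeCoeff_smul, multTerm, smul_smul, mul_left_comm]
  rw [fiberMultiplier_eq, h, tsum_const_smul'']
  exact Lp.coeFn_smul _ _

lemma fiberMultiplier_mode (m : ℤ → ℂ) (n : ℤ × ℤ) :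
    fiberMultiplier m (mode n) =ᵐ[volume] m n.2 • ⇑(mode n) := by
  rw [fiberMultiplier_eq, tsum_eq_single n]
  · rw [multTerm, modeCoeff_mode, if_pos rfl, mul_one]
    filter_upwards [Lp.coeFn_smul (m n.2) (modeLp n), coeFn_modeLp n] with b h1 h2
    rw [h1, Pi.smul_apply, Pi.smul_apply, h2]
  · intro k hk
    rw [multTerm, modeCoeff_mode, if_neg hk, mul_zero, zero_smul]

/-- Parseval in bilinear form: the inner product is taken with the conjugate of v, hence the index
-n in the coefficient of v. -/
lemma hasSum_integral_fiberMultiplier_mul {m : ℤ → ℂ} (hm : ∀ k, ‖m k‖ ≤ 1) {u v : BdrySM → ℂ}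
    (hu : MemLp u 2 volume) (hv : MemLp v 2 volume) :
    HasSum (fun n : ℤ × ℤ => (4 * π ^ 2 : ℂ) * (m n.2 * modeCoeff u n * modeCoeff v (-n)))
      (∫ b, fiberMultiplier m u b * v b) := by
  have hpi : (π : ℂ) ≠ 0 := by exact_mod_cast Real.pi_ne_zero
  have hvc : MemLp (star v) 2 volume := hv.star
  have h1 := (summable_multTerm hm hu).hasSum.mapL (innerSL ℂ (hvc.toLp _))
  have e1 : ∀ (W : Lp ℂ 2 (volume : Measure BdrySM)) (w : BdrySM → ℂ), W =ᵐ[volume] w →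
      innerSL ℂ (hvc.toLp _) W = ∫ b, w b * v b := by
    intro W w hW
    rw [innerSL_apply_apply, L2.inner_def]
    refine integral_congr_ae ?_
    filter_upwards [hvc.coeFn_toLp, hW] with b h1 h2
    rw [h1, h2, RCLike.inner_apply]
    simp
  rw [e1 _ (fiberMultiplier m u) (by rfl)] at h1
  have h4 : (4 * π ^ 2 : ℂ) ≠ 0 := mul_ne_zero (by norm_num) (pow_ne_zero 2 hpi)
  have hfun : (fun n : ℤ × ℤ => (4 * π ^ 2 : ℂ) * (m n.2 * modeCoeff u n * modeCoeff v (-n))) =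
      fun n => innerSL ℂ (hvc.toLp _) (multTerm m u n) := by
    funext n
    rw [multTerm, map_smul, e1 _ _ (coeFn_modeLp n), modeCoeff, modeCoeff, neg_neg, smul_eq_mul]
    field_simp
  rw [hfun]
  exact h1

/-! ### Boundary operators and their transposes -/

/-- The symbol of `H₊`. -/
def evenSymbol (k : ℤ) : ℂ := if Even k then hilbertSymbol k else 0

/-- The symbol of `H₋`. -/
def oddSymbol (k : ℤ) : ℂ := if Even k then 0 else hilbertSymbol k

lemma Hplus_eq : Hplus = fiberMultiplier evenSymbol := rfl

lemma Hminus_eq : Hminus = fiberMultiplier oddSymbol := rfl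

lemma hilbertSymbol_of_pos {k : ℤ} (h : 0 < k) : hilbertSymbol k = -Complex.I := by
  simp [hilbertSymbol, Int.sign_eq_one_of_pos h]

lemma hilbertSymbol_of_neg {k : ℤ} (h : k < 0) : hilbertSymbol k = Complex.I := by
  simp [hilbertSymbol, Int.sign_eq_neg_one_of_neg h]

lemma hilbertSymbol_zero : hilbertSymbol 0 = 0 := by simp [hilbertSymbol]

lemma norm_hilbertSymbol_le (k : ℤ) : ‖hilbertSymbol k‖ ≤ 1 := by
  rcases lt_trichotomy k 0 with h | h | h
  · simp [hilbertSymbol_of_neg h]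
  · simp [h, hilbertSymbol_zero]
  · simp [hilbertSymbol_of_pos h]

lemma hilbertSymbol_neg (k : ℤ) : hilbertSymbol (-k) = -hilbertSymbol k := by
  simp [hilbertSymbol]

lemma norm_evenSymbol_le (k : ℤ) : ‖evenSymbol k‖ ≤ 1 := by
  unfold evenSymbol
  split_ifs
  · exact norm_hilbertSymbol_le k
  · simp

lemma norm_oddSymbol_le (k : ℤ) : ‖oddSymbol k‖ ≤ 1 := by
  unfold oddSymbol
  split_ifs
  · simp
  · exact norm_hilbertSymbol_le k

lemma evenSymbol_neg (k : ℤ) : evenSymbol (-k) = -evenSymbol k := by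
  simp only [evenSymbol, even_neg, hilbertSymbol_neg]
  split_ifs <;> simp

lemma oddSymbol_neg (k : ℤ) : oddSymbol (-k) = -oddSymbol k := by
  simp only [oddSymbol, even_neg, hilbertSymbol_neg]
  split_ifs <;> simp

/-- A Fourier multiplier with odd symbol is antisymmetric. -/
lemma integral_oddMultiplier_mul {m : ℤ → ℂ} (hm : ∀ k, ‖m k‖ ≤ 1) (hodd : ∀ k, m (-k) = -m k)
    {u v : BdrySM → ℂ} (hu : MemLp u 2 volume) (hv : MemLp v 2 volume) :
    ∫ b, fiberMultiplier m u b * v b = -∫ b, u b * fiberMultiplier m v b := by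
  have h1 := hasSum_integral_fiberMultiplier_mul hm hu hv
  have h2 := (hasSum_integral_fiberMultiplier_mul hm hv hu).neg
  have h3 := (Equiv.neg (ℤ × ℤ)).hasSum_iff.mpr h2
  simp only [mul_comm (u _)]
  have hfun : ((fun n : ℤ × ℤ => -((4 * π ^ 2 : ℂ) * (m n.2 * modeCoeff v n * modeCoeff u (-n)))) ∘
      (Equiv.neg (ℤ × ℤ))) =
      fun n => (4 * π ^ 2 : ℂ) * (m n.2 * modeCoeff u n * modeCoeff v (-n)) := by
    funext n
    simp only [Function.comp, Equiv.neg_apply, Prod.snd_neg, neg_neg, hodd]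
    ring
  rw [hfun] at h3
  exact h1.unique h3

/-- The operator `A_{t}^* M A_s`, for a fibrewise multiplier `M`. -/
def sandwich (m : ℤ → ℂ) (t s : ℂ) (u : BdrySM → ℂ) : BdrySM → ℂ :=
  extAStar t (fiberMultiplier m (extA s u))

lemma memLp_sandwich (m : ℤ → ℂ) (t s : ℂ) (u : BdrySM → ℂ) :
    MemLp (sandwich m t s u) 2 volume := memLp_extAStar (memLp_fiberMultiplier _ _)

lemma sandwich_congr {m : ℤ → ℂ} {t s : ℂ} {u v : BdrySM → ℂ} (h : u =ᵐ[influxMeasure] v) :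
    sandwich m t s u = sandwich m t s v := by
  rw [sandwich, sandwich, fiberMultiplier_congr (extA_congr h)]

/-- Each A* is the bilinear transpose of the corresponding A, and the odd symbol contributes the
sign; transposition therefore exchanges s and t. -/
lemma integral_sandwich_mul {m : ℤ → ℂ} (hm : ∀ k, ‖m k‖ ≤ 1) (hodd : ∀ k, m (-k) = -m k)
    (t s : ℂ) {u v : BdrySM → ℂ} (hu : MemLp u 2 influxMeasure) (hv : MemLp v 2 influxMeasure) :
    ∫ b, sandwich m t s u b * v b ∂influxMeasure =
      -∫ b, u b * sandwich m s t v b ∂influxMeasure := by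
  unfold sandwich
  rw [integral_extAStar_mul (memLp_fiberMultiplier _ _) hv,
    integral_oddMultiplier_mul hm hodd (memLp_extA hu) (memLp_extA hv)]
  simp only [mul_comm (u _)]
  rw [integral_extAStar_mul (memLp_fiberMultiplier _ _) hu]
  simp only [mul_comm]

lemma PminusDagger_apply (u : BdrySM → ℂ) (b : BdrySM) :
    PminusDagger u b = -(1 / 4) * sandwich oddSymbol 1 (-1) u b := by
  simp only [PminusDagger, PminusStar, Hminus_eq, sandwich, Pi.smul_apply, Pi.neg_apply,
    smul_eq_mul]
  ring

lemma Cplus_apply (u : BdrySM → ℂ) (b : BdrySM) :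
    Cplus u b = (1 / 2) * sandwich evenSymbol (-1) (-1) u b := by
  simp only [Cplus, Hplus_eq, sandwich, Pi.smul_apply, smul_eq_mul]

lemma PplusDagger_apply (u : BdrySM → ℂ) (b : BdrySM) :
    PplusDagger u b =
      -(1 / 4) * sandwich evenSymbol 1 (-1) (u - (12 : ℂ) • Cplus (Cplus u)) b := by
  simp only [PplusDagger, PplusStar, Hplus_eq, sandwich, Pi.smul_apply, Pi.neg_apply,
    smul_eq_mul]
  ring

lemma memLp_PminusDagger (u : BdrySM → ℂ) : MemLp (PminusDagger u) 2 influxMeasure := by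
  have h : PminusDagger u = fun b => -(1 / 4) * sandwich oddSymbol 1 (-1) u b :=
    funext (PminusDagger_apply u)
  rw [h]
  exact memLp_influx ((memLp_sandwich _ _ _ _).const_mul _)

lemma memLp_PplusDagger (u : BdrySM → ℂ) : MemLp (PplusDagger u) 2 influxMeasure := by
  have h := funext (PplusDagger_apply u)
  rw [h]
  exact memLp_influx ((memLp_sandwich _ _ _ _).const_mul _)

lemma memLp_Cplus (u : BdrySM → ℂ) : MemLp (Cplus u) 2 influxMeasure := by
  have h := funext (Cplus_apply u)
  rw [h]
  exact memLp_influx ((memLp_sandwich _ _ _ _).const_mul _)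

lemma Cplus_congr {u v : BdrySM → ℂ} (h : u =ᵐ[influxMeasure] v) : Cplus u = Cplus v := by
  funext b
  rw [Cplus_apply, Cplus_apply, sandwich_congr h]

/-- The transpose of `P₋†`. -/
def PminusTranspose (v : BdrySM → ℂ) (b : BdrySM) : ℂ :=
  (1 / 4) * sandwich oddSymbol (-1) 1 v b

/-- The transpose of `P₊†`. -/
def PplusTranspose (v : BdrySM → ℂ) (b : BdrySM) : ℂ :=
  (1 / 4) * (sandwich evenSymbol (-1) 1 v b
    - 12 * Cplus (Cplus (sandwich evenSymbol (-1) 1 v)) b)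

lemma memLp_PminusTranspose (v : BdrySM → ℂ) : MemLp (PminusTranspose v) 2 influxMeasure :=
  memLp_influx ((memLp_sandwich _ _ _ _).const_mul _)

lemma integral_PminusDagger_mul {u v : BdrySM → ℂ} (hu : MemLp u 2 influxMeasure)
    (hv : MemLp v 2 influxMeasure) :
    ∫ b, PminusDagger u b * v b ∂influxMeasure =
      ∫ b, u b * PminusTranspose v b ∂influxMeasure := by
  simp only [PminusDagger_apply, PminusTranspose, mul_assoc, mul_left_comm (u _)]
  rw [integral_const_mul, integral_const_mul,
    integral_sandwich_mul norm_oddSymbol_le oddSymbol_neg _ _ hu hv]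
  ring

lemma integral_Cplus_mul {u v : BdrySM → ℂ} (hu : MemLp u 2 influxMeasure)
    (hv : MemLp v 2 influxMeasure) :
    ∫ b, Cplus u b * v b ∂influxMeasure = -∫ b, u b * Cplus v b ∂influxMeasure := by
  simp only [Cplus_apply, mul_assoc, mul_left_comm (u _)]
  rw [integral_const_mul, integral_const_mul,
    integral_sandwich_mul norm_evenSymbol_le evenSymbol_neg _ _ hu hv]
  ring

lemma integral_PplusDagger_mul {u v : BdrySM → ℂ} (hu : MemLp u 2 influxMeasure)
    (hv : MemLp v 2 influxMeasure) :
    ∫ b, PplusDagger u b * v b ∂influxMeasure =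
      ∫ b, u b * PplusTranspose v b ∂influxMeasure := by
  have hu' : MemLp (u - (12 : ℂ) • Cplus (Cplus u)) 2 influxMeasure :=
    hu.sub ((memLp_Cplus _).const_smul _)
  set y := sandwich evenSymbol (-1) 1 v with hy
  have hyL : MemLp y 2 influxMeasure := memLp_influx (memLp_sandwich _ _ _ _)
  have e1 : ∫ b, PplusDagger u b * v b ∂influxMeasure =
      (1 / 4) * ∫ b, (u b * y b - 12 * (Cplus (Cplus u) b * y b)) ∂influxMeasure := by
    simp only [PplusDagger_apply, mul_assoc]
    rw [integral_const_mul, integral_sandwich_mul norm_evenSymbol_le evenSymbol_neg _ _ hu' hv,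
      ← hy]
    simp only [Pi.sub_apply, Pi.smul_apply, smul_eq_mul, sub_mul, mul_assoc]
    ring
  have e2 : ∫ b, u b * PplusTranspose v b ∂influxMeasure =
      (1 / 4) * ∫ b, (u b * y b - 12 * (u b * Cplus (Cplus y) b)) ∂influxMeasure := by
    rw [← integral_const_mul]
    refine integral_congr_ae (Filter.Eventually.of_forall fun b => ?_)
    simp only [PplusTranspose, ← hy]
    ring
  have i1 : Integrable (fun b => u b * y b) influxMeasure := hu.integrable_mul hyL
  have i2 : Integrable (fun b => 12 * (Cplus (Cplus u) b * y b)) influxMeasure :=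
    ((memLp_Cplus _).integrable_mul hyL).const_mul _
  have i3 : Integrable (fun b => 12 * (u b * Cplus (Cplus y) b)) influxMeasure :=
    (hu.integrable_mul (memLp_Cplus _)).const_mul _
  rw [e1, e2, integral_sub i1 i2, integral_sub i1 i3,
    integral_const_mul, integral_const_mul, integral_Cplus_mul (memLp_Cplus _) hyL,
    integral_Cplus_mul hu (memLp_Cplus _), neg_neg]

/-! ### Modes in parallel-beam coordinates -/

/-- The function `e^{ipθ} e^{iqγ}`, where `θ = β + π + α` and `γ = π/2 - α`. -/
def E (p q : ℤ) (b : BdrySM) : ℂ := dir (rayDir b) ^ p * (Complex.I * (dir b.2)⁻¹) ^ q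

/-- The function `e^{ipθ} sin (qγ)`. -/
def sinE (p q : ℤ) (b : BdrySM) : ℂ := (E p q b - E p (-q) b) / (2 * Complex.I)

/-- The function `e^{ipθ} cos (qγ)`. -/
def cosE (p q : ℤ) (b : BdrySM) : ℂ := (E p q b + E p (-q) b) / 2

lemma fourier_eq_dir (n : ℤ) (θ : Ang) : fourier n θ = dir θ ^ n := by
  rw [fourier_apply, AddCircle.toCircle_zsmul, dir, Circle.coe_zpow]

/-- The frequency in α is p - q, so a fibrewise multiplier m acts on `E p q` by the scalar m(p - q).
-/
lemma E_eq_mode (p q : ℤ) (b : BdrySM) :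
    E p q b = (-1) ^ p * Complex.I ^ q * mode (p, p - q) b := by
  rw [mode_apply, fourier_eq_dir, fourier_eq_dir, E, rayDir, dir_add, dir_add, dir_pi,
    mul_zpow, mul_zpow, mul_zpow, inv_zpow, zpow_sub₀ (dir_ne_zero _)]
  field_simp

/-- The scattering relation moves to the other end of the same oriented line: θ is unchanged and γ =
π/2 - α changes sign. -/
lemma E_scat (p q : ℤ) (b : BdrySM) : E p q (scat b) = E p (-q) b := by
  have h1 : dir (rayDir (scat b)) = dir (rayDir b) := by
    simp only [rayDir, scat, dir_add, dir_sub, dir_pi]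
    field_simp [dir_ne_zero b.2]
  have h2 : Complex.I * (dir (scat b).2)⁻¹ = (Complex.I * (dir b.2)⁻¹)⁻¹ := by
    simp only [scat, dir_sub, dir_pi]
    field_simp [dir_ne_zero b.2]
    simp
  rw [E, E, h1, h2, inv_zpow, zpow_neg]

lemma E_smul_eq (p q : ℤ) : E p q = ((-1) ^ p * Complex.I ^ q : ℂ) • ⇑(mode (p, p - q)) :=
  funext fun b => by rw [E_eq_mode]; rfl

lemma memLp_E (p q : ℤ) : MemLp (E p q) 2 volume := by
  rw [E_smul_eq]; exact (memLp_mode _).const_smul _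

lemma fiberMultiplier_E (m : ℤ → ℂ) (c : ℂ) (p q : ℤ) :
    fiberMultiplier m (c • E p q) =ᵐ[volume] (c * m (p - q)) • E p q := by
  rw [E_smul_eq, smul_smul]
  filter_upwards [fiberMultiplier_smul (m := m) (c * ((-1) ^ p * Complex.I ^ q)) (mode (p, p - q)),
    fiberMultiplier_mode m (p, p - q)] with b h1 h2
  rw [h1, Pi.smul_apply, h2]
  simp only [Pi.smul_apply, smul_eq_mul]; ring

lemma fiberMultiplier_E_add {m : ℤ → ℂ} (hm : ∀ k, ‖m k‖ ≤ 1) (c d : ℂ) (p q p' q' : ℤ) :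
    fiberMultiplier m (fun b => c * E p q b + d * E p' q' b) =ᵐ[volume]
      fun b => c * m (p - q) * E p q b + d * m (p' - q') * E p' q' b := by
  have h := fiberMultiplier_add hm ((memLp_E p q).const_smul c) ((memLp_E p' q').const_smul d)
  filter_upwards [h, fiberMultiplier_E m c p q, fiberMultiplier_E m d p' q'] with b h1 h2 h3
  rw [Pi.add_apply, h2, h3] at h1
  exact h1

lemma sinE_eq (p q : ℤ) : sinE p q =
    fun b => (1 / (2 * Complex.I)) * E p q b + -(1 / (2 * Complex.I)) * E p (-q) b := by
  funext b; rw [sinE]; ring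

lemma cosE_eq (p q : ℤ) : cosE p q = fun b => (1 / 2) * E p q b + (1 / 2) * E p (-q) b := by
  funext b; rw [cosE]; ring

lemma memLp_sinE (p q : ℤ) : MemLp (sinE p q) 2 volume := by
  rw [sinE_eq]; exact ((memLp_E p q).const_mul _).add ((memLp_E p (-q)).const_mul _)

lemma memLp_cosE (p q : ℤ) : MemLp (cosE p q) 2 volume := by
  rw [cosE_eq]; exact ((memLp_E p q).const_mul _).add ((memLp_E p (-q)).const_mul _)

lemma sinE_scat (p q : ℤ) (b : BdrySM) : sinE p q (scat b) = -sinE p q b := by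
  rw [sinE, sinE, E_scat, E_scat, neg_neg]; ring

lemma cosE_scat (p q : ℤ) (b : BdrySM) : cosE p q (scat b) = cosE p q b := by
  rw [cosE, cosE, E_scat, E_scat, neg_neg]; ring

/-! ### Diagonal action of the boundary operators on sine and cosine modes. -/

lemma extA_sinE (p q : ℤ) : extA (-1) (sinE p q) = sinE p q := by
  funext b; rw [extA, sinE_scat]; simp

lemma extA_cosE (p q : ℤ) : extA 1 (cosE p q) = cosE p q := by
  funext b; rw [extA, cosE_scat]; simp

lemma sandwich_sinE {m : ℤ → ℂ} (hm : ∀ k, ‖m k‖ ≤ 1) (t : ℂ) (p q : ℤ) :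
    sandwich m t (-1) (sinE p q) =ᵐ[volume] fun b =>
      (1 / (2 * Complex.I)) * ((m (p - q) - t * m (p + q)) * E p q b
        - (m (p + q) - t * m (p - q)) * E p (-q) b) := by
  rw [sandwich, extA_sinE]
  refine (extAStar_congr (sinE_eq p q ▸ fiberMultiplier_E_add hm _ _ p q p (-q))).trans ?_
  refine Filter.Eventually.of_forall fun b => ?_
  simp only [extAStar, E_scat, neg_neg, sub_neg_eq_add]
  ring

lemma sandwich_cosE {m : ℤ → ℂ} (hm : ∀ k, ‖m k‖ ≤ 1) (t : ℂ) (p q : ℤ) :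
    sandwich m t 1 (cosE p q) =ᵐ[volume] fun b =>
      (1 / 2) * ((m (p - q) + t * m (p + q)) * E p q b
        + (m (p + q) + t * m (p - q)) * E p (-q) b) := by
  rw [sandwich, extA_cosE]
  refine (extAStar_congr (cosE_eq p q ▸ fiberMultiplier_E_add hm _ _ p q p (-q))).trans ?_
  refine Filter.Eventually.of_forall fun b => ?_
  simp only [extAStar, E_scat, neg_neg, sub_neg_eq_add]
  ring

/-- For |p| < q the frequencies p - q and p + q have opposite signs, so the Hilbert symbols differ
by a sign and exchange sine for cosine. -/
lemma PminusDagger_sinE {p q : ℤ} (hpq : ¬ Even (p - q)) (h1 : p < q) (h2 : -q < p) :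
    PminusDagger (sinE p q) =ᵐ[influxMeasure] fun b => -(1 / 2) * cosE p q b := by
  have hpq' : ¬ Even (p + q) := by
    intro h; apply hpq; rw [show p - q = p + q - (q + q) by ring]; exact h.sub ⟨q, rfl⟩
  have m1 : oddSymbol (p - q) = Complex.I := by
    rw [oddSymbol, if_neg hpq, hilbertSymbol_of_neg (by omega)]
  have m2 : oddSymbol (p + q) = -Complex.I := by
    rw [oddSymbol, if_neg hpq', hilbertSymbol_of_pos (by omega)]
  filter_upwards [ae_restrict_of_ae (sandwich_sinE norm_oddSymbol_le 1 p q)] with b hb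
  rw [PminusDagger_apply, hb, m1, m2, cosE]
  field_simp
  ring

lemma sandwich_const_mul (m : ℤ → ℂ) (t s c : ℂ) (u : BdrySM → ℂ) :
    sandwich m t s (fun b => c * u b) =ᵐ[volume] fun b => c * sandwich m t s u b := by
  have h1 : extA s (fun b => c * u b) = c • extA s u := by
    funext b
    simp only [extA, Pi.smul_apply, smul_eq_mul]
    split_ifs <;> ring
  rw [sandwich, h1]
  refine (extAStar_congr (fiberMultiplier_smul c _)).trans ?_
  refine Filter.Eventually.of_forall fun b => ?_
  simp only [sandwich, extAStar, Pi.smul_apply, smul_eq_mul]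
  ring

lemma Cplus_const_mul_sinE (c : ℂ) (p q : ℤ) :
    Cplus (fun b => c * sinE p q b) =ᵐ[influxMeasure] fun b =>
      c * ((1 / 2) * (evenSymbol (p - q) + evenSymbol (p + q))) * sinE p q b := by
  filter_upwards [ae_restrict_of_ae (sandwich_const_mul evenSymbol (-1) (-1) c (sinE p q)),
    ae_restrict_of_ae (sandwich_sinE norm_evenSymbol_le (-1) p q)] with b h1 h2
  rw [Cplus_apply, h1, h2, sinE]
  ring

/-- C₊ multiplies the sine mode by half the sum of the two symbols, so 12 C₊² contributes 3 times
the square of that sum. -/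
lemma PplusTranspose_cosE (p q : ℤ) :
    PplusTranspose (cosE p q) =ᵐ[influxMeasure] fun b =>
      (1 / 4) * (Complex.I * (evenSymbol (p - q) - evenSymbol (p + q))) *
        (1 - 3 * (evenSymbol (p - q) + evenSymbol (p + q)) ^ 2) * sinE p q b := by
  set c := Complex.I * (evenSymbol (p - q) - evenSymbol (p + q)) with hc
  have h0 : sandwich evenSymbol (-1) 1 (cosE p q) =ᵐ[influxMeasure] fun b => c * sinE p q b := by
    filter_upwards [ae_restrict_of_ae (sandwich_cosE norm_evenSymbol_le (-1) p q)] with b hb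
    rw [hb, sinE, hc]
    field_simp
    ring
  have h1 := Cplus_const_mul_sinE c p q
  have h2 := Cplus_const_mul_sinE (c * ((1 / 2) * (evenSymbol (p - q) + evenSymbol (p + q)))) p q
  rw [← Cplus_congr h1, ← Cplus_congr h0] at h2
  filter_upwards [h0, h2] with b e0 e2
  rw [PplusTranspose, e2, e0]
  ring

/-- The two symbols cancel in the sum: C₊ annihilates the mode and the correction is invisible. -/
lemma PplusTranspose_cosE_of_lt {p q : ℤ} (hpq : Even (p - q)) (h1 : p < q) (h2 : -q < p) :
    PplusTranspose (cosE p q) =ᵐ[influxMeasure] fun b => -(1 / 2) * sinE p q b := by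
  have hpq' : Even (p + q) := by
    rw [show p + q = p - q + (q + q) by ring]; exact hpq.add ⟨q, rfl⟩
  have m1 : evenSymbol (p - q) = Complex.I := by
    rw [evenSymbol, if_pos hpq, hilbertSymbol_of_neg (by omega)]
  have m2 : evenSymbol (p + q) = -Complex.I := by
    rw [evenSymbol, if_pos hpq', hilbertSymbol_of_pos (by omega)]
  filter_upwards [PplusTranspose_cosE p q] with b hb
  rw [hb, m1, m2]
  ring_nf
  rw [Complex.I_sq]
  ring

/-- One frequency is zero, where the Hilbert symbol vanishes, so the uncorrected multiplier is only
-1/4. The sum of the symbols has square -1, and the correction supplies the factor 1 + 3 = 4. -/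
lemma PplusTranspose_cosE_of_eq {p q : ℤ} (h0 : 0 < q) (h : p = q ∨ p = -q) :
    PplusTranspose (cosE p q) =ᵐ[influxMeasure] fun b => -1 * sinE p q b := by
  filter_upwards [PplusTranspose_cosE p q] with b hb
  rcases h with rfl | rfl
  · have m1 : evenSymbol (p - p) = 0 := by
      rw [evenSymbol, if_pos (by simp), sub_self, hilbertSymbol_zero]
    have m2 : evenSymbol (p + p) = -Complex.I := by
      rw [evenSymbol, if_pos ⟨p, rfl⟩, hilbertSymbol_of_pos (by omega)]
    rw [hb, m1, m2]
    ring_nf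
    rw [Complex.I_sq, Complex.I_pow_four]
    ring
  · have m1 : evenSymbol (-q - q) = Complex.I := by
      rw [evenSymbol, if_pos ⟨-q, by ring⟩, hilbertSymbol_of_neg (by omega)]
    have m2 : evenSymbol (-q + q) = 0 := by
      rw [evenSymbol, if_pos (by simp), neg_add_cancel, hilbertSymbol_zero]
    rw [hb, m1, m2]
    ring_nf
    rw [Complex.I_sq, Complex.I_pow_four]
    ring

/-! ### Chebyshev polynomials and Dirichlet sums -/

open Polynomial.Chebyshev in
/-- The Chebyshev polynomial of the second kind as a function on `ℂ`. -/
def chebU (n : ℤ) (z : ℂ) : ℂ := (U ℂ n).eval z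

open Polynomial.Chebyshev in
/-- The Chebyshev polynomial of the first kind as a function on `ℂ`. -/
def chebT (n : ℤ) (z : ℂ) : ℂ := (T ℂ n).eval z

lemma chebU_add_two (n : ℤ) (z : ℂ) : chebU (n + 2) z = 2 * z * chebU (n + 1) z - chebU n z := by
  simp [chebU, Polynomial.Chebyshev.U_add_two]

lemma chebU_zero (z : ℂ) : chebU 0 z = 1 := by simp [chebU]

lemma chebU_one (z : ℂ) : chebU 1 z = 2 * z := by simp [chebU]

lemma chebU_neg_one (z : ℂ) : chebU (-1) z = 0 := by simp [chebU]

/-- The sum `z^n + z^(n-2) + ⋯ + z^(-n)`. -/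
def dsum (n : ℕ) (z : ℂ) : ℂ := ∑ j ∈ Finset.range (n + 1), z ^ ((n : ℤ) - 2 * j)

lemma dsum_succ (n : ℕ) {z : ℂ} (hz : z ≠ 0) : dsum (n + 1) z = z * dsum n z + z⁻¹ ^ (n + 1) := by
  rw [dsum, Finset.sum_range_succ, dsum, Finset.mul_sum]
  congr 1
  · refine Finset.sum_congr rfl fun j _ => ?_
    rw [← zpow_one_add₀ hz]; congr 1; push_cast; ring
  · rw [inv_pow, ← zpow_natCast, ← zpow_neg]; congr 1; push_cast; ring

lemma dsum_succ' (n : ℕ) {z : ℂ} (hz : z ≠ 0) : dsum (n + 1) z = z⁻¹ * dsum n z + z ^ (n + 1) := by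
  rw [dsum, Finset.sum_range_succ', dsum, Finset.mul_sum]
  congr 1
  · refine Finset.sum_congr rfl fun j _ => ?_
    rw [← zpow_neg_one, ← zpow_add₀ hz]; congr 1; push_cast; ring

/-- Peeling off the last or the first term of the next sum gives two recursions; their difference is
the closed form. -/
lemma sub_mul_dsum (n : ℕ) {z : ℂ} (hz : z ≠ 0) :
    (z - z⁻¹) * dsum n z = z ^ (n + 1) - z⁻¹ ^ (n + 1) := by
  have h := (dsum_succ n hz).symm.trans (dsum_succ' n hz)
  linear_combination h

lemma chebU_eq_dsum (n : ℕ) {z : ℂ} (hz : z ≠ 0) : chebU n ((z + z⁻¹) / 2) = dsum n z := by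
  induction n using Nat.twoStepInduction with
  | zero => simp [chebU_zero, dsum]
  | one => simp [chebU_one, dsum, Finset.sum_range_succ]; field_simp
  | more n h1 h2 =>
    push_cast at h2 ⊢
    rw [chebU_add_two, h1, h2, dsum_succ (n + 1) hz]
    have h3 := dsum_succ n hz
    have h4 : z⁻¹ * z = 1 := inv_mul_cancel₀ hz
    rw [pow_succ _ (n + 1)]
    linear_combination z⁻¹ * h3 + dsum n z * h4

lemma chebT_eq (n : ℕ) {z : ℂ} (hz : z ≠ 0) :
    chebT (n + 1) ((z + z⁻¹) / 2) = (z ^ (n + 1) + z⁻¹ ^ (n + 1)) / 2 := by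
  have h : chebT (n + 1) ((z + z⁻¹) / 2) =
      chebU (n + 1 : ℕ) ((z + z⁻¹) / 2) - (z + z⁻¹) / 2 * chebU n ((z + z⁻¹) / 2) := by
    simp [chebT, chebU, Polynomial.Chebyshev.T_eq_U_sub_X_mul_U]
  rw [h, chebU_eq_dsum _ hz, chebU_eq_dsum _ hz, dsum_succ n hz]
  linear_combination (1 / 2) * sub_mul_dsum n hz

lemma hasDerivAt_chebT (n : ℤ) (z : ℂ) : HasDerivAt (chebT (n + 1)) ((n + 1) * chebU n z) z := by
  have h := (Polynomial.Chebyshev.T ℂ (n + 1)).hasDerivAt z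
  rw [Polynomial.Chebyshev.T_derivative_eq_U] at h
  convert! h using 1
  simp [chebU]

@[fun_prop]
lemma continuous_chebU (n : ℤ) : Continuous (chebU n) := (Polynomial.Chebyshev.U ℂ n).continuous

@[fun_prop]
lemma continuous_chebT (n : ℤ) : Continuous (chebT n) := (Polynomial.Chebyshev.T ℂ n).continuous

/-! ### Chords in terms of the complex angle -/

/-- The number `e^{iγ}`, where `γ = π/2 - α`. -/
def zeta (b : BdrySM) : ℂ := Complex.I * (dir b.2)⁻¹

lemma zeta_ne_zero (b : BdrySM) : zeta b ≠ 0 :=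
  mul_ne_zero Complex.I_ne_zero (inv_ne_zero (dir_ne_zero _))

lemma zeta_eq (b : BdrySM) : zeta b = (sinA b.2 : ℂ) + (cosA b.2 : ℂ) * Complex.I := by
  rw [zeta, dir_inv_eq]; linear_combination -(sinA b.2 : ℂ) * Complex.I_sq

lemma zeta_inv_eq (b : BdrySM) : (zeta b)⁻¹ = (sinA b.2 : ℂ) - (cosA b.2 : ℂ) * Complex.I := by
  rw [zeta, mul_inv, inv_inv, dir_eq, Complex.inv_I]
  linear_combination -(sinA b.2 : ℂ) * Complex.I_sq

lemma E_eq (p q : ℤ) (b : BdrySM) : E p q b = dir (rayDir b) ^ p * zeta b ^ q := rfl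

lemma sinE_eq_zeta (p : ℤ) (n : ℕ) (b : BdrySM) : sinE p n b =
    dir (rayDir b) ^ p * ((zeta b ^ n - (zeta b)⁻¹ ^ n) / (2 * Complex.I)) := by
  rw [sinE, E_eq, E_eq, zpow_neg, zpow_natCast, inv_pow]; ring

lemma cosE_eq_zeta (p : ℤ) (n : ℕ) (b : BdrySM) : cosE p n b =
    dir (rayDir b) ^ p * ((zeta b ^ n + (zeta b)⁻¹ ^ n) / 2) := by
  rw [cosE, E_eq, E_eq, zpow_neg, zpow_natCast, inv_pow]; ring

lemma sinA_eq_zeta (b : BdrySM) : (sinA b.2 : ℂ) = (zeta b + (zeta b)⁻¹) / 2 := by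
  rw [zeta_inv_eq, zeta_eq]; ring

lemma cosA_eq_zeta (b : BdrySM) : (cosA b.2 : ℂ) * (2 * Complex.I) = zeta b - (zeta b)⁻¹ := by
  rw [zeta_inv_eq, zeta_eq]; ring

lemma sinE_eq_chebU (p : ℤ) (n : ℕ) (b : BdrySM) : sinE p (n + 1) b =
    dir (rayDir b) ^ p * ((cosA b.2 : ℂ) * chebU n (sinA b.2)) := by
  have h := sub_mul_dsum n (zeta_ne_zero b)
  rw [← cosA_eq_zeta, ← chebU_eq_dsum n (zeta_ne_zero b), ← sinA_eq_zeta] at h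
  have h2 := sinE_eq_zeta p (n + 1) b
  push_cast at h2
  rw [h2, ← h]
  field_simp [Complex.I_ne_zero]

lemma cosE_eq_chebT (p : ℤ) (n : ℕ) (b : BdrySM) : cosE p (n + 1) b =
    dir (rayDir b) ^ p * chebT (n + 1) (sinA b.2) := by
  have h2 := cosE_eq_zeta p (n + 1) b
  push_cast at h2
  rw [h2, sinA_eq_zeta, chebT_eq n (zeta_ne_zero b)]

/-- The ridge function `x ↦ U_n (Im (x e^{-iφ}))`. -/
def ridge (n : ℕ) (φ : Ang) (x : ℂ) : ℂ := chebU n (offset x φ)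

lemma offset_chord_eq (b : BdrySM) (t : ℝ) (φ : Ang) :
    offset (chord (b, t)).1 φ =
      (t - cosA b.2) * sinA (rayDir b - φ) + sinA b.2 * cosA (rayDir b - φ) := by
  have h1 : (chord (b, t)).1 * (dir φ)⁻¹ =
      (chord (b, t)).1 * (dir (rayDir b))⁻¹ * dir (rayDir b - φ) := by
    rw [dir_sub]; field_simp [dir_ne_zero (rayDir b)]
  rw [offset, h1, chord_mul_inv, dir_eq (rayDir b - φ)]
  simp

lemma sinA_eq_dir (a : Ang) : (sinA a : ℂ) * (2 * Complex.I) = dir a - (dir a)⁻¹ := by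
  rw [dir_inv_eq, dir_eq]; ring

/-- Here a is the angle from the ridge direction to the ray. The antiderivative is T_{n+1}/((n+1)
sin a), evaluated at cos(γ - a) and cos(γ + a); the difference factors into sin((n+1)a) sin((n+1)γ),
and sin((n+1)a)/sin a is the Dirichlet sum. -/
lemma integral_ridge (n : ℕ) (b : BdrySM) (a : Ang) :
    ∫ t in (0 : ℝ)..(2 * cosA b.2),
      chebU n (((t - cosA b.2) * sinA a + sinA b.2 * cosA a : ℝ) : ℂ) =
      2 / (n + 1) * dsum n (dir a) *
        ((zeta b ^ (n + 1) - (zeta b)⁻¹ ^ (n + 1)) / (2 * Complex.I)) := by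
  have hn : (n + 1 : ℂ) ≠ 0 := by exact_mod_cast n.succ_ne_zero
  have hζ := zeta_ne_zero b
  have hw := dir_ne_zero a
  -- When the ray is parallel to the ridge, e^{ia} = ±1, the integrand is constant, and the
  -- Dirichlet sum collapses to (n+1) e^{ina}.
  by_cases hs : sinA a = 0
  · have hw2 : dir a ^ 2 = 1 := by
      rw [dir_eq, hs]
      rcases cosA_eq_of_sinA_eq_zero hs with h | h <;> simp [h]
    have hwi : (dir a)⁻¹ = dir a := by
      rw [inv_eq_iff_eq_inv]; exact eq_inv_of_mul_eq_one_left (by rw [← sq, hw2])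
    have hκ : (cosA a : ℂ) = dir a := by rw [dir_eq, hs]; simp
    have hD : dsum n (dir a) = (n + 1) * dir a ^ n := by
      rw [dsum, Finset.sum_congr rfl (g := fun _ => dir a ^ n)]
      · simp
      · intro j _
        rw [zpow_sub₀ hw, zpow_mul, zpow_natCast, zpow_natCast]
        norm_cast
        rw [hw2]; simp
    have hyi : (dir a * zeta b)⁻¹ = dir a * (zeta b)⁻¹ := by rw [mul_inv, hwi]
    have harg : ∀ t : ℝ, (((t - cosA b.2) * sinA a + sinA b.2 * cosA a : ℝ) : ℂ) =
        (dir a * zeta b + (dir a * zeta b)⁻¹) / 2 := fun t => by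
      push_cast
      rw [hs, hκ, sinA_eq_zeta, hyi]; push_cast; ring
    simp only [harg, chebU_eq_dsum n (mul_ne_zero hw hζ), intervalIntegral.integral_const]
    have h2 := sub_mul_dsum n (mul_ne_zero hw hζ)
    rw [hyi, mul_pow, mul_pow, ← mul_sub, ← cosA_eq_zeta] at h2
    have h3 : (cosA b.2 : ℂ) * (2 * Complex.I) * dsum n (dir a * zeta b) =
        dir a ^ n * (zeta b ^ (n + 1) - (zeta b)⁻¹ ^ (n + 1)) := by
      have h4 : dir a * dir a = 1 := by rw [← sq, hw2]
      rw [pow_succ (dir a)] at h2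
      linear_combination dir a * h2 -
        ((cosA b.2 : ℂ) * (2 * Complex.I) * dsum n (dir a * zeta b) -
        dir a ^ n * (zeta b ^ (n + 1) - (zeta b)⁻¹ ^ (n + 1))) * h4
    rw [hD, Complex.real_smul]
    push_cast
    field_simp [Complex.I_ne_zero]
    linear_combination h3
  · have hs' : (sinA a : ℂ) ≠ 0 := by exact_mod_cast hs
    have hder : ∀ t : ℝ, HasDerivAt (fun t : ℝ =>
        chebT (n + 1) (((t - cosA b.2) * sinA a + sinA b.2 * cosA a : ℝ) : ℂ) /
          ((n + 1) * sinA a))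
        (chebU n (((t - cosA b.2) * sinA a + sinA b.2 * cosA a : ℝ) : ℂ)) t := by
      intro t
      have h1 : HasDerivAt (fun t : ℝ => (t - cosA b.2) * sinA a + sinA b.2 * cosA a)
          (sinA a) t := by
        simpa using (((hasDerivAt_id t).sub_const (cosA b.2)).mul_const (sinA a)).add_const
          (sinA b.2 * cosA a)
      have h2 := ((hasDerivAt_chebT n _).comp t h1.ofReal_comp).div_const ((n + 1) * sinA a : ℂ)
      convert! h2 using 1
      push_cast
      field_simp
    rw [intervalIntegral.integral_eq_sub_of_hasDerivAt (fun t _ => hder t)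
      (Continuous.intervalIntegrable (by fun_prop) _ _)]
    have hκ : (cosA a : ℂ) = (dir a + (dir a)⁻¹) / 2 := by rw [dir_inv_eq, dir_eq]; ring
    have hI2 : (Complex.I)⁻¹ = -Complex.I := Complex.inv_I
    have hc : (cosA b.2 : ℂ) = (zeta b - (zeta b)⁻¹) / (2 * Complex.I) := by
      rw [← cosA_eq_zeta]; field_simp [Complex.I_ne_zero]
    have hσ : (sinA a : ℂ) = (dir a - (dir a)⁻¹) / (2 * Complex.I) := by
      rw [← sinA_eq_dir]; field_simp [Complex.I_ne_zero]
    have e1 : (((2 * cosA b.2 - cosA b.2) * sinA a + sinA b.2 * cosA a : ℝ) : ℂ) =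
        (zeta b * (dir a)⁻¹ + (zeta b * (dir a)⁻¹)⁻¹) / 2 := by
      push_cast
      rw [hc, hσ, hκ, sinA_eq_zeta, mul_inv, inv_inv]
      field_simp [Complex.I_ne_zero]
      rw [Complex.I_sq]; ring
    have e2 : (((0 - cosA b.2) * sinA a + sinA b.2 * cosA a : ℝ) : ℂ) =
        (zeta b * dir a + (zeta b * dir a)⁻¹) / 2 := by
      push_cast
      rw [hc, hσ, hκ, sinA_eq_zeta, mul_inv]
      field_simp [Complex.I_ne_zero]
      rw [Complex.I_sq]; ring
    rw [e1, e2, chebT_eq n (mul_ne_zero hζ (inv_ne_zero hw)), chebT_eq n (mul_ne_zero hζ hw)]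
    have h5 := sub_mul_dsum n hw
    rw [← sinA_eq_dir] at h5
    rw [← sub_div, div_eq_iff (mul_ne_zero hn hs')]
    have h6 : 2 / ((n : ℂ) + 1) * dsum n (dir a) *
        ((zeta b ^ (n + 1) - (zeta b)⁻¹ ^ (n + 1)) / (2 * Complex.I)) * ((n + 1) * sinA a) =
        (sinA a * (2 * Complex.I) * dsum n (dir a)) *
          (zeta b ^ (n + 1) - (zeta b)⁻¹ ^ (n + 1)) * (2 / (2 * Complex.I * (2 * Complex.I))) := by
      field_simp [Complex.I_ne_zero]
    have h7 : (2 : ℂ) / (2 * Complex.I * (2 * Complex.I)) = -1 / 2 := by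
      rw [mul_mul_mul_comm, Complex.I_mul_I]; norm_num
    rw [h6, h5, h7, mul_pow, mul_pow, mul_inv, inv_inv, mul_pow, mul_inv, mul_pow]
    ring

lemma I0_ridge (n : ℕ) (φ : Ang) (b : BdrySM) :
    I0 (ridge n φ) b = 2 / (n + 1) * ∑ j ∈ Finset.range (n + 1),
      (dir φ)⁻¹ ^ ((n : ℤ) - 2 * j) * sinE ((n : ℤ) - 2 * j) (n + 1) b := by
  have h : I0 (ridge n φ) b = ∫ t in (0 : ℝ)..(2 * cosA b.2), chebU n
      (((t - cosA b.2) * sinA (rayDir b - φ) + sinA b.2 * cosA (rayDir b - φ) : ℝ) : ℂ) := by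
    simp only [← offset_chord_eq]
    rfl
  rw [h, integral_ridge, dsum, mul_assoc, Finset.sum_mul]
  congr 1
  refine Finset.sum_congr rfl fun j _ => ?_
  have h2 := sinE_eq_zeta ((n : ℤ) - 2 * j) (n + 1) b
  push_cast at h2
  rw [h2, dir_sub, mul_zpow]
  ring

/-! ### Trigonometric polynomials -/

/-- The trigonometric polynomials spanned by `e^{i(n-2j)θ}`, `0 ≤ j ≤ n`. -/
def trig (n : ℕ) : Submodule ℂ (Ang → ℂ) :=
  Submodule.span ℂ ((fun j : ℕ => fun θ : Ang => dir θ ^ ((n : ℤ) - 2 * j)) '' {j | j ≤ n})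

lemma dir_zpow_mem_trig {n j : ℕ} (hj : j ≤ n) :
    (fun θ : Ang => dir θ ^ ((n : ℤ) - 2 * j)) ∈ trig n := Submodule.subset_span ⟨j, hj, rfl⟩

lemma trig_le_trig_add_two (n : ℕ) : trig n ≤ trig (n + 2) := by
  refine Submodule.span_le.mpr ?_
  rintro _ ⟨j, hj, rfl⟩
  have h := dir_zpow_mem_trig (n := n + 2) (j := j + 1) (by have : j ≤ n := hj; omega)
  have e : ((n + 2 : ℕ) : ℤ) - 2 * (j + 1 : ℕ) = (n : ℤ) - 2 * j := by push_cast; ring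
  rw [e] at h
  exact h

lemma mul_mem_trig {n : ℕ} (c d : ℂ) {u : Ang → ℂ} (hu : u ∈ trig n) :
    (fun θ => (c * dir θ + d * (dir θ)⁻¹) * u θ) ∈ trig (n + 1) := by
  induction hu using Submodule.span_induction with
  | mem u hu =>
    obtain ⟨j, hj, rfl⟩ := hu
    have hj' : j ≤ n := hj
    have h1 := (trig (n + 1)).smul_mem c (dir_zpow_mem_trig (n := n + 1) (j := j) (by omega))
    have h2 := (trig (n + 1)).smul_mem d (dir_zpow_mem_trig (n := n + 1) (j := j + 1) (by omega))
    convert (trig (n + 1)).add_mem h1 h2 using 1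
    funext θ
    have e1 : ((n + 1 : ℕ) : ℤ) - 2 * j = ((n : ℤ) - 2 * j) + 1 := by push_cast; ring
    have e2 : ((n + 1 : ℕ) : ℤ) - 2 * (j + 1 : ℕ) = ((n : ℤ) - 2 * j) - 1 := by push_cast; ring
    simp only [Pi.add_apply, Pi.smul_apply, smul_eq_mul]
    rw [e1, e2, zpow_add_one₀ (dir_ne_zero θ), zpow_sub_one₀ (dir_ne_zero θ)]
    ring
  | zero => simp; exact (trig (n + 1)).zero_mem
  | add u v _ _ hu hv =>
    convert (trig (n + 1)).add_mem hu hv using 1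
    funext θ; simp only [Pi.add_apply]; ring
  | smul a u _ hu =>
    convert (trig (n + 1)).smul_mem a hu using 1
    funext θ; simp only [Pi.smul_apply, smul_eq_mul]; ring

lemma offset_eq (x : ℂ) (θ : Ang) : (offset x θ : ℂ) =
    -((starRingEnd ℂ) x / (2 * Complex.I)) * dir θ + x / (2 * Complex.I) * (dir θ)⁻¹ := by
  have h : (offset x θ : ℂ) = (x * (dir θ)⁻¹ - (starRingEnd ℂ) (x * (dir θ)⁻¹)) / (2 * Complex.I) := by
    rw [Complex.sub_conj, offset]; push_cast
    field_simp [Complex.I_ne_zero]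
  rw [h, map_mul, map_inv₀, conj_dir, inv_inv]
  ring

/-- As a function of θ the offset is a combination of e^{iθ} and e^{-iθ}, so the three-term
recursion raises the degree by one at each step and keeps the parity of the frequencies. -/
lemma chebU_offset_mem_trig (n : ℕ) (x : ℂ) : (fun θ => chebU n (offset x θ)) ∈ trig n := by
  induction n using Nat.twoStepInduction with
  | zero =>
    convert dir_zpow_mem_trig (le_refl 0) using 2
    simp [chebU_zero]
  | one =>
    have h0 := mul_mem_trig (-((starRingEnd ℂ) x / (2 * Complex.I))) (x / (2 * Complex.I))
      (dir_zpow_mem_trig (le_refl 0))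
    convert (trig 1).smul_mem 2 h0 using 1
    funext θ
    simp [chebU_one, offset_eq]
  | more n h1 h2 =>
    have h0 := mul_mem_trig (-((starRingEnd ℂ) x / (2 * Complex.I))) (x / (2 * Complex.I)) h2
    convert (trig (n + 2)).sub_mem ((trig (n + 2)).smul_mem 2 h0) (trig_le_trig_add_two n h1) using 1
    funext θ
    simp only [Pi.sub_apply, Pi.smul_apply, smul_eq_mul, ← offset_eq]
    push_cast
    rw [chebU_add_two]
    ring

lemma integral_dir_zpow (n : ℤ) : ∫ θ : Ang, dir θ ^ n = if n = 0 then (2 * π : ℂ) else 0 := by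
  simp only [← fourier_eq_dir, integral_fourier]

lemma continuous_dir_zpow (n : ℤ) : Continuous fun θ => dir θ ^ n := by
  simp only [← fourier_eq_dir]; fun_prop

lemma continuous_of_mem_trig {n : ℕ} {u : Ang → ℂ} (hu : u ∈ trig n) : Continuous u := by
  induction hu using Submodule.span_induction with
  | mem u hu => obtain ⟨j, _, rfl⟩ := hu; exact continuous_dir_zpow _
  | zero => exact continuous_const
  | add u v _ _ hu hv => exact hu.add hv
  | smul a u _ hu => exact hu.const_smul a

lemma integrable_of_continuous {u : Ang → ℂ} (hu : Continuous u) : Integrable u volume :=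
  hu.integrable_of_hasCompactSupport (HasCompactSupport.of_compactSpace _)

lemma integral_zpow_mul_eq_zero {n : ℕ} {u : Ang → ℂ} (hu : u ∈ trig n) {p : ℤ}
    (hp : (n : ℤ) < |p|) : ∫ θ, dir θ ^ p * u θ = 0 := by
  induction hu using Submodule.span_induction with
  | mem u hu =>
    obtain ⟨j, hj, rfl⟩ := hu
    have hj' : j ≤ n := hj
    simp only [← zpow_add₀ (dir_ne_zero _), integral_dir_zpow]
    rw [if_neg]
    intro h
    rcases abs_cases p with ⟨h1, h2⟩ | ⟨h1, h2⟩ <;> omega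
  | zero => simp
  | add u v hu' hv' hu hv =>
    simp only [Pi.add_apply, mul_add]
    rw [integral_add, hu, hv, add_zero]
    · exact integrable_of_continuous ((continuous_dir_zpow p).mul (continuous_of_mem_trig hu'))
    · exact integrable_of_continuous ((continuous_dir_zpow p).mul (continuous_of_mem_trig hv'))
  | smul a u _ hu =>
    simp only [Pi.smul_apply, smul_eq_mul, mul_left_comm _ a]
    rw [integral_const_mul, hu, mul_zero]

/-- The reproducing property of the Dirichlet sum. -/
lemma integral_dsum_mul {n : ℕ} {u : Ang → ℂ} (hu : u ∈ trig n) (φ : Ang) :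
    ∑ j ∈ Finset.range (n + 1), (dir φ)⁻¹ ^ ((n : ℤ) - 2 * j) *
      ∫ θ, dir θ ^ ((n : ℤ) - 2 * j) * u θ = 2 * π * u φ := by
  induction hu using Submodule.span_induction with
  | mem u hu =>
    obtain ⟨k, hk, rfl⟩ := hu
    have hk' : k ≤ n := hk
    simp only [← zpow_add₀ (dir_ne_zero _), integral_dir_zpow]
    rw [Finset.sum_eq_single (n - k)]
    · rw [if_pos (by push_cast [hk']; ring), inv_zpow', mul_comm]
      congr 2; push_cast [hk']; ring
    · intro j _ hj
      rw [if_neg, mul_zero]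
      omega
    · intro h
      exact absurd (Finset.mem_range.mpr (by omega)) h
  | zero => simp
  | add u v hu' hv' hu hv =>
    simp only [Pi.add_apply, mul_add] at *
    rw [← hu, ← hv, ← Finset.sum_add_distrib]
    refine Finset.sum_congr rfl fun j _ => ?_
    rw [integral_add, mul_add]
    · exact integrable_of_continuous ((continuous_dir_zpow _).mul (continuous_of_mem_trig hu'))
    · exact integrable_of_continuous ((continuous_dir_zpow _).mul (continuous_of_mem_trig hv'))
  | smul a u _ hu =>
    simp only [Pi.smul_apply, smul_eq_mul, mul_left_comm _ a]
    rw [← hu, Finset.mul_sum]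
    refine Finset.sum_congr rfl fun j _ => ?_
    rw [integral_const_mul]; ring

lemma sum_integral_ridge (n : ℕ) (x : ℂ) (φ : Ang) :
    ∑ j ∈ Finset.range (n + 1), (dir φ)⁻¹ ^ ((n : ℤ) - 2 * j) *
      ∫ θ, dir θ ^ ((n : ℤ) - 2 * j) * chebU n (offset x θ) = 2 * π * ridge n φ x :=
  integral_dsum_mul (chebU_offset_mem_trig n x) φ

/-! ### Completeness of the ridge functions -/

lemma measurableSet_disc : MeasurableSet disc := Metric.isClosed_closedBall.measurableSet

lemma isCompact_disc : IsCompact disc := isCompact_closedBall 0 1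

instance : CompactSpace disc := isCompact_iff_compactSpace.mp isCompact_disc

lemma integrable_mul_continuous {g F : ℂ → ℂ} (hg : Integrable g discMeasure) (hF : Continuous F) :
    Integrable (fun x => g x * F x) discMeasure := by
  obtain ⟨C, hC⟩ := isCompact_disc.exists_bound_of_continuousOn hF.continuousOn
  refine hg.mul_bdd (c := C) hF.aestronglyMeasurable ?_
  exact (ae_restrict_mem measurableSet_disc).mono fun x hx => hC x hx

@[fun_prop]
lemma continuous_ridge (n : ℕ) (φ : Ang) : Continuous (ridge n φ) := by
  unfold ridge; fun_prop

/-- The recursion s U_n = (U_{n+1} + U_{n-1})/2 absorbs one power of s at a time, at the cost of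
varying n in the induction. -/
lemma integral_mul_offset_pow_eq_zero {g : ℂ → ℂ} (hg : Integrable g discMeasure)
    (h : ∀ n φ, ∫ x, g x * ridge n φ x ∂discMeasure = 0) (m n : ℕ) (φ : Ang) :
    ∫ x, g x * ((offset x φ : ℂ) ^ m * ridge n φ x) ∂discMeasure = 0 := by
  induction m generalizing n with
  | zero => simpa using h n φ
  | succ m ih =>
    cases n with
    | zero =>
      have e : ∀ x, g x * ((offset x φ : ℂ) ^ (m + 1) * ridge 0 φ x) =
          (1 / 2) * (g x * ((offset x φ : ℂ) ^ m * ridge 1 φ x)) := fun x => by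
        simp only [ridge]
        push_cast
        rw [chebU_zero, chebU_one]; ring
      simp only [e]
      rw [integral_const_mul, ih, mul_zero]
    | succ n =>
      have e : ∀ x, g x * ((offset x φ : ℂ) ^ (m + 1) * ridge (n + 1) φ x) =
          (1 / 2) * (g x * ((offset x φ : ℂ) ^ m * ridge (n + 2) φ x)
            + g x * ((offset x φ : ℂ) ^ m * ridge n φ x)) := fun x => by
        simp only [ridge]
        push_cast
        rw [chebU_add_two]; ring
      simp only [e]
      rw [integral_const_mul, integral_add, ih, ih]
      · simp
      · exact integrable_mul_continuous hg (by fun_prop)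
      · exact integrable_mul_continuous hg (by fun_prop)

lemma coeff_eq_zero_of_sum_dir_eq_zero {n : ℕ} {A : ℕ → ℂ}
    (h : ∀ φ : Ang, ∑ k ∈ Finset.range (n + 1), A k * dir φ ^ (2 * (k : ℤ) - n) = 0) {k : ℕ}
    (hk : k ≤ n) : A k = 0 := by
  have h1 : ∫ φ : Ang, dir φ ^ (-(2 * (k : ℤ) - n)) *
      ∑ j ∈ Finset.range (n + 1), A j * dir φ ^ (2 * (j : ℤ) - n) = 0 := by
    simp only [h, mul_zero, integral_zero]
  have e : ∀ φ : Ang, dir φ ^ (-(2 * (k : ℤ) - n)) *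
      ∑ j ∈ Finset.range (n + 1), A j * dir φ ^ (2 * (j : ℤ) - n) =
      ∑ j ∈ Finset.range (n + 1), A j * dir φ ^ (2 * (j : ℤ) - 2 * k) := fun φ => by
    rw [Finset.mul_sum]
    refine Finset.sum_congr rfl fun j _ => ?_
    rw [mul_left_comm, ← zpow_add₀ (dir_ne_zero φ)]
    congr 2; ring
  simp only [e] at h1
  have hI : ∀ j ∈ Finset.range (n + 1),
      Integrable (fun φ : Ang => A j * dir φ ^ (2 * (j : ℤ) - 2 * k)) volume := fun j _ =>
    integrable_of_continuous (continuous_const.mul (continuous_dir_zpow _))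
  rw [integral_finsetSum _ hI] at h1
  simp only [integral_const_mul, integral_dir_zpow] at h1
  rw [Finset.sum_eq_single k] at h1
  · simpa [Real.pi_ne_zero] using h1
  · intro j _ hj
    rw [if_neg (by omega), mul_zero]
  · intro hk'
    exact absurd (Finset.mem_range.mpr (by omega)) hk'

/-- For n = a + b, the moment of s^n is a trigonometric polynomial in φ whose coefficients are
nonzero multiples of the moments of x^{n-k} x̄^k. It vanishes for all φ, hence so does each
coefficient; take k = b. -/
lemma integral_mul_monomial_eq_zero {g : ℂ → ℂ} (hg : Integrable g discMeasure)
    (h : ∀ n φ, ∫ x, g x * ridge n φ x ∂discMeasure = 0) (a b : ℕ) :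
    ∫ x, g x * (x ^ a * (starRingEnd ℂ) x ^ b) ∂discMeasure = 0 := by
  set n := a + b with hn
  set A : ℕ → ℂ := fun k => ((-1) ^ k * (n.choose k : ℂ) / (2 * Complex.I) ^ n) *
    ∫ x, g x * (x ^ (n - k) * (starRingEnd ℂ) x ^ k) ∂discMeasure with hA
  have hsum : ∀ φ : Ang, ∑ k ∈ Finset.range (n + 1), A k * dir φ ^ (2 * (k : ℤ) - n) = 0 := by
    intro φ
    have h1 := integral_mul_offset_pow_eq_zero hg h n 0 φ
    have e : ∀ x, g x * ((offset x φ : ℂ) ^ n * ridge 0 φ x) = ∑ k ∈ Finset.range (n + 1),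
        ((-1) ^ k * (n.choose k : ℂ) / (2 * Complex.I) ^ n * dir φ ^ (2 * (k : ℤ) - n)) *
          (g x * (x ^ (n - k) * (starRingEnd ℂ) x ^ k)) := fun x => by
      simp only [ridge]
      push_cast
      rw [chebU_zero, mul_one, offset_eq, add_pow, Finset.mul_sum]
      refine Finset.sum_congr rfl fun k hk => ?_
      have hk' : k ≤ n := by have := Finset.mem_range.mp hk; omega
      have e1 : dir φ ^ (2 * (k : ℤ) - n) = dir φ ^ k * (dir φ)⁻¹ ^ (n - k) := by
        rw [inv_pow, ← zpow_natCast, ← zpow_natCast, ← zpow_neg, ← zpow_add₀ (dir_ne_zero φ)]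
        congr 1; push_cast [hk']; ring
      have e2 : (2 * Complex.I) ^ n = (2 * Complex.I) ^ k * (2 * Complex.I) ^ (n - k) := by
        rw [← pow_add]; congr 1; omega
      rw [e1, e2, mul_pow, mul_pow, neg_pow, div_pow, div_pow]
      field_simp [Complex.I_ne_zero]
    simp only [e] at h1
    rw [integral_finsetSum _ fun j _ =>
      (integrable_mul_continuous hg (by fun_prop)).const_mul _] at h1
    simp only [integral_const_mul] at h1
    rw [← h1]
    refine Finset.sum_congr rfl fun k _ => ?_
    simp only [hA]; ring
  have h2 := coeff_eq_zero_of_sum_dir_eq_zero hsum (k := b) (by omega)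
  simp only [hA] at h2
  rcases mul_eq_zero.mp h2 with h3 | h3
  · exfalso
    have hc : (n.choose b : ℂ) ≠ 0 := by
      exact_mod_cast (Nat.choose_pos (by omega)).ne'
    have : (-1 : ℂ) ^ b * (n.choose b : ℂ) / (2 * Complex.I) ^ n ≠ 0 :=
      div_ne_zero (mul_ne_zero (pow_ne_zero _ (by norm_num)) hc)
        (pow_ne_zero _ (mul_ne_zero (by norm_num) Complex.I_ne_zero))
    exact this h3
  · rwa [show n - b = a by omega] at h3

/-- Integration over the disc against an integrable function, as a functional on `C(M)`. -/
def discPairing (g : ℂ → ℂ) : C(disc, ℂ) → ℂ :=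
  fun f => ∫ x : disc, g x * f x ∂(volume.comap Subtype.val)

lemma integrable_comap {g : ℂ → ℂ} (hg : Integrable g discMeasure) (f : C(disc, ℂ)) :
    Integrable (fun x : disc => g x * f x) (volume.comap Subtype.val) := by
  have h1 : Integrable (fun x : disc => g x) (volume.comap Subtype.val) :=
    ((MeasurableEmbedding.subtype_coe measurableSet_disc).integrable_map_iff).mp (by
      rwa [map_comap_subtype_coe measurableSet_disc])
  refine h1.mul_bdd (c := ‖f‖) f.continuous.aestronglyMeasurable ?_
  exact Filter.Eventually.of_forall fun x => f.norm_coe_le_norm x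

lemma continuous_discPairing {g : ℂ → ℂ} (hg : Integrable g discMeasure) :
    Continuous (discPairing g) := by
  let L : C(disc, ℂ) →ₗ[ℂ] ℂ :=
    { toFun := discPairing g
      map_add' := fun f₁ f₂ => by
        simp only [discPairing, ContinuousMap.add_apply, mul_add]
        exact integral_add (integrable_comap hg f₁) (integrable_comap hg f₂)
      map_smul' := fun c f => by
        simp only [discPairing, ContinuousMap.smul_apply, smul_eq_mul, mul_left_comm _ c,
          RingHom.id_apply]
        exact integral_const_mul _ _ }
  refine AddMonoidHomClass.continuous_of_bound L
    (∫ x : disc, ‖g x‖ ∂(volume.comap Subtype.val)) fun f => ?_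
  have h1 : Integrable (fun x : disc => g x) (volume.comap Subtype.val) := by
    simpa using integrable_comap hg 1
  rw [← integral_mul_const]
  refine norm_integral_le_of_norm_le (h1.norm.mul_const _) ?_
  refine Filter.Eventually.of_forall fun x => ?_
  rw [norm_mul]
  exact mul_le_mul_of_nonneg_left (f.norm_coe_le_norm x) (norm_nonneg _)

lemma discPairing_eq_zero {g : ℂ → ℂ} (hg : Integrable g discMeasure)
    (h : ∀ n φ, ∫ x, g x * ridge n φ x ∂discMeasure = 0) (f : C(disc, ℂ)) :
    discPairing g f = 0 := by
  set z : C(disc, ℂ) := ContinuousMap.restrict disc (ContinuousMap.id ℂ) with hz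
  have hmon : ∀ a b : ℕ, discPairing g (z ^ a * star z ^ b * 1) = 0 := by
    intro a b
    have h1 := integral_mul_monomial_eq_zero hg h a b
    rw [discMeasure, ← integral_subtype_comap measurableSet_disc] at h1
    rw [← h1]
    refine integral_congr_ae (Filter.Eventually.of_forall fun x => ?_)
    simp [hz]
  have hadd : ∀ f₁ f₂ : C(disc, ℂ), discPairing g (f₁ + f₂) =
      discPairing g f₁ + discPairing g f₂ := fun f₁ f₂ => by
    simp only [discPairing, ContinuousMap.add_apply, mul_add]
    exact integral_add (integrable_comap hg f₁) (integrable_comap hg f₂)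
  -- Stone–Weierstrass induction must pass through products, so the statement is strengthened:
  -- multiplication by f preserves the class of k all of whose monomial multiples are annihilated.
  have key : ∀ f : C(disc, ℂ), ∀ k : C(disc, ℂ),
      (∀ a b : ℕ, discPairing g (z ^ a * star z ^ b * k) = 0) →
      ∀ a b : ℕ, discPairing g (z ^ a * star z ^ b * (f * k)) = 0 := by
    intro f
    refine ContinuousMap.induction_on_of_compact
      (p := fun f => ∀ k : C(disc, ℂ),
        (∀ a b : ℕ, discPairing g (z ^ a * star z ^ b * k) = 0) →
        ∀ a b : ℕ, discPairing g (z ^ a * star z ^ b * (f * k)) = 0) ?_ ?_ ?_ ?_ ?_ ?_ f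
    · intro r k hk a b
      have : discPairing g (z ^ a * star z ^ b * (ContinuousMap.const disc r * k)) =
          r * discPairing g (z ^ a * star z ^ b * k) := by
        simp only [discPairing]
        rw [← integral_const_mul]
        refine integral_congr_ae (Filter.Eventually.of_forall fun x => ?_)
        simp only [ContinuousMap.mul_apply, ContinuousMap.const_apply]; ring
      rw [this, hk, mul_zero]
    · intro k hk a b
      rw [← hk (a + 1) b]; congr 1; rw [← hz]; ring
    · intro k hk a b
      rw [← hk a (b + 1)]; congr 1; rw [← hz]; ring
    · intro f₁ f₂ h1 h2 k hk a b
      rw [add_mul, mul_add, hadd, h1 k hk, h2 k hk, add_zero]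
    · intro f₁ f₂ h1 h2 k hk a b
      rw [mul_assoc f₁]
      exact h1 _ (h2 k hk) a b
    · intro f hf k hk a b
      have hclosed : IsClosed {f : C(disc, ℂ) |
          discPairing g (z ^ a * star z ^ b * (f * k)) = 0} :=
        isClosed_eq ((continuous_discPairing hg).comp (by fun_prop)) continuous_const
      exact hclosed.closure_subset (mem_closure_iff_frequently.mpr (hf.mono fun f' hf' => hf' k hk a b))
  have := key f 1 hmon 0 0
  simpa using this

/-- An integrable function on the disc that is orthogonal to all ridge functions vanishes. -/
lemma ae_eq_zero_of_integral_ridge {g : ℂ → ℂ} (hg : Integrable g discMeasure)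
    (h : ∀ n φ, ∫ x, g x * ridge n φ x ∂discMeasure = 0) : g =ᵐ[discMeasure] 0 := by
  have hI : Integrable (disc.indicator g) volume := (integrable_indicator_iff measurableSet_disc).mpr hg
  have h1 := ae_eq_zero_of_integral_contDiff_smul_eq_zero hI.locallyIntegrable
    (fun ψ hψ _ => by
      have h2 := discPairing_eq_zero hg h ⟨fun x : disc => ((ψ x : ℝ) : ℂ),
        Complex.continuous_ofReal.comp (hψ.continuous.comp continuous_subtype_val)⟩
      have h3 : ∀ x, ψ x • disc.indicator g x = disc.indicator (fun x => g x * (ψ x : ℂ)) x := by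
        intro x
        by_cases hx : x ∈ disc
        · simp [hx, mul_comm]
        · simp [hx]
      simp only [h3]
      rw [integral_indicator measurableSet_disc, ← integral_subtype_comap measurableSet_disc]
      exact h2)
  rw [discMeasure]
  refine (ae_restrict_iff' measurableSet_disc).mpr (h1.mono fun x hx hm => ?_)
  rwa [Set.indicator_of_mem hm] at hx

/-! ### Pairings on `SM` -/

lemma phaseMeasure_eq : phaseMeasure = (volume.prod volume).restrict (disc ×ˢ Set.univ) := by
  rw [phaseMeasure, discMeasure, ← Measure.prod_restrict, Measure.restrict_univ]

lemma ae_mem_disc : ∀ᵐ p ∂phaseMeasure, p.1 ∈ disc := by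
  rw [phaseMeasure_eq]
  exact (ae_restrict_mem (measurableSet_disc.prod MeasurableSet.univ)).mono fun p hp => hp.1

lemma memLp_phase_of_continuous {F : ℂ × Ang → ℂ} (hF : Continuous F) : MemLp F 2 phaseMeasure := by
  obtain ⟨C, hC⟩ := (isCompact_disc.prod (isCompact_univ (X := Ang))).exists_bound_of_continuousOn
    hF.continuousOn
  exact MemLp.of_bound hF.aestronglyMeasurable C
    (ae_mem_disc.mono fun p hp => hC p ⟨hp, trivial⟩)

lemma memLp_volume_of_continuous {w : BdrySM → ℂ} (hw : Continuous w) :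
    MemLp w 2 (volume : Measure BdrySM) :=
  hw.memLp_of_hasCompactSupport (HasCompactSupport.of_compactSpace _)

lemma memLp_cosA_mul {v : BdrySM → ℂ} (hv : MemLp v 2 influxMeasure) :
    MemLp (fun b => (cosA b.2 : ℂ) * v b) 2 influxMeasure := by
  have hm : Continuous fun b : BdrySM => (cosA b.2 : ℂ) := by fun_prop
  refine hv.of_le (hm.aestronglyMeasurable.mul hv.1) (Filter.Eventually.of_forall fun b => ?_)
  rw [norm_mul, Complex.norm_real, Real.norm_eq_abs]
  exact mul_le_of_le_one_left (norm_nonneg _) (abs_cosA_le _)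

/-- Duality between backprojection and the ray transform, with the weight `cos α`. -/
lemma integral_comp_entry_mul {w : BdrySM → ℂ} {F : ℂ × Ang → ℂ} (hw : MemLp w 2 influxMeasure)
    (hF : MemLp F 2 phaseMeasure) :
    ∫ p, w (entry p) * F p ∂phaseMeasure =
      ∫ b, w b * ((cosA b.2 : ℂ) * rayTransform (fun x θ => F (x, θ)) b) ∂influxMeasure := by
  have h := integral_entry_mul (memLp_cosA_mul hw) hF
  have h2 : ∀ b, w b * ((cosA b.2 : ℂ) * rayTransform (fun x θ => F (x, θ)) b) =
      (cosA b.2 : ℂ) * w b * rayTransform (fun x θ => F (x, θ)) b := fun b => by ring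
  simp only [h2]
  rw [← h]
  refine integral_congr_ae ?_
  filter_upwards [quasiMeasurePreserving_entry.tendsto_ae.eventually ae_cosA_pos] with p hp
  have : (cosA (entry p).2 : ℂ) ≠ 0 := by exact_mod_cast hp.ne'
  field_simp

lemma continuous_dir_rayDir_zpow (p : ℤ) : Continuous fun b => dir (rayDir b) ^ p :=
  (continuous_dir_zpow p).comp continuous_rayDir

/-- Both θ and the offset are constant along a ray, and the offset equals sin α there. -/
lemma integral_profile_mul (p : ℤ) {P : ℂ → ℂ} (hP : Continuous P) {F : ℂ × Ang → ℂ}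
    (hF : MemLp F 2 phaseMeasure) :
    ∫ b, (dir (rayDir b) ^ p * P (sinA b.2)) *
      ((cosA b.2 : ℂ) * rayTransform (fun x θ => F (x, θ)) b) ∂influxMeasure =
    ∫ q, (dir q.2 ^ p * P (offset q.1 q.2)) * F q ∂phaseMeasure := by
  have hc : Continuous fun b => dir (rayDir b) ^ p * P (sinA b.2) :=
    (continuous_dir_rayDir_zpow p).mul (by fun_prop)
  rw [← integral_comp_entry_mul (memLp_influx (memLp_volume_of_continuous hc)) hF]
  refine integral_congr_ae ?_
  filter_upwards [ae_mem_disc] with q hq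
  rw [rayDir_entry, sinA_entry hq]

lemma continuous_profile (p : ℤ) {P : ℂ → ℂ} (hP : Continuous P) :
    Continuous fun q : ℂ × Ang => dir q.2 ^ p * P (offset q.1 q.2) :=
  ((continuous_dir_zpow p).comp continuous_snd).mul
    (hP.comp (Complex.continuous_ofReal.comp continuous_offset))

lemma memLp_fst {f : ℂ → ℂ} (hf : MemLp f 2 discMeasure) :
    MemLp (fun q : ℂ × Ang => f q.1) 2 phaseMeasure := hf.comp_fst _

lemma memLp_I0 {f : ℂ → ℂ} (hf : MemLp f 2 discMeasure) : MemLp (I0 f) 2 influxMeasure :=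
  memLp_rayTransform (F := fun q => f q.1) (memLp_fst hf)

/-! ### Calculus of profile functions -/

lemma hasFDerivAt_offset (x : ℂ) (θ : Ang) :
    HasFDerivAt (fun x => offset x θ)
      (Complex.imCLM.comp ((ContinuousLinearMap.mul ℝ ℂ).flip (dir θ)⁻¹)) x :=
  (Complex.imCLM.comp ((ContinuousLinearMap.mul ℝ ℂ).flip (dir θ)⁻¹)).hasFDerivAt

lemma hasFDerivAt_comp_offset {P : ℂ → ℂ} {P' : ℂ} {x : ℂ} {θ : Ang}
    (hP : HasDerivAt P P' (offset x θ)) :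
    HasFDerivAt (fun x => P (offset x θ)) ((Complex.imCLM.comp
      ((ContinuousLinearMap.mul ℝ ℂ).flip (dir θ)⁻¹)).smulRight P') x := by
  have h1 := hP.comp_ofReal.hasFDerivAt.comp x (hasFDerivAt_offset x θ)
  convert! h1 using 1

lemma fderiv_comp_offset {P : ℂ → ℂ} {P' : ℂ} {x : ℂ} {θ : Ang}
    (hP : HasDerivAt P P' (offset x θ)) (v : ℂ) :
    fderiv ℝ (fun x => P (offset x θ)) x v = ((v * (dir θ)⁻¹).im : ℂ) * P' := by
  rw [(hasFDerivAt_comp_offset hP).fderiv, ContinuousLinearMap.smulRight_apply, Complex.real_smul]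
  rfl

/-- X_⊥ is differentiation along -i e^{iθ}, the direction in which the offset decreases at unit
rate. -/
lemma sin_fderiv_sub_cos_fderiv (L : ℂ →L[ℝ] ℂ) (θ : Ang) :
    (sinA θ : ℂ) * L 1 - (cosA θ : ℂ) * L Complex.I = L (-Complex.I * dir θ) := by
  have h : -Complex.I * dir θ = (sinA θ) • (1 : ℂ) + (-cosA θ) • Complex.I := by
    rw [dir_eq, Complex.real_smul, Complex.real_smul]
    push_cast
    linear_combination -(sinA θ : ℂ) * Complex.I_mul_I
  rw [h, map_add, map_smul, map_smul, Complex.real_smul, Complex.real_smul]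
  push_cast; ring

lemma perp_mul_inv_im (θ : Ang) : (-Complex.I * dir θ * (dir θ)⁻¹).im = -1 := by
  rw [mul_assoc, mul_inv_cancel₀ (dir_ne_zero θ)]; simp

/-! ### Test functions -/

/-- `X_⊥ φ` for a test function `φ`. -/
def perpTest (φ : ℂ → ℝ) (q : ℂ × Ang) : ℂ :=
  Xperp (fun x => (fderiv ℝ φ x 1 : ℂ)) (fun x => (fderiv ℝ φ x Complex.I : ℂ)) q.1 q.2

lemma continuous_fderiv_test {φ : ℂ → ℝ} (hφ : ContDiff ℝ ∞ φ) (v : ℂ) :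
    Continuous fun x => fderiv ℝ φ x v :=
  (hφ.continuous_fderiv (by simp)).clm_apply continuous_const

lemma continuous_perpTest {φ : ℂ → ℝ} (hφ : ContDiff ℝ ∞ φ) : Continuous (perpTest φ) := by
  have h1 := continuous_fderiv_test hφ 1
  have h2 := continuous_fderiv_test hφ Complex.I
  unfold perpTest Xperp
  fun_prop

/-- The sign of integration by parts and the derivative -1 of the offset cancel. There is no
boundary term, because φ is smooth on the whole plane and vanishes off the disc. -/
lemma integral_comp_offset_mul_perpTest {φ : ℂ → ℝ} (hφ : ContDiff ℝ ∞ φ)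
    (hsupp : tsupport φ ⊆ disc) {P P' : ℂ → ℂ} (hP : ∀ z, HasDerivAt P (P' z) z)
    (hP' : Continuous P') (θ : Ang) :
    ∫ x, P (offset x θ) * perpTest φ (x, θ) ∂discMeasure =
      ∫ x, P' (offset x θ) * (φ x : ℂ) ∂discMeasure := by
  have hPc : Continuous P := continuous_iff_continuousAt.mpr fun z => (hP z).continuousAt
  set φc : ℂ → ℂ := fun x => (φ x : ℂ) with hφc
  have hφd : ∀ x, HasFDerivAt φc (Complex.ofRealCLM.comp (fderiv ℝ φ x)) x := fun x =>
    Complex.ofRealCLM.hasFDerivAt.comp x ((hφ.differentiable (by simp)) x).hasFDerivAt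
  have hcs : HasCompactSupport φ := isCompact_disc.of_isClosed_subset (isClosed_tsupport φ) hsupp
  set v : ℂ := -Complex.I * dir θ with hv
  have hperp : ∀ x, perpTest φ (x, θ) = fderiv ℝ φc x v := fun x => by
    rw [hv, ← sin_fderiv_sub_cos_fderiv, (hφd x).fderiv]
    rfl
  have hzero : ∀ x, x ∉ disc → φ x = 0 := fun x hx => image_eq_zero_of_notMem_tsupport
    fun h => hx (hsupp h)
  have hdzero : ∀ x, x ∉ disc → fderiv ℝ φc x = 0 := fun x hx => by
    rw [(hφd x).fderiv, image_eq_zero_of_notMem_tsupport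
      (fun h => hx (hsupp ((tsupport_fderiv_subset ℝ) h)))]
    simp
  have hfc : Continuous fun x => fderiv ℝ φc x v := by
    simp only [← hperp]
    exact (continuous_perpTest hφ).comp (Continuous.prodMk_left θ)
  have hQc : Continuous fun x => P (offset x θ) := by fun_prop
  have hf : ∀ x, fderiv ℝ (fun x => P (offset x θ)) x v = -P' (offset x θ) := fun x => by
    rw [fderiv_comp_offset (hP _), hv, perp_mul_inv_im]; simp
  have hcs1 : HasCompactSupport φc := hcs.comp_left (g := fun r : ℝ => (r : ℂ)) (by simp)
  have hcs2 : HasCompactSupport fun x => fderiv ℝ φc x v :=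
    HasCompactSupport.intro isCompact_disc fun x hx => by rw [hdzero x hx]; rfl
  have hφcc : Continuous φc := Complex.continuous_ofReal.comp hφ.continuous
  have key := integral_mul_fderiv_eq_neg_fderiv_mul_of_integrable (μ := (volume : Measure ℂ))
    (f := fun x => P (offset x θ)) (g := φc) (v := v)
    (by
      simp only [hf]
      exact Continuous.integrable_of_hasCompactSupport (by fun_prop) hcs1.mul_left)
    ((hQc.mul hfc).integrable_of_hasCompactSupport hcs2.mul_left)
    ((hQc.mul hφcc).integrable_of_hasCompactSupport hcs1.mul_left)
    (fun x _ => (hasFDerivAt_comp_offset (hP _)).differentiableAt)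
    (fun x _ => (hφd x).differentiableAt)
  simp only [hf] at key
  have e1 : ∫ x, P (offset x θ) * perpTest φ (x, θ) ∂discMeasure =
      ∫ x, P (offset x θ) * fderiv ℝ φc x v := by
    simp only [hperp]
    exact setIntegral_eq_integral_of_forall_compl_eq_zero fun x hx => by rw [hdzero x hx]; simp
  have e2 : ∫ x, P' (offset x θ) * (φ x : ℂ) ∂discMeasure =
      ∫ x, P' (offset x θ) * (φ x : ℂ) :=
    setIntegral_eq_integral_of_forall_compl_eq_zero fun x hx => by rw [hzero x hx]; simp
  rw [e1, e2, key, ← integral_neg]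
  simp only [neg_mul, neg_neg]
  rfl

/-! ### Distributional pairings and fibre averages. -/

lemma toDistr_apply {g : ℂ → ℂ} (hg : Integrable g discMeasure) (φ : 𝓓(openDisc, ℝ)) :
    toDistr g φ = ∫ x, (φ x : ℂ) * g x ∂discMeasure := by
  have hloc : LocallyIntegrableOn g (openDisc : Set ℂ) volume :=
    (IntegrableOn.mono_set (s := (openDisc : Set ℂ)) (t := disc) hg
      Metric.ball_subset_closedBall).locallyIntegrableOn
  refine (TestFunction.integralAgainstBilinCLM_eq_integral
    (B := ContinuousLinearMap.lsmul ℝ ℝ) (f := φ) hloc).trans ?_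
  rw [discMeasure, setIntegral_eq_integral_of_forall_compl_eq_zero]
  · rfl
  · intro x hx
    have : φ x = 0 := image_eq_zero_of_notMem_tsupport fun h =>
      hx (Metric.ball_subset_closedBall (φ.tsupport_subset' h))
    rw [this]; simp

lemma lineDerivOp_test_apply (φ : 𝓓(openDisc, ℝ)) (v x : ℂ) : (∂_{v} φ) x = fderiv ℝ φ x v := by
  rw [TestFunction.lineDerivOp_eq_lineDerivCLM ℝ, TestFunction.lineDerivCLM_apply_of_le (by simp)]
  exact ((φ.contDiff'.differentiable (by simp)) x).lineDeriv_eq_fderiv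

lemma integrable_phase_mul_continuous {F G : ℂ × Ang → ℂ} (hG : Integrable G phaseMeasure)
    (hF : Continuous F) : Integrable (fun q => F q * G q) phaseMeasure := by
  obtain ⟨C, hC⟩ := (isCompact_disc.prod (isCompact_univ (X := Ang))).exists_bound_of_continuousOn
    hF.continuousOn
  exact hG.bdd_mul (c := C) hF.aestronglyMeasurable
    (ae_mem_disc.mono fun p hp => hC p ⟨hp, trivial⟩)

lemma integral_mul_fiberAvg {u : ℂ → Ang → ℂ} {k : ℂ → ℂ}
    (hu : Integrable (fun q : ℂ × Ang => u q.1 q.2) phaseMeasure) (hk : Continuous k) :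
    ∫ x, k x * fiberAvg u x ∂discMeasure =
      (1 / (2 * π)) * ∫ q, k q.1 * u q.1 q.2 ∂phaseMeasure := by
  have h1 := integrable_phase_mul_continuous hu (hk.comp continuous_fst)
  have h2 := integral_prod (μ := discMeasure) (ν := (volume : Measure Ang)) _ h1
  simp only [Function.comp, integral_const_mul] at h2
  rw [phaseMeasure, h2, ← integral_const_mul]
  refine integral_congr_ae (Filter.Eventually.of_forall fun x => ?_)
  simp only [fiberAvg]; ring

lemma integrable_fiberAvg {u : ℂ → Ang → ℂ}
    (hu : Integrable (fun q : ℂ × Ang => u q.1 q.2) phaseMeasure) :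
    Integrable (fiberAvg u) discMeasure :=
  (Integrable.integral_prod_left (μ := discMeasure) (ν := (volume : Measure Ang)) hu).const_mul _

lemma avgXperp_apply {u : ℂ → Ang → ℂ} (hu : Integrable (fun q : ℂ × Ang => u q.1 q.2) phaseMeasure)
    (φ : 𝓓(openDisc, ℝ)) :
    avgXperp u φ = -(1 / (2 * π)) * ∫ q, u q.1 q.2 * perpTest φ q ∂phaseMeasure := by
  have hs : Integrable (fun q : ℂ × Ang => (sinA q.2 : ℂ) * u q.1 q.2) phaseMeasure :=
    integrable_phase_mul_continuous hu (by fun_prop)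
  have hc : Integrable (fun q : ℂ × Ang => (cosA q.2 : ℂ) * u q.1 q.2) phaseMeasure :=
    integrable_phase_mul_continuous hu (by fun_prop)
  have k1 : Continuous fun x => ((fderiv ℝ φ x 1 : ℝ) : ℂ) :=
    Complex.continuous_ofReal.comp (continuous_fderiv_test φ.contDiff' 1)
  have k2 : Continuous fun x => ((fderiv ℝ φ x Complex.I : ℝ) : ℂ) :=
    Complex.continuous_ofReal.comp (continuous_fderiv_test φ.contDiff' Complex.I)
  have e1 := toDistr_apply (integrable_fiberAvg (u := fun x θ => (sinA θ : ℂ) * u x θ) hs)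
    (∂_{(1 : ℂ)} φ)
  have e2 := toDistr_apply (integrable_fiberAvg (u := fun x θ => (cosA θ : ℂ) * u x θ) hc)
    (∂_{Complex.I} φ)
  simp only [lineDerivOp_test_apply] at e1 e2
  rw [integral_mul_fiberAvg (u := fun x θ => (sinA θ : ℂ) * u x θ) hs k1] at e1
  rw [integral_mul_fiberAvg (u := fun x θ => (cosA θ : ℂ) * u x θ) hc k2] at e2
  have e3 : avgXperp u φ = -(toDistr (fiberAvg fun x θ => (sinA θ : ℂ) * u x θ) (∂_{(1 : ℂ)} φ)) -
      -(toDistr (fiberAvg fun x θ => (cosA θ : ℂ) * u x θ) (∂_{Complex.I} φ)) := rfl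
  rw [e3, e1, e2]
  have e4 : ∫ q, u q.1 q.2 * perpTest φ q ∂phaseMeasure =
      ∫ q : ℂ × Ang, ((fderiv ℝ φ q.1 1 : ℝ) : ℂ) * ((sinA q.2 : ℂ) * u q.1 q.2) ∂phaseMeasure -
      ∫ q : ℂ × Ang, ((fderiv ℝ φ q.1 Complex.I : ℝ) : ℂ) * ((cosA q.2 : ℂ) * u q.1 q.2)
        ∂phaseMeasure := by
    refine Eq.trans ?_ (integral_sub
      (integrable_phase_mul_continuous hs (k1.comp continuous_fst))
      (integrable_phase_mul_continuous hc (k2.comp continuous_fst)))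
    refine integral_congr_ae (Filter.Eventually.of_forall fun q => ?_)
    simp only [perpTest, Xperp]; ring
  rw [e4]; ring

/-! ### Inversion of `I₀` -/

lemma integral_I0_ridge_mul (n : ℕ) (φ : Ang) {v : BdrySM → ℂ} (hv : MemLp v 2 influxMeasure) :
    ∫ b, I0 (ridge n φ) b * v b ∂influxMeasure = 2 / (n + 1) * ∑ j ∈ Finset.range (n + 1),
      (dir φ)⁻¹ ^ ((n : ℤ) - 2 * j) *
        ∫ b, sinE ((n : ℤ) - 2 * j) (n + 1) b * v b ∂influxMeasure := by
  have hI : ∀ j ∈ Finset.range (n + 1), Integrable (fun b => (dir φ)⁻¹ ^ ((n : ℤ) - 2 * j) *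
      (sinE ((n : ℤ) - 2 * j) (n + 1) b * v b)) influxMeasure := fun j _ =>
    ((memLp_influx (memLp_sinE _ _)).integrable_mul hv).const_mul _
  simp only [← integral_const_mul]
  rw [← integral_finsetSum _ hI, ← integral_const_mul]
  refine integral_congr_ae (Filter.Eventually.of_forall fun b => ?_)
  simp only [I0_ridge, mul_assoc, Finset.sum_mul]

lemma integral_PminusDagger_sinE_mul {n j : ℕ} (hj : j ≤ n) {v : BdrySM → ℂ} :
    ∫ b, PminusDagger (sinE ((n : ℤ) - 2 * j) (n + 1)) b * v b ∂influxMeasure =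
      -(1 / 2) * ∫ b, cosE ((n : ℤ) - 2 * j) (n + 1) b * v b ∂influxMeasure := by
  have hodd : ¬ Even ((n : ℤ) - 2 * j - (n + 1)) := by
    rw [Int.not_even_iff_odd]; exact ⟨-j - 1, by ring⟩
  rw [← integral_const_mul]
  refine integral_congr_ae ?_
  filter_upwards [PminusDagger_sinE hodd (by omega) (by omega)] with b hb
  rw [hb, mul_assoc]

lemma integral_profile_mul_perpTest {φ : ℂ → ℝ} (hφ : ContDiff ℝ ∞ φ) (hsupp : tsupport φ ⊆ disc)
    (p : ℤ) {P P' : ℂ → ℂ} (hP : ∀ z, HasDerivAt P (P' z) z) (hP' : Continuous P') :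
    ∫ q, (dir q.2 ^ p * P (offset q.1 q.2)) * perpTest φ q ∂phaseMeasure =
      ∫ q, (dir q.2 ^ p * P' (offset q.1 q.2)) * (φ q.1 : ℂ) ∂phaseMeasure := by
  have hPc : Continuous P := continuous_iff_continuousAt.mpr fun z => (hP z).continuousAt
  have hc1 : Continuous fun q => (dir q.2 ^ p * P (offset q.1 q.2)) * perpTest φ q :=
    (continuous_profile p hPc).mul (continuous_perpTest hφ)
  have hc2 : Continuous fun q : ℂ × Ang => (dir q.2 ^ p * P' (offset q.1 q.2)) * (φ q.1 : ℂ) :=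
    (continuous_profile p hP').mul
      (Complex.continuous_ofReal.comp (hφ.continuous.comp continuous_fst))
  rw [phaseMeasure, integral_prod_symm _ ((memLp_phase_of_continuous hc1).integrable (by norm_num)),
    integral_prod_symm _ ((memLp_phase_of_continuous hc2).integrable (by norm_num))]
  refine integral_congr_ae (Filter.Eventually.of_forall fun θ => ?_)
  simp only [mul_assoc, integral_const_mul]
  rw [integral_comp_offset_mul_perpTest hφ hsupp hP hP']

/-- The sum over all harmonics of the backprojection of `U_n` reproduces the ridge function. -/
lemma sum_integral_profile_chebU (n : ℕ) (ψ : Ang) {h : ℂ → ℂ} (hh : Integrable h discMeasure) :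
    ∑ j ∈ Finset.range (n + 1), (dir ψ)⁻¹ ^ ((n : ℤ) - 2 * j) *
      ∫ q, (dir q.2 ^ ((n : ℤ) - 2 * j) * chebU n (offset q.1 q.2)) * h q.1 ∂phaseMeasure =
      2 * π * ∫ x, ridge n ψ x * h x ∂discMeasure := by
  have hI : ∀ p : ℤ, Integrable
      (fun q : ℂ × Ang => (dir q.2 ^ p * chebU n (offset q.1 q.2)) * h q.1)
      (discMeasure.prod volume) := fun p =>
    integrable_phase_mul_continuous (hh.comp_fst (volume : Measure Ang))
      (continuous_profile p (continuous_chebU n))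
  have e1 : ∀ p : ℤ, ∫ q, (dir q.2 ^ p * chebU n (offset q.1 q.2)) * h q.1 ∂phaseMeasure =
      ∫ x, (∫ θ, dir θ ^ p * chebU n (offset x θ)) * h x ∂discMeasure := fun p => by
    rw [phaseMeasure, integral_prod _ (hI p)]
    simp only [integral_mul_const]
  have hI2 : ∀ p : ℤ, Integrable (fun x => (∫ θ, dir θ ^ p * chebU n (offset x θ)) * h x)
      discMeasure := fun p => by
    have := (hI p).integral_prod_left
    simpa only [integral_mul_const] using this
  simp only [e1, ← integral_const_mul]
  rw [← integral_finsetSum _ fun j _ => (hI2 _).const_mul _]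
  refine integral_congr_ae (Filter.Eventually.of_forall fun x => ?_)
  simp only [← mul_assoc]
  rw [← Finset.sum_mul, sum_integral_ridge]

/-- The density `G` such that `⟨(X_⊥ (P₋† I₀ f)_ψ)₀, φ⟩ = -(1/2π) ∫ f G`. -/
def testDensity (φ : ℂ → ℝ) (q : ℂ × Ang) : ℂ :=
  PminusTranspose (fun b => (cosA b.2 : ℂ) * rayTransform (fun x θ => perpTest φ (x, θ)) b) (entry q)
    / (cosA (entry q).2 : ℂ)

lemma memLp_cosA_rayTransform {F : ℂ × Ang → ℂ} (hF : MemLp F 2 phaseMeasure) :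
    MemLp (fun b => (cosA b.2 : ℂ) * rayTransform (fun x θ => F (x, θ)) b) 2 influxMeasure :=
  memLp_cosA_mul (memLp_rayTransform hF)

lemma integrable_testDensity_mul (φ : ℂ → ℝ) {f : ℂ → ℂ} (hf : MemLp f 2 discMeasure) :
    Integrable (fun q => testDensity φ q * f q.1) phaseMeasure :=
  integrable_entry_mul (memLp_PminusTranspose _) (memLp_fst hf)

lemma integral_PminusDagger_I0 {φ : ℂ → ℝ} (hφ : ContDiff ℝ ∞ φ) {f : ℂ → ℂ}
    (hf : MemLp f 2 discMeasure) :
    ∫ q, PminusDagger (I0 f) (entry q) * perpTest φ q ∂phaseMeasure =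
      ∫ b, I0 f b * PminusTranspose (fun b => (cosA b.2 : ℂ) *
        rayTransform (fun x θ => perpTest φ (x, θ)) b) b ∂influxMeasure := by
  have hF := memLp_phase_of_continuous (continuous_perpTest hφ)
  rw [integral_comp_entry_mul (memLp_PminusDagger _) hF,
    integral_PminusDagger_mul (memLp_I0 hf) (memLp_cosA_rayTransform hF)]

lemma integral_I0_mul_PminusTranspose (φ : ℂ → ℝ) {f : ℂ → ℂ} (hf : MemLp f 2 discMeasure) :
    ∫ b, I0 f b * PminusTranspose (fun b => (cosA b.2 : ℂ) *
        rayTransform (fun x θ => perpTest φ (x, θ)) b) b ∂influxMeasure =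
      ∫ x, (∫ θ, testDensity φ (x, θ)) * f x ∂discMeasure := by
  have h := integral_entry_mul (memLp_PminusTranspose (fun b => (cosA b.2 : ℂ) *
    rayTransform (fun x θ => perpTest φ (x, θ)) b)) (memLp_fst hf)
  have h2 := integral_prod (μ := discMeasure) (ν := (volume : Measure Ang)) _
    (integrable_testDensity_mul φ hf)
  simp only [integral_mul_const] at h2
  rw [← h2]
  refine Eq.trans ?_ h.symm
  refine integral_congr_ae (Filter.Eventually.of_forall fun b => ?_)
  exact mul_comm _ _

lemma memLp_ridge (n : ℕ) (ψ : Ang) : MemLp (ridge n ψ) 2 discMeasure := by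
  obtain ⟨C, hC⟩ := isCompact_disc.exists_bound_of_continuousOn (continuous_ridge n ψ).continuousOn
  exact MemLp.of_bound (continuous_ridge n ψ).aestronglyMeasurable C
    ((ae_restrict_mem measurableSet_disc).mono fun x hx => hC x hx)

/-- This is the first identity for f a ridge function. The constants 2/(n+1) from I₀, -1/2 from P₋†
and n+1 from T_{n+1}' multiply to -1; the Dirichlet sum contributes 2π. -/
lemma integral_testDensity_mul_ridge {φ : ℂ → ℝ} (hφ : ContDiff ℝ ∞ φ) (hsupp : tsupport φ ⊆ disc)
    (n : ℕ) (ψ : Ang) :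
    ∫ x, (∫ θ, testDensity φ (x, θ)) * ridge n ψ x ∂discMeasure =
      -(2 * π) * ∫ x, ridge n ψ x * (φ x : ℂ) ∂discMeasure := by
  have hn : (n + 1 : ℂ) ≠ 0 := by exact_mod_cast n.succ_ne_zero
  have hF := memLp_phase_of_continuous (continuous_perpTest hφ)
  have hφI : Integrable (fun x => (φ x : ℂ)) discMeasure := by
    have := integrable_mul_continuous (g := fun _ => 1) (integrable_const _)
      (Complex.continuous_ofReal.comp hφ.continuous)
    simpa using this
  rw [← integral_I0_mul_PminusTranspose φ (memLp_ridge n ψ),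
    integral_I0_ridge_mul n ψ (memLp_PminusTranspose _), ← neg_mul_eq_neg_mul,
    ← sum_integral_profile_chebU n ψ hφI, Finset.mul_sum, ← Finset.sum_neg_distrib]
  refine Finset.sum_congr rfl fun j hj => ?_
  have hj' : j ≤ n := by have := Finset.mem_range.mp hj; omega
  -- Transposing back puts P₋† on the sine mode, where it is diagonal.
  rw [← integral_PminusDagger_mul (memLp_influx (memLp_sinE _ _)) (memLp_cosA_rayTransform hF),
    integral_PminusDagger_sinE_mul hj']
  simp only [cosE_eq_chebT]
  rw [integral_profile_mul _ (continuous_chebT _) hF,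
    integral_profile_mul_perpTest hφ hsupp _ (hasDerivAt_chebT n)
      (continuous_const.mul (continuous_chebU n))]
  simp only [mul_left_comm _ ((n : ℂ) + 1), mul_assoc, integral_const_mul, Int.cast_natCast]
  field_simp

lemma integral_testDensity {φ : ℂ → ℝ} (hφ : ContDiff ℝ ∞ φ) (hsupp : tsupport φ ⊆ disc) :
    (fun x => ∫ θ, testDensity φ (x, θ)) =ᵐ[discMeasure] fun x => -(2 * π) * (φ x : ℂ) := by
  have h1 : MemLp (fun _ : ℂ => (1 : ℂ)) 2 discMeasure := memLp_const 1
  have hG : Integrable (fun x => ∫ θ, testDensity φ (x, θ)) discMeasure := by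
    have := (integrable_testDensity_mul φ h1).integral_prod_left
    simpa using this
  have hφc : Continuous fun x => (φ x : ℂ) := Complex.continuous_ofReal.comp hφ.continuous
  have hφI : Integrable (fun x => (φ x : ℂ)) discMeasure := by
    simpa using integrable_mul_continuous (g := fun _ => 1) (integrable_const _) hφc
  have h := ae_eq_zero_of_integral_ridge (hG.add (hφI.const_mul (2 * π))) fun n ψ => by
    have i1 : Integrable (fun x => 2 * (π : ℂ) * (ridge n ψ x * (φ x : ℂ))) discMeasure := by
      refine Integrable.const_mul ?_ _
      simpa only [mul_comm] using integrable_mul_continuous hφI (continuous_ridge n ψ)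
    have i2 : ∀ x, ((fun x => ∫ θ, testDensity φ (x, θ)) + fun x => 2 * π * (φ x : ℂ)) x *
        ridge n ψ x = (∫ θ, testDensity φ (x, θ)) * ridge n ψ x +
          2 * π * (ridge n ψ x * (φ x : ℂ)) := fun x => by
      simp only [Pi.add_apply]; ring
    simp only [i2]
    rw [integral_add (integrable_mul_continuous hG (continuous_ridge n ψ)) i1,
      integral_testDensity_mul_ridge hφ hsupp, integral_const_mul]
    ring
  filter_upwards [h] with x hx
  simp only [Pi.add_apply, Pi.zero_apply] at hx
  linear_combination hx

/-- All operators have been moved onto the test function, and the resulting density does not involve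
f; a general f in L² therefore needs no approximation. -/
theorem toDistr_eq_IperpSharp {f : ℂ → ℂ} (hf : MemLp f 2 discMeasure) :
    toDistr f = (-(1 / (2 * π))) • IperpSharp (PminusDagger (I0 f)) := by
  have hpi : (π : ℂ) ≠ 0 := by exact_mod_cast Real.pi_ne_zero
  ext φ
  have hφ : ContDiff ℝ ∞ (φ : ℂ → ℝ) := φ.contDiff'
  have hsupp : tsupport φ ⊆ disc := φ.tsupport_subset'.trans Metric.ball_subset_closedBall
  have hu : Integrable (fun q : ℂ × Ang => psiExt (PminusDagger (I0 f)) q.1 q.2) phaseMeasure :=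
    (memLp_comp_entry (memLp_PminusDagger (I0 f))).integrable (by norm_num)
  have e1 : ((-(1 / (2 * π))) • IperpSharp (PminusDagger (I0 f))) φ =
      avgXperp (psiExt (PminusDagger (I0 f))) φ := by
    rw [IperpSharp, smul_smul]
    have : (-(1 / (2 * π)) * -(2 * π) : ℝ) = 1 := by field_simp
    rw [this, one_smul]
  rw [e1, avgXperp_apply hu, toDistr_apply (hf.integrable (by norm_num))]
  have e2 := integral_PminusDagger_I0 hφ hf
  rw [integral_I0_mul_PminusTranspose φ hf] at e2
  have e3 : ∫ x, (∫ θ, testDensity φ (x, θ)) * f x ∂discMeasure =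
      -(2 * π) * ∫ x, (φ x : ℂ) * f x ∂discMeasure := by
    rw [← integral_const_mul]
    refine integral_congr_ae ?_
    filter_upwards [integral_testDensity hφ hsupp] with x hx
    rw [hx, mul_assoc]
  refine Eq.symm ((congrArg (fun z => -(1 / (2 * π) : ℂ) * z) (e2.trans e3)).trans ?_)
  field_simp

/-! ### Derivatives of Chebyshev polynomials and boundary values -/

/-- The derivative of the Chebyshev polynomial of the second kind. -/
def dchebU (n : ℤ) (z : ℂ) : ℂ := (Polynomial.Chebyshev.U ℂ n).derivative.eval z

lemma hasDerivAt_chebU (n : ℤ) (z : ℂ) : HasDerivAt (chebU n) (dchebU n z) z :=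
  (Polynomial.Chebyshev.U ℂ n).hasDerivAt z

@[fun_prop]
lemma continuous_dchebU (n : ℤ) : Continuous (dchebU n) :=
  (Polynomial.Chebyshev.U ℂ n).derivative.continuous

lemma chebU_sub (n : ℤ) (z : ℂ) : chebU (n + 1) z - chebU (n - 1) z = 2 * chebT (n + 1) z := by
  have h1 := chebU_add_two (n - 1) z
  have h2 : chebT (n + 1) z = chebU (n + 1) z - z * chebU n z := by
    simp [chebT, chebU, Polynomial.Chebyshev.T_eq_U_sub_X_mul_U]
  rw [show n - 1 + 2 = n + 1 by ring, show n - 1 + 1 = n by ring] at h1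
  rw [h2]; linear_combination -h1

lemma dchebU_sub (n : ℤ) (z : ℂ) :
    dchebU (n + 1) z - dchebU (n - 1) z = 2 * ((n + 1) * chebU n z) := by
  have h1 := (hasDerivAt_chebU (n + 1) z).sub (hasDerivAt_chebU (n - 1) z)
  have h2 := (hasDerivAt_chebT n z).const_mul 2
  have h3 : (chebU (n + 1) - chebU (n - 1)) = fun z => 2 * chebT (n + 1) z :=
    funext fun z => chebU_sub n z
  rw [h3] at h1
  exact h1.unique h2

lemma dchebU_zero (z : ℂ) : dchebU 0 z = 0 := by simp [dchebU]

lemma mul_chebU (n : ℤ) (z : ℂ) : z * chebU n z = (chebU (n + 1) z + chebU (n - 1) z) / 2 := by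
  have h1 := chebU_add_two (n - 1) z
  rw [show n - 1 + 2 = n + 1 by ring, show n - 1 + 1 = n by ring] at h1
  rw [h1]; ring

/-- Induction through U_{n+1}' = 2(n+1) U_n + U_{n-1}'. The degree n makes harmonics with |p| > n
vanish, which settles the edge modes. -/
lemma dchebU_offset_mem_trig (n : ℕ) (x : ℂ) :
    (fun θ => dchebU (n + 1) (offset x θ)) ∈ trig n := by
  induction n using Nat.twoStepInduction with
  | zero =>
    have h : (fun θ => dchebU ((0 : ℕ) + 1) (offset x θ)) =
        (2 : ℂ) • fun θ => chebU (0 : ℕ) (offset x θ) := by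
      funext θ
      simp [dchebU, chebU]
    rw [h]
    exact (trig 0).smul_mem 2 (chebU_offset_mem_trig 0 x)
  | one =>
    have h : (fun θ => dchebU ((1 : ℕ) + 1) (offset x θ)) =
        (4 : ℂ) • fun θ => chebU (1 : ℕ) (offset x θ) := by
      funext θ
      have h1 := dchebU_sub 1 (offset x θ)
      simp only [sub_self, dchebU_zero] at h1
      simp only [Pi.smul_apply, smul_eq_mul, Nat.cast_one]
      generalize dchebU (1 + 1) (offset x θ : ℂ) = d at h1 ⊢
      push_cast at h1
      linear_combination h1
    rw [h]
    exact (trig 1).smul_mem 4 (chebU_offset_mem_trig 1 x)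
  | more n h1 _ =>
    have h : (fun θ => dchebU ((n + 2 : ℕ) + 1) (offset x θ)) =
        ((2 * (n + 3) : ℂ) • fun θ => chebU (n + 2 : ℕ) (offset x θ)) +
          fun θ => dchebU (n + 1) (offset x θ) := by
      funext θ
      have h1 := dchebU_sub (n + 2 : ℕ) (offset x θ)
      rw [show ((n + 2 : ℕ) : ℤ) - 1 = n + 1 by push_cast; ring] at h1
      simp only [Pi.add_apply, Pi.smul_apply, smul_eq_mul]
      push_cast at h1 ⊢
      linear_combination h1
    rw [h]
    exact (trig (n + 2)).add_mem ((trig (n + 2)).smul_mem _ (chebU_offset_mem_trig (n + 2) x))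
      (trig_le_trig_add_two n h1)

/-- The `p`-th harmonic of the boundary values of `U_m (s)`. -/
def bdryCoeff (m p : ℤ) (β : Ang) : ℂ := ∫ θ, dir θ ^ p * chebU m (offset (dir β) θ)

lemma offset_dir (β θ : Ang) : (offset (dir β) θ : ℂ) =
    (-Complex.I * dir β * (dir θ)⁻¹ + (-Complex.I * dir β * (dir θ)⁻¹)⁻¹) / 2 := by
  rw [offset_eq, conj_dir, mul_inv, mul_inv, inv_inv, inv_neg, Complex.inv_I]
  field_simp [Complex.I_ne_zero, dir_ne_zero β, dir_ne_zero θ]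
  rw [Complex.I_sq]
  ring

/-- On the unit circle U_m(s) is a Dirichlet sum in θ, so its p-th harmonic depends on p alone and
not on m, as long as p occurs in it. -/
lemma bdryCoeff_of_le {m j : ℕ} (hj : j ≤ m) (β : Ang) :
    bdryCoeff m ((m : ℤ) - 2 * j) β = 2 * π * (-Complex.I * dir β) ^ ((m : ℤ) - 2 * j) := by
  have hne : -Complex.I * dir β ≠ 0 := mul_ne_zero (neg_ne_zero.mpr Complex.I_ne_zero) (dir_ne_zero β)
  have e : ∀ θ, dir θ ^ ((m : ℤ) - 2 * j) * chebU m (offset (dir β) θ) =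
      ∑ k ∈ Finset.range (m + 1), (-Complex.I * dir β) ^ ((m : ℤ) - 2 * k) *
        dir θ ^ (2 * (k : ℤ) - 2 * j) := fun θ => by
    rw [offset_dir, chebU_eq_dsum m (mul_ne_zero hne (inv_ne_zero (dir_ne_zero θ))), dsum,
      Finset.mul_sum]
    refine Finset.sum_congr rfl fun k _ => ?_
    rw [mul_zpow _ (dir θ)⁻¹, inv_zpow', mul_left_comm, ← zpow_add₀ (dir_ne_zero θ)]
    congr 2; ring
  have hI : ∀ k ∈ Finset.range (m + 1), Integrable (fun θ : Ang =>
      (-Complex.I * dir β) ^ ((m : ℤ) - 2 * k) * dir θ ^ (2 * (k : ℤ) - 2 * j)) volume :=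
    fun k _ => integrable_of_continuous (continuous_const.mul (continuous_dir_zpow _))
  simp only [bdryCoeff, e]
  rw [integral_finsetSum _ hI]
  simp only [integral_const_mul, integral_dir_zpow]
  rw [Finset.sum_eq_single j]
  · simp [mul_comm]
  · intro k _ hk
    rw [if_neg (by omega), mul_zero]
  · intro h
    exact absurd (Finset.mem_range.mpr (by omega)) h

lemma bdryCoeff_of_lt {m : ℕ} {p : ℤ} (hp : (m : ℤ) < |p|) (β : Ang) : bdryCoeff m p β = 0 :=
  integral_zpow_mul_eq_zero (chebU_offset_mem_trig m (dir β)) hp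

lemma bdryCoeff_neg_one (p : ℤ) (β : Ang) : bdryCoeff (-1) p β = 0 := by
  simp [bdryCoeff, chebU_neg_one]

/-- The `p`-th harmonic of the boundary values of `s U_m (s)`. -/
def bdryMoment (m p : ℤ) (β : Ang) : ℂ :=
  ∫ θ, dir θ ^ p * (chebU m (offset (dir β) θ) * offset (dir β) θ)

lemma bdryMoment_eq (m p : ℤ) (β : Ang) :
    bdryMoment m p β = (bdryCoeff (m + 1) p β + bdryCoeff (m - 1) p β) / 2 := by
  have hI : ∀ m : ℤ, Integrable (fun θ => dir θ ^ p * chebU m (offset (dir β) θ)) volume := fun m =>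
    integrable_of_continuous ((continuous_dir_zpow p).mul (by fun_prop))
  rw [bdryMoment, bdryCoeff, bdryCoeff, ← integral_add (hI _) (hI _), ← integral_div]
  refine integral_congr_ae (Filter.Eventually.of_forall fun θ => ?_)
  simp only [mul_comm (chebU m _), mul_chebU]
  ring

/-- The weight with which the harmonic `n - 2j` is damped by `P₊*`. -/
def edgeWeight (n j : ℕ) : ℂ := if j = 0 ∨ j = n then 1 else 1 / 2

/-- Let c_m be the p-th harmonic of U_m on the boundary, p = n - 2j. The moments are (c_{n+2} +
c_n)/2 and (c_n + c_{n-2})/2, with c_{n+2} = c_n. Also c_{n-2} = c_n away from the edge, while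
c_{n-2} = 0 for |p| = n; this forces the weights 1/2 and 1. -/
lemma bdryMoment_cancel {n j : ℕ} (hn : n ≠ 0) (hj : j ≤ n) (β : Ang) :
    (1 / 2) * bdryMoment (n + 1) ((n : ℤ) - 2 * j) β =
      edgeWeight n j * bdryMoment (n - 1) ((n : ℤ) - 2 * j) β := by
  have e1 : bdryCoeff (n + 1 + 1) ((n : ℤ) - 2 * j) β = bdryCoeff n ((n : ℤ) - 2 * j) β := by
    have h1 := bdryCoeff_of_le (m := n + 2) (j := j + 1) (by omega) β
    rw [show ((n + 2 : ℕ) : ℤ) - 2 * (j + 1 : ℕ) = (n : ℤ) - 2 * j by push_cast; ring] at h1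
    rw [bdryCoeff_of_le hj, ← h1]
    congr 1
  rw [bdryMoment_eq, bdryMoment_eq, e1, sub_add_cancel, add_sub_cancel_right, edgeWeight]
  by_cases hedge : j = 0 ∨ j = n
  · rw [if_pos hedge]
    have h0 : bdryCoeff ((n : ℤ) - 1 - 1) ((n : ℤ) - 2 * j) β = 0 := by
      obtain rfl | ⟨m, rfl⟩ : n = 1 ∨ ∃ m, n = m + 2 := by
        rcases n with _ | _ | m
        · exact absurd rfl hn
        · left; rfl
        · right; exact ⟨m, rfl⟩
      · exact bdryCoeff_neg_one _ _
      · have := bdryCoeff_of_lt (m := m) (p := ((m + 2 : ℕ) : ℤ) - 2 * j) (by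
          rcases hedge with rfl | rfl
          · rw [abs_of_nonneg] <;> push_cast <;> omega
          · rw [abs_of_nonpos] <;> push_cast <;> omega) β
        rw [← this]; congr 1; push_cast; ring
    rw [h0]; ring
  · rw [if_neg hedge]
    obtain ⟨m, rfl⟩ : ∃ m, n = m + 2 := ⟨n - 2, by omega⟩
    obtain ⟨k, rfl⟩ : ∃ k, j = k + 1 := ⟨j - 1, by omega⟩
    have h1 := bdryCoeff_of_le (m := m) (j := k) (by omega) β
    have h2 := bdryCoeff_of_le hj β
    have e3 : ((m + 2 : ℕ) : ℤ) - 2 * (k + 1 : ℕ) = (m : ℤ) - 2 * k := by push_cast; ring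
    have e4 : ((m + 2 : ℕ) : ℤ) - 1 - 1 = m := by push_cast; ring
    rw [h2, e3, e4, h1]

lemma bdryMoment_one_zero (β : Ang) : bdryMoment 1 0 β = 2 * π := by
  have h0 := bdryCoeff_of_le (m := 0) (j := 0) le_rfl β
  have h2 := bdryCoeff_of_le (m := 2) (j := 1) (by norm_num) β
  norm_num at h0 h2
  rw [bdryMoment_eq]
  norm_num
  rw [h0, h2]; ring

/-! ### Green's formula -/

lemma contDiff_chebU_offset (m : ℤ) (c : ℂ) (θ : Ang) :
    ContDiff ℝ ∞ fun x => c * chebU m (offset x θ) := by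
  have h1 : ContDiff ℝ ∞ (chebU m) :=
    (Differentiable.contDiff fun z => (hasDerivAt_chebU m z).differentiableAt).restrict_scalars ℝ
  have h2 : ContDiff ℝ ∞ fun x => (offset x θ : ℂ) :=
    (Complex.ofRealCLM.comp
      (Complex.imCLM.comp ((ContinuousLinearMap.mul ℝ ℂ).flip (dir θ)⁻¹))).contDiff
  exact contDiff_const.mul (h1.comp h2)

lemma offset_dir_eq (β θ : Ang) : offset (dir β) θ = sinA β * cosA θ - cosA β * sinA θ := by
  rw [offset, dir_inv_eq, dir_eq]
  simp; ring

/-- X_⊥ applied to U_m(s) gives -U_m'(s), and the component of X_⊥ along the outer normal at e^{iβ}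
is sin θ cos β - cos θ sin β = -s. Hence the plus sign inside and the factor s on the boundary. -/
lemma green_offset {h hx hy : ℂ → ℂ} {g : Ang → ℂ} (hh : IsH1 h hx hy) (hg : IsTrace h hx hy g)
    (m : ℤ) (θ : Ang) :
    ∫ x, chebU m (offset x θ) * Xperp hx hy x θ ∂discMeasure =
      (∫ x, dchebU m (offset x θ) * h x ∂discMeasure) -
        ∫ β, g β * (chebU m (offset (dir β) θ) * offset (dir β) θ) := by
  have iH := hh.memLp.integrable (by norm_num)
  have iX := hh.memLp_x.integrable (by norm_num)
  have iY := hh.memLp_y.integrable (by norm_num)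
  have iG := hg.memLp.integrable (by norm_num)
  have hgx := hg.green_x _ (contDiff_chebU_offset m (sinA θ) θ)
  have hgy := hg.green_y _ (contDiff_chebU_offset m (cosA θ) θ)
  have hd : ∀ (c : ℂ) (x v : ℂ), fderiv ℝ (fun x => c * chebU m (offset x θ)) x v =
      c * (((v * (dir θ)⁻¹).im : ℂ) * dchebU m (offset x θ)) := fun c x v => by
    have := (hasFDerivAt_comp_offset (x := x) (θ := θ) (hasDerivAt_chebU m _)).const_mul c
    rw [this.fderiv, ← fderiv_comp_offset (hasDerivAt_chebU m (offset x θ)),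
      (hasFDerivAt_comp_offset (x := x) (θ := θ) (hasDerivAt_chebU m _)).fderiv]
    rfl
  have hv1 : ((1 : ℂ) * (dir θ)⁻¹).im = -sinA θ := by rw [dir_inv_eq]; simp
  have hv2 : (Complex.I * (dir θ)⁻¹).im = cosA θ := by rw [dir_inv_eq]; simp
  simp only [hd, hv1, hv2] at hgx hgy
  have iL1 : Integrable (fun x => hx x * ((sinA θ : ℂ) * chebU m (offset x θ)) +
      h x * ((sinA θ : ℂ) * (((-sinA θ : ℝ) : ℂ) * dchebU m (offset x θ)))) discMeasure :=
    (integrable_mul_continuous iX (by fun_prop)).add (integrable_mul_continuous iH (by fun_prop))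
  have iL2 : Integrable (fun x => hy x * ((cosA θ : ℂ) * chebU m (offset x θ)) +
      h x * ((cosA θ : ℂ) * ((cosA θ : ℂ) * dchebU m (offset x θ)))) discMeasure :=
    (integrable_mul_continuous iY (by fun_prop)).add (integrable_mul_continuous iH (by fun_prop))
  have hbd : ∀ F : Ang → ℂ, Continuous F → Integrable (fun β => g β * F β) volume := fun F hF => by
    obtain ⟨C, hC⟩ := isCompact_univ.exists_bound_of_continuousOn hF.continuousOn
    exact iG.mul_bdd (c := C) hF.aestronglyMeasurable
      (Filter.Eventually.of_forall fun β => hC β trivial)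
  have hoc : Continuous fun β => (offset (dir β) θ : ℂ) := by fun_prop
  have iR1 : Integrable (fun β => g β * ((sinA θ : ℂ) * chebU m (offset (dir β) θ)) *
      (cosA β : ℂ)) volume := by
    simpa only [mul_assoc] using hbd (fun β => (sinA θ : ℂ) * (chebU m (offset (dir β) θ) *
      (cosA β : ℂ))) (by fun_prop)
  have iR2 : Integrable (fun β => g β * ((cosA θ : ℂ) * chebU m (offset (dir β) θ)) *
      (sinA β : ℂ)) volume := by
    simpa only [mul_assoc] using hbd (fun β => (cosA θ : ℂ) * (chebU m (offset (dir β) θ) *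
      (sinA β : ℂ))) (by fun_prop)
  have hdiff := congrArg₂ (· - ·) hgx hgy
  rw [← integral_sub iL1 iL2, ← integral_sub iR1 iR2] at hdiff
  have eR : ∫ β, g β * (chebU m (offset (dir β) θ) * offset (dir β) θ) =
      -∫ β, (g β * ((sinA θ : ℂ) * chebU m (offset (dir β) θ)) * (cosA β : ℂ) -
        g β * ((cosA θ : ℂ) * chebU m (offset (dir β) θ)) * (sinA β : ℂ)) := by
    rw [← integral_neg]
    refine integral_congr_ae (Filter.Eventually.of_forall fun β => ?_)
    have : (offset (dir β) θ : ℂ) = sinA β * cosA θ - cosA β * sinA θ := by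
      rw [offset_dir_eq]; push_cast; ring
    simp only
    generalize chebU m (offset (dir β) θ) = c
    rw [this]; ring
  have iD : Integrable (fun x => dchebU m (offset x θ) * h x) discMeasure := by
    simpa only [mul_comm] using
      integrable_mul_continuous iH (F := fun x => dchebU m (offset x θ)) (by fun_prop)
  have hcs : (cosA θ : ℂ) ^ 2 + (sinA θ : ℂ) ^ 2 = 1 := by
    exact_mod_cast cosA_sq_add_sinA_sq θ
  rw [eR, ← hdiff, sub_neg_eq_add]
  refine Eq.trans ?_ (integral_add iD (iL1.sub iL2))
  refine integral_congr_ae (Filter.Eventually.of_forall fun x => ?_)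
  simp only [Xperp]
  push_cast
  linear_combination h x * dchebU m (offset x θ) * hcs

lemma memLp_Xperp {h hx hy : ℂ → ℂ} (hh : IsH1 h hx hy) :
    MemLp (fun q : ℂ × Ang => Xperp hx hy q.1 q.2) 2 phaseMeasure := by
  have key : ∀ (f : ℂ → ℂ) (a : Ang → ℝ), MemLp f 2 discMeasure → Continuous a →
      (∀ θ, |a θ| ≤ 1) → MemLp (fun q : ℂ × Ang => (a q.2 : ℂ) * f q.1) 2 phaseMeasure := by
    intro f a hf ha hb
    have hm : Continuous fun q : ℂ × Ang => (a q.2 : ℂ) := by fun_prop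
    refine (memLp_fst hf).of_le (hm.aestronglyMeasurable.mul (memLp_fst hf).1)
      (Filter.Eventually.of_forall fun q => ?_)
    rw [norm_mul, Complex.norm_real, Real.norm_eq_abs]
    exact mul_le_of_le_one_left (norm_nonneg _) (hb _)
  exact (key hx sinA hh.memLp_x continuous_sinA abs_sinA_le).sub
    (key hy cosA hh.memLp_y continuous_cosA abs_cosA_le)

lemma memLp_Iperp {h hx hy : ℂ → ℂ} (hh : IsH1 h hx hy) :
    MemLp (Iperp hx hy) 2 influxMeasure :=
  memLp_rayTransform (F := fun q => Xperp hx hy q.1 q.2) (memLp_Xperp hh)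

lemma integral_profile_mul_Xperp {h hx hy : ℂ → ℂ} {g : Ang → ℂ} (hh : IsH1 h hx hy)
    (hg : IsTrace h hx hy g) (m p : ℤ) :
    ∫ q, (dir q.2 ^ p * chebU m (offset q.1 q.2)) * Xperp hx hy q.1 q.2 ∂phaseMeasure =
      (∫ q, (dir q.2 ^ p * dchebU m (offset q.1 q.2)) * h q.1 ∂phaseMeasure) -
        ∫ β, g β * bdryMoment m p β := by
  have iH := hh.memLp.integrable (by norm_num)
  have iG := hg.memLp.integrable (by norm_num)
  have i1 := integrable_phase_mul_continuous ((memLp_Xperp hh).integrable (by norm_num))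
    (continuous_profile p (continuous_chebU m))
  have i2 := integrable_phase_mul_continuous (iH.comp_fst (volume : Measure Ang))
    (continuous_profile p (continuous_dchebU m))
  have hc3 : Continuous fun r : Ang × Ang =>
      dir r.2 ^ p * (chebU m (offset (dir r.1) r.2) * (offset (dir r.1) r.2 : ℂ)) := by
    have ho : Continuous fun r : Ang × Ang => (offset (dir r.1) r.2 : ℂ) :=
      Complex.continuous_ofReal.comp
        (continuous_offset.comp ((continuous_dir.comp continuous_fst).prodMk continuous_snd))
    exact ((continuous_dir_zpow p).comp continuous_snd).mul
      (((continuous_chebU m).comp ho).mul ho)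
  have i3 : Integrable (fun r : Ang × Ang => g r.1 * (dir r.2 ^ p *
      (chebU m (offset (dir r.1) r.2) * (offset (dir r.1) r.2 : ℂ)))) (volume.prod volume) := by
    obtain ⟨C, hC⟩ := isCompact_univ.exists_bound_of_continuousOn hc3.continuousOn
    exact (iG.comp_fst (volume : Measure Ang)).mul_bdd (c := C) hc3.aestronglyMeasurable
      (Filter.Eventually.of_forall fun β => hC β trivial)
  have e3 : ∫ β, g β * bdryMoment m p β = ∫ θ : Ang, ∫ β : Ang, g β * (dir θ ^ p *
      (chebU m (offset (dir β) θ) * (offset (dir β) θ : ℂ))) := by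
    rw [← integral_prod_symm _ i3, integral_prod _ i3]
    simp only [integral_const_mul, bdryMoment]
  rw [phaseMeasure, integral_prod_symm _ i1, integral_prod_symm _ i2, e3,
    ← integral_sub i2.integral_prod_right i3.integral_prod_right]
  refine integral_congr_ae (Filter.Eventually.of_forall fun θ => ?_)
  have e4 : ∫ β : Ang, g β * (dir θ ^ p * (chebU m (offset (dir β) θ) * (offset (dir β) θ : ℂ))) =
      dir θ ^ p * ∫ β : Ang, g β * (chebU m (offset (dir β) θ) * (offset (dir β) θ : ℂ)) := by
    rw [← integral_const_mul]
    exact integral_congr_ae (Filter.Eventually.of_forall fun β => mul_left_comm _ _ _)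
  simp only [mul_assoc, integral_const_mul]
  rw [green_offset hh hg, mul_sub, e4]

/-! ### Reconstruction from `I_⊥` -/

lemma sinE_zero (p : ℤ) (b : BdrySM) : sinE p 0 b = 0 := by simp [sinE]

lemma sinE_natCast (p : ℤ) (n : ℕ) (b : BdrySM) : sinE p n b =
    dir (rayDir b) ^ p * ((cosA b.2 : ℂ) * chebU (n - 1) (sinA b.2)) := by
  cases n with
  | zero => simp [sinE_zero, chebU_neg_one]
  | succ n =>
    rw [Nat.cast_succ, sinE_eq_chebU, add_sub_cancel_right]

lemma cosA_mul_sinE (p : ℤ) (n : ℕ) (b : BdrySM) :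
    2 * ((cosA b.2 : ℂ) * sinE p (n + 1) b) = cosE p n b - cosE p (n + 2) b := by
  have h1 := sinE_eq_zeta p (n + 1) b
  have h2 := cosE_eq_zeta p n b
  have h3 := cosE_eq_zeta p (n + 2) b
  have hz := zeta_ne_zero b
  have hc : (cosA b.2 : ℂ) = (zeta b - (zeta b)⁻¹) / (2 * Complex.I) := by
    rw [← cosA_eq_zeta]; field_simp [Complex.I_ne_zero]
  push_cast at h1 h3
  rw [h1, h2, h3, hc, inv_pow, inv_pow, inv_pow, pow_succ, pow_add]
  have hI2 : (2 * Complex.I) ^ 2 = -4 := by rw [mul_pow, Complex.I_sq]; norm_num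
  have e : ∀ a b c : ℂ, 2 * (a / (2 * Complex.I) * (b * (c / (2 * Complex.I)))) =
      -(1 / 2) * (a * (b * c)) := fun a b c => by
    have : 2 * (a / (2 * Complex.I) * (b * (c / (2 * Complex.I)))) =
        2 * (a * (b * c)) / (2 * Complex.I) ^ 2 := by ring
    rw [this, hI2]; ring
  rw [e]
  field_simp
  ring

/-- The sine mode contains the factor cos α = sin γ, which is exactly the Santaló weight. For n = 0
both sides vanish, as U_{-1} = 0. -/
lemma integral_rayTransform_mul_sinE {F : ℂ × Ang → ℂ} (hF : MemLp F 2 phaseMeasure) (p : ℤ)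
    (n : ℕ) :
    ∫ b, rayTransform (fun x θ => F (x, θ)) b * sinE p n b ∂influxMeasure =
      ∫ q, (dir q.2 ^ p * chebU (n - 1) (offset q.1 q.2)) * F q ∂phaseMeasure := by
  rw [← integral_profile_mul p (continuous_chebU _) hF]
  refine integral_congr_ae (Filter.Eventually.of_forall fun b => ?_)
  simp only [sinE_natCast]
  ring

lemma integral_PplusDagger_mul_cosE_add_two {n j : ℕ} (hj : j ≤ n) {u : BdrySM → ℂ}
    (hu : MemLp u 2 influxMeasure) :
    ∫ b, PplusDagger u b * cosE ((n : ℤ) - 2 * j) (n + 2) b ∂influxMeasure =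
      -(1 / 2) * ∫ b, u b * sinE ((n : ℤ) - 2 * j) (n + 2) b ∂influxMeasure := by
  have heven : Even ((n : ℤ) - 2 * j - (n + 2)) := ⟨-j - 1, by ring⟩
  rw [integral_PplusDagger_mul hu (memLp_influx (memLp_cosE _ _)), ← integral_const_mul]
  refine integral_congr_ae ?_
  filter_upwards [PplusTranspose_cosE_of_lt heven (by omega) (by omega)] with b hb
  rw [hb]; ring

lemma integral_PplusDagger_mul_cosE {n j : ℕ} (hj : j ≤ n) {u : BdrySM → ℂ}
    (hu : MemLp u 2 influxMeasure) :
    ∫ b, PplusDagger u b * cosE ((n : ℤ) - 2 * j) n b ∂influxMeasure =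
      -edgeWeight n j * ∫ b, u b * sinE ((n : ℤ) - 2 * j) n b ∂influxMeasure := by
  rw [integral_PplusDagger_mul hu (memLp_influx (memLp_cosE _ _)), ← integral_const_mul]
  refine integral_congr_ae ?_
  have key : PplusTranspose (cosE ((n : ℤ) - 2 * j) n) =ᵐ[influxMeasure] fun b =>
      -edgeWeight n j * sinE ((n : ℤ) - 2 * j) n b := by
    -- For n = 0 the sine mode is zero, so the value of the weight is immaterial.
    rcases Nat.eq_zero_or_pos n with rfl | hn
    · filter_upwards [PplusTranspose_cosE (((0 : ℕ) : ℤ) - 2 * j) (0 : ℕ)] with b hb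
      rw [hb, Nat.cast_zero, sinE_zero, mul_zero, mul_zero]
    · rw [edgeWeight]
      split_ifs with h
      · exact PplusTranspose_cosE_of_eq (by omega) (by omega)
      · exact PplusTranspose_cosE_of_lt ⟨-j, by ring⟩ (by omega) (by omega)
  filter_upwards [key] with b hb
  rw [hb]; ring

/-! ### Edge harmonics, boundary terms and the second identity. -/

lemma dchebU_neg_one (z : ℂ) : dchebU (-1) z = 0 := by simp [dchebU]

lemma integral_zpow_mul_dchebU {n : ℕ} {p : ℤ} (hp : |p| = n) (x : ℂ) :
    ∫ θ, dir θ ^ p * dchebU (n - 1) (offset x θ) = 0 := by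
  rcases n with _ | _ | m
  · simp [dchebU_neg_one]
  · simp [dchebU_zero]
  · have h := integral_zpow_mul_eq_zero (dchebU_offset_mem_trig m x) (p := p) (by omega)
    rw [show ((m + 1 + 1 : ℕ) : ℤ) - 1 = m + 1 by push_cast; ring]
    exact h

/-- The weight differs from 1/2 only when |p| = n, and there the fibre integral vanishes because
U_{n-1}'(s) has degree below n in θ. -/
lemma edgeWeight_mul_integral_dchebU {n j : ℕ} {h : ℂ → ℂ} (hh : Integrable h discMeasure) :
    edgeWeight n j * ∫ q, (dir q.2 ^ ((n : ℤ) - 2 * j) * dchebU (n - 1) (offset q.1 q.2)) * h q.1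
        ∂phaseMeasure =
      (1 / 2) * ∫ q, (dir q.2 ^ ((n : ℤ) - 2 * j) * dchebU (n - 1) (offset q.1 q.2)) * h q.1
        ∂phaseMeasure := by
  rw [edgeWeight]
  split_ifs with hedge
  · have hi := integrable_phase_mul_continuous (hh.comp_fst (volume : Measure Ang))
      (continuous_profile ((n : ℤ) - 2 * j) (continuous_dchebU (n - 1)))
    have hp : |(n : ℤ) - 2 * j| = n := by
      rcases hedge with rfl | rfl
      · rw [abs_of_nonneg] <;> push_cast <;> omega
      · rw [abs_of_nonpos] <;> omega
    rw [phaseMeasure, integral_prod _ hi]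
    simp only [integral_mul_const, integral_zpow_mul_dchebU hp, zero_mul, integral_zero, mul_zero]
  · rfl

lemma integral_mul_bdryMoment {g : Ang → ℂ} (hg : ∫ β, g β = 0) {n j : ℕ} (hj : j ≤ n) :
    (1 / 2) * ∫ β, g β * bdryMoment (n + 1) ((n : ℤ) - 2 * j) β =
      edgeWeight n j * ∫ β, g β * bdryMoment (n - 1) ((n : ℤ) - 2 * j) β := by
  rcases Nat.eq_zero_or_pos n with rfl | hn
  -- This is the one place where the zero mean of the trace is needed: the left moment is the
  -- constant 2π and the right one is zero.
  · obtain rfl : j = 0 := by omega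
    have h0 : ∀ β, bdryMoment (-1) 0 β = 0 := fun β => by simp [bdryMoment, chebU_neg_one]
    simp [bdryMoment_one_zero, h0, integral_mul_const, hg]
  · rw [← integral_const_mul, ← integral_const_mul]
    refine integral_congr_ae (Filter.Eventually.of_forall fun β => ?_)
    have := bdryMoment_cancel hn.ne' hj β
    simp only
    linear_combination g β * this

lemma integral_PplusDagger_Iperp_mul {h hx hy : ℂ → ℂ} (hh : IsHDot1 h hx hy) {n j : ℕ}
    (hj : j ≤ n) :
    ∫ b, PplusDagger (Iperp hx hy) b * ((cosA b.2 : ℂ) * sinE ((n : ℤ) - 2 * j) (n + 1) b)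
        ∂influxMeasure =
      (n + 1) / 2 * ∫ q, (dir q.2 ^ ((n : ℤ) - 2 * j) * chebU n (offset q.1 q.2)) * h q.1
        ∂phaseMeasure := by
  obtain ⟨g, hg, hg0⟩ := hh.trace_mean
  have hu := memLp_Iperp hh.toIsH1
  have iH := hh.memLp.integrable (by norm_num)
  set p : ℤ := (n : ℤ) - 2 * j with hp
  have hw : ∀ q, Integrable (fun b => PplusDagger (Iperp hx hy) b * cosE p q b) influxMeasure :=
    fun q => (memLp_PplusDagger _).integrable_mul (memLp_influx (memLp_cosE _ _))
  have e1 : ∫ b, PplusDagger (Iperp hx hy) b * ((cosA b.2 : ℂ) * sinE p (n + 1) b)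
      ∂influxMeasure = (1 / 2) * (∫ b, PplusDagger (Iperp hx hy) b * cosE p n b ∂influxMeasure -
        ∫ b, PplusDagger (Iperp hx hy) b * cosE p (n + 2) b ∂influxMeasure) := by
    rw [← integral_sub (hw _) (hw _), ← integral_const_mul]
    refine integral_congr_ae (Filter.Eventually.of_forall fun b => ?_)
    have := cosA_mul_sinE p n b
    simp only
    linear_combination (1 / 2) * PplusDagger (Iperp hx hy) b * this
  have e2 := integral_rayTransform_mul_sinE (memLp_Xperp hh.toIsH1) p n
  have e3 := integral_rayTransform_mul_sinE (memLp_Xperp hh.toIsH1) p (n + 2)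
  rw [integral_profile_mul_Xperp hh.toIsH1 hg] at e2 e3
  push_cast at e3
  rw [show (n : ℤ) + 2 - 1 = n + 1 by ring] at e3
  have e4 := edgeWeight_mul_integral_dchebU (n := n) (j := j) iH
  have e5 := integral_mul_bdryMoment hg0 hj
  have i2 := fun m => integrable_phase_mul_continuous (iH.comp_fst (volume : Measure Ang))
    (continuous_profile p (continuous_dchebU m))
  have e6 : (∫ q, (dir q.2 ^ p * dchebU (n + 1) (offset q.1 q.2)) * h q.1 ∂phaseMeasure) -
      ∫ q, (dir q.2 ^ p * dchebU (n - 1) (offset q.1 q.2)) * h q.1 ∂phaseMeasure =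
      2 * (n + 1) * ∫ q, (dir q.2 ^ p * chebU n (offset q.1 q.2)) * h q.1 ∂phaseMeasure := by
    rw [← integral_const_mul]
    refine (integral_sub (i2 _) (i2 _)).symm.trans
      (integral_congr_ae (Filter.Eventually.of_forall fun q => ?_))
    have := dchebU_sub n (offset q.1 q.2)
    push_cast at this
    simp only
    linear_combination dir q.2 ^ p * h q.1 * this
  rw [← hp] at e4 e5
  rw [e1, integral_PplusDagger_mul_cosE hj hu, integral_PplusDagger_mul_cosE_add_two hj hu, ← hp]
  change (1 / 2) * (-edgeWeight n j * (∫ b, Iperp hx hy b * sinE p n b ∂influxMeasure) -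
    -(1 / 2) * ∫ b, Iperp hx hy b * sinE p (n + 2) b ∂influxMeasure) = _
  change ∫ b, Iperp hx hy b * sinE p n b ∂influxMeasure = _ at e2
  change ∫ b, Iperp hx hy b * sinE p (n + 2) b ∂influxMeasure = _ at e3
  rw [e2, e3]
  -- `e4` replaces the weight by 1/2 in the interior, `e5` cancels the boundary terms, and `e6`
  -- evaluates the remaining difference of derivatives.
  linear_combination (1 / 4) * e6 - (1 / 2) * e4 - (1 / 2) * e5

/-- The factor 2/(n+1) from I₀ of the ridge function cancels the factor (n+1)/2 of each harmonic,
and the 2π of the reproducing sum cancels the normalisation of the fibre average. -/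
lemma integral_ridge_mul_fiberAvg {h hx hy : ℂ → ℂ} (hh : IsHDot1 h hx hy) (n : ℕ) (ψ : Ang) :
    ∫ x, ridge n ψ x * fiberAvg (psiExt (PplusDagger (Iperp hx hy))) x ∂discMeasure =
      ∫ x, ridge n ψ x * h x ∂discMeasure := by
  have hn : (n + 1 : ℂ) ≠ 0 := by exact_mod_cast n.succ_ne_zero
  have hpi : (π : ℂ) ≠ 0 := by exact_mod_cast Real.pi_ne_zero
  have iH := hh.memLp.integrable (by norm_num)
  have hw := memLp_PplusDagger (Iperp hx hy)
  have hu : Integrable (fun q : ℂ × Ang => psiExt (PplusDagger (Iperp hx hy)) q.1 q.2)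
      phaseMeasure := (memLp_comp_entry hw).integrable (by norm_num)
  have hI : ∀ j ∈ Finset.range (n + 1), Integrable (fun b => (dir ψ)⁻¹ ^ ((n : ℤ) - 2 * j) *
      (PplusDagger (Iperp hx hy) b * ((cosA b.2 : ℂ) * sinE ((n : ℤ) - 2 * j) (n + 1) b)))
      influxMeasure := fun j _ =>
    (hw.integrable_mul (memLp_cosA_mul (memLp_influx (memLp_sinE _ _)))).const_mul _
  have e1 : ∫ q, ridge n ψ q.1 * psiExt (PplusDagger (Iperp hx hy)) q.1 q.2 ∂phaseMeasure =
      ∫ b, PplusDagger (Iperp hx hy) b * ((cosA b.2 : ℂ) * I0 (ridge n ψ) b) ∂influxMeasure := by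
    refine Eq.trans ?_ (integral_comp_entry_mul hw (memLp_fst (memLp_ridge n ψ)))
    exact integral_congr_ae (Filter.Eventually.of_forall fun q => mul_comm _ _)
  have e2 : ∫ b, PplusDagger (Iperp hx hy) b * ((cosA b.2 : ℂ) * I0 (ridge n ψ) b)
      ∂influxMeasure = 2 / (n + 1) * ∑ j ∈ Finset.range (n + 1), (dir ψ)⁻¹ ^ ((n : ℤ) - 2 * j) *
        ∫ b, PplusDagger (Iperp hx hy) b *
          ((cosA b.2 : ℂ) * sinE ((n : ℤ) - 2 * j) (n + 1) b) ∂influxMeasure := by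
    simp only [← integral_const_mul]
    rw [← integral_finsetSum _ hI, ← integral_const_mul]
    refine integral_congr_ae (Filter.Eventually.of_forall fun b => ?_)
    simp only [I0_ridge, Finset.mul_sum]
    exact Finset.sum_congr rfl fun j _ => by ring
  have e3 : ∀ j ∈ Finset.range (n + 1), (dir ψ)⁻¹ ^ ((n : ℤ) - 2 * j) *
      ∫ b, PplusDagger (Iperp hx hy) b *
        ((cosA b.2 : ℂ) * sinE ((n : ℤ) - 2 * j) (n + 1) b) ∂influxMeasure =
      (n + 1) / 2 * ((dir ψ)⁻¹ ^ ((n : ℤ) - 2 * j) *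
        ∫ q, (dir q.2 ^ ((n : ℤ) - 2 * j) * chebU n (offset q.1 q.2)) * h q.1 ∂phaseMeasure) :=
    fun j hj => by
      rw [integral_PplusDagger_Iperp_mul hh (Nat.lt_succ_iff.mp (Finset.mem_range.mp hj))]
      ring
  rw [integral_mul_fiberAvg hu (continuous_ridge n ψ), e1, e2, Finset.sum_congr rfl e3,
    ← Finset.mul_sum, sum_integral_profile_chebU n ψ iH]
  field_simp

theorem ae_eq_I0Sharp {h hx hy : ℂ → ℂ} (hh : IsHDot1 h hx hy) :
    h =ᵐ[discMeasure] fun x => (1 / (2 * π) : ℂ) * I0Sharp (PplusDagger (Iperp hx hy)) x := by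
  have hpi : (π : ℂ) ≠ 0 := by exact_mod_cast Real.pi_ne_zero
  have iH := hh.memLp.integrable (by norm_num)
  have iA : Integrable (fiberAvg (psiExt (PplusDagger (Iperp hx hy)))) discMeasure :=
    integrable_fiberAvg ((memLp_comp_entry (memLp_PplusDagger _)).integrable (by norm_num))
  have key := ae_eq_zero_of_integral_ridge (iH.sub iA) fun n ψ => by
    have h1 := integral_ridge_mul_fiberAvg hh n ψ
    have i1 := integrable_mul_continuous iH (continuous_ridge n ψ)
    have i2 := integrable_mul_continuous iA (continuous_ridge n ψ)
    simp only [mul_comm (ridge n ψ _)] at h1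
    simp only [Pi.sub_apply, sub_mul]
    rw [integral_sub i1 i2, h1, sub_self]
  filter_upwards [key] with x hx'
  rw [I0Sharp]
  simp only [Pi.sub_apply, Pi.zero_apply, sub_eq_zero] at hx'
  rw [hx']
  field_simp

end FanBeam

end

theorem proposition4p2 :
    (∀ f : ℂ → ℂ, MemLp f 2 FanBeam.discMeasure →
      MemLp (FanBeam.I0 f) 2 FanBeam.influxMeasure ∧
      MemLp (fun p : ℂ × FanBeam.Ang =>
          FanBeam.psiExt (FanBeam.PminusDagger (FanBeam.I0 f)) p.1 p.2) 2
        (FanBeam.discMeasure.prod volume) ∧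
      FanBeam.toDistr f =
        (-(1 / (2 * π))) • FanBeam.IperpSharp (FanBeam.PminusDagger (FanBeam.I0 f))) ∧
    (∀ h hx hy : ℂ → ℂ, FanBeam.IsHDot1 h hx hy →
      MemLp (FanBeam.Iperp hx hy) 2 FanBeam.influxMeasure ∧
      MemLp (fun p : ℂ × FanBeam.Ang =>
          FanBeam.psiExt (FanBeam.PplusDagger (FanBeam.Iperp hx hy)) p.1 p.2) 2
        (FanBeam.discMeasure.prod volume) ∧
      h =ᵐ[FanBeam.discMeasure] fun x =>
        (1 / (2 * π) : ℂ) *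
          FanBeam.I0Sharp (FanBeam.PplusDagger (FanBeam.Iperp hx hy)) x) :=
  ⟨fun _ hf => ⟨FanBeam.memLp_I0 hf, FanBeam.memLp_comp_entry (FanBeam.memLp_PminusDagger _),
    FanBeam.toDistr_eq_IperpSharp hf⟩,
  fun _ _ _ hh => ⟨FanBeam.memLp_Iperp hh.toIsH1,
    FanBeam.memLp_comp_entry (FanBeam.memLp_PplusDagger _), FanBeam.ae_eq_I0Sharp hh⟩⟩
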